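/- Let $Q$ be a smooth $n$-dimensional manifold, $(E,[\![\cdot,\cdot]\!]_E,\rho_E)$ a Lie algebroid over $Q$ (a smooth vector bundle of finite rank with a Lie bracket on its smooth sections and an anchor $\rho_E:E\to TQ$ satisfying the Leibniz rule), $k\ge 0$, and $L:\mathbb R^k\times\bigoplus^kE\to\mathbb R$ a smooth function, where $\bigoplus^k E=E\oplus\cdots\oplus E$ is the Whitney sum of $k$ copies of $E$. Write $\widetilde p:\mathbb R^k\times\bigoplus^kE\to Q$ and $\widetilde p^{\,*}:\mathbb R^k\times\bigoplus^kE^*\to Q$ for the projections. For $\pi:P\to Q$ equal to $\widetilde p$ or $\widetilde p^{\,*}$ let $\mathcal T^EP\to P$ be the vector bundle with fibres $$\mathcal T^E_pP=\{(a,v)\in E_{\pi(p)}\times T_pP:\ \rho_E(a)=T_p\pi(v)\}.$$ It carries a unique Lie algebroid structure with anchor $(a,v)\mapsto v$ and $$[\![(\sigma\circ\pi,U),(\tau\circ\pi,W)]\!]=([\![\sigma,\tau]\!]_E\circ\pi,[U,W])$$ for all smooth sections of $\mathcal T^EP$ of the form $(\sigma\circ\pi,U)$, $(\tau\circ\pi,W)$,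 with $\sigma,\tau$ smooth sections of $E$ and $U,W$ vector fields on $P$. The two resulting Lie algebroids are the Lagrangian prolongation $\mathcal T^E(\mathbb R^k\times\bigoplus^kE)$ and the Hamiltonian prolongation $\mathcal T^E(\mathbb R^k\times\bigoplus^kE^*)$. Write $d$ for the exterior differential of either of them. Let $Leg_L:\mathbb R^k\times\bigoplus^kE\to\mathbb R^k\times\bigoplus^kE^*$ be the Legendre transformation, $Leg_L(\mathbf t,e_1,\dots,e_k)=(\mathbf t,\ell^1,\dots,\ell^k)$ with $$\ell^A(u)=\frac{d}{ds}\Big|_{s=0}L(\mathbf t,e_1,\dots,e_A+su,\dots,e_k),\qquad u\in E_q,$$ where $q\in Q$ is the base point of $e_1,\dots,e_k$, and let $\mathcal T^ELeg_L(a,v)=(a,(Leg_L)_*v)$. Then the pair $(\mathcal T^ELeg_L,Leg_L)$ is a morphism of Lie algebroids from the Lagrangian to the Hamiltonian prolongation: it is a smooth vector bundle map, and the pullback by it commutes with the exterior differentials on smooth forms of every degree. Moreover, for $1\le A\le k$ let $\Theta^A$, $\Omega^A=-d\Theta^A$ be the Liouville sections, $\Theta^A_{(\mathbf t,e_1^*,\dots,e_k^*)}(a,v)=e_A^*(a)$,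 and let $\Theta_L^A$, $\Omega_L^A=-d\Theta_L^A$ be the Poincaré–Cartan sections, $\Theta_L^A=dL\circ\widetilde S^A$, where $\widetilde S^A(a,v)=(0,a^{v_A})$ and $a^{v_A}$ is the tangent vector at $s=0$ of the curve $s\mapsto(\mathbf t,e_1,\dots,e_A+sa,\dots,e_k)$. Then $$(\mathcal T^ELeg_L,Leg_L)^*\Theta^A=\Theta_L^A,\qquad(\mathcal T^ELeg_L,Leg_L)^*\Omega^A=\Omega_L^A,\qquad 1\le A\le k.$$ -/

import Mathlib

open Bundle Set Topology
open scoped Manifold ContDiff Bundle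

noncomputable section

/-! ### Whitney sums of copies of a vector bundle -/

section WhitneySum

/-- The `k`-fold Whitney sum `E ⊕ ⋯ ⊕ E` of a family of vector spaces: the fibre over `x` consists
of the `k`-tuples of elements of `E x`. -/
@[reducible] def WhitneySum (k : ℕ) {B : Type*} (E : B → Type*) : B → Type _ :=
  fun x => Fin k → E x

variable {B F : Type*} [TopologicalSpace B] [NormedAddCommGroup F] [NormedSpace ℝ F]
  {E : B → Type*} [TopologicalSpace (TotalSpace F E)]
  [∀ x, AddCommGroup (E x)] [∀ x, Module ℝ (E x)] [∀ x, TopologicalSpace (E x)]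

/-- The trivialization of the Whitney sum that applies `e` to every component. -/
def whitneyPretrivialization (k : ℕ) (e : Trivialization F (π F E)) [e.IsLinear ℝ] :
    Pretrivialization (Fin k → F) (π (Fin k → F) (WhitneySum k E)) where
  toFun p := ⟨p.1, fun A => e.linearMapAt ℝ p.1 (p.2 A)⟩
  invFun p := ⟨p.1, fun A => e.symmₗ ℝ p.1 (p.2 A)⟩
  source := TotalSpace.proj ⁻¹' e.baseSet
  target := e.baseSet ×ˢ Set.univ
  map_source' := fun ⟨_, _⟩ h => ⟨h, Set.mem_univ _⟩
  map_target' := fun ⟨_, _⟩ h => h.1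
  left_inv' := fun ⟨x, v⟩ h => by
    simp only [TotalSpace.mk_inj]
    funext A
    exact e.symmₗ_linearMapAt h (v A)
  right_inv' := fun ⟨x, v⟩ h => by
    simp only [Prod.mk_right_inj]
    funext A
    exact e.linearMapAt_symmₗ h.1 (v A)
  open_target := e.open_baseSet.prod isOpen_univ
  baseSet := e.baseSet
  open_baseSet := e.open_baseSet
  source_eq := rfl
  target_eq := rfl
  proj_toFun _ _ := rfl

instance whitneyPretrivialization.isLinear (k : ℕ) (e : Trivialization F (π F E)) [e.IsLinear ℝ] :
    (whitneyPretrivialization k e).IsLinear ℝ where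
  linear x _ :=
    { map_add v w := by
        funext A
        simp [whitneyPretrivialization, Pretrivialization.toFun']
      map_smul c v := by
        funext A
        simp [whitneyPretrivialization, Pretrivialization.toFun'] }

/-- Componentwise application of a linear map, as a continuous linear operation. -/
def whitneyMapCLM (k : ℕ) (F : Type*) [NormedAddCommGroup F] [NormedSpace ℝ F] :
    (F →L[ℝ] F) →L[ℝ] ((Fin k → F) →L[ℝ] (Fin k → F)) :=
  ∑ A : Fin k,
    (ContinuousLinearMap.compL ℝ (Fin k → F) F (Fin k → F)
        (ContinuousLinearMap.single ℝ (fun _ : Fin k => F) A)).comp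
      ((ContinuousLinearMap.compL ℝ (Fin k → F) F F).flip (ContinuousLinearMap.proj A))

theorem whitneyMapCLM_apply (k : ℕ) (f : F →L[ℝ] F) (v : Fin k → F) (A : Fin k) :
    whitneyMapCLM k F f v A = f (v A) := by
  simp only [whitneyMapCLM, sum_apply, Finset.sum_apply]
  rw [Finset.sum_eq_single A]
  · simp
  · intro b _ hb
    simp [Ne.symm hb]
  · simp

variable [FiberBundle F E] [VectorBundle ℝ F E]

theorem whitney_coordChange (k : ℕ) (e e' : Trivialization F (π F E))
    [MemTrivializationAtlas e] [MemTrivializationAtlas e'] {b : B}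
    (hb : b ∈ (whitneyPretrivialization k e).baseSet ∩ (whitneyPretrivialization k e').baseSet)
    (v : Fin k → F) :
    whitneyMapCLM k F (e.coordChangeL ℝ e' b : F →L[ℝ] F) v =
      (whitneyPretrivialization k e' ⟨b, (whitneyPretrivialization k e).symm b v⟩).2 := by
  have hb' : b ∈ e.baseSet ∩ e'.baseSet := hb
  funext A
  rw [whitneyMapCLM_apply, Pretrivialization.symm_apply _ hb.1]
  simp only [ContinuousLinearEquiv.coe_coe]
  rw [Trivialization.coordChangeL_apply _ _ hb']
  change _ = e'.linearMapAt ℝ b (e.symmₗ ℝ b (v A))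
  rw [Trivialization.coe_linearMapAt_of_mem _ hb'.2, Trivialization.coe_symmₗ]
  exact hb'.1

/-- The vector prebundle underlying the Whitney sum. -/
def whitneyPrebundle (k : ℕ) (F : Type*) [NormedAddCommGroup F] [NormedSpace ℝ F]
    (E : B → Type*) [TopologicalSpace (TotalSpace F E)]
    [∀ x, AddCommGroup (E x)] [∀ x, Module ℝ (E x)] [∀ x, TopologicalSpace (E x)]
    [FiberBundle F E] [VectorBundle ℝ F E] :
    VectorPrebundle ℝ (Fin k → F) (WhitneySum k E) where
  pretrivializationAtlas :=
    {e | ∃ (e₁ : Trivialization F (π F E)) (_ : MemTrivializationAtlas e₁),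
      e = whitneyPretrivialization k e₁}
  pretrivialization_linear' := by
    rintro _ ⟨e, he, rfl⟩
    infer_instance
  pretrivializationAt x := whitneyPretrivialization k (trivializationAt F E x)
  mem_base_pretrivializationAt x := mem_baseSet_trivializationAt F E x
  pretrivialization_mem_atlas x := ⟨trivializationAt F E x, inferInstance, rfl⟩
  exists_coordChange := by
    rintro _ ⟨e, he, rfl⟩ _ ⟨e', he', rfl⟩
    exact ⟨fun b => whitneyMapCLM k F (e.coordChangeL ℝ e' b : F →L[ℝ] F),
      (whitneyMapCLM k F).continuous.comp_continuousOn (continuousOn_coordChange ℝ e e'),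
      fun b hb v => whitney_coordChange k e e' hb v⟩
  totalSpaceMk_isInducing := by
    intro b
    have hb := mem_baseSet_trivializationAt F E b
    let φ : (Fin k → E b) ≃ₜ (Fin k → F) :=
      Homeomorph.piCongrRight fun _ =>
        ((trivializationAt F E b).continuousLinearEquivAt ℝ b hb).toHomeomorph
    have : IsInducing fun x => (b, φ x) := isInducing_const_prod.mpr φ.isInducing
    convert! this using 1
    funext v
    refine Prod.ext rfl ?_
    funext A
    exact congrFun (Trivialization.coe_linearMapAt_of_mem (R := ℝ) _ hb) (v A)

variable (k : ℕ)

instance WhitneySum.topologicalSpaceTotalSpace :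
    TopologicalSpace (TotalSpace (Fin k → F) (WhitneySum k E)) :=
  (whitneyPrebundle k F E).totalSpaceTopology

instance WhitneySum.fiberBundle : FiberBundle (Fin k → F) (WhitneySum k E) :=
  (whitneyPrebundle k F E).toFiberBundle

instance WhitneySum.vectorBundle : VectorBundle ℝ (Fin k → F) (WhitneySum k E) :=
  (whitneyPrebundle k F E).toVectorBundle

theorem whitney_trivializationAt_apply (x₀ : B)
    (p : TotalSpace (Fin k → F) (WhitneySum k E)) (A : Fin k) :
    (trivializationAt (Fin k → F) (WhitneySum k E) x₀ p).2 A =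
      (trivializationAt F E x₀).linearMapAt ℝ p.1 (p.2 A) :=
  rfl

variable {EB : Type*} [NormedAddCommGroup EB] [NormedSpace ℝ EB] {HB : Type*} [TopologicalSpace HB]
  {IB : ModelWithCorners ℝ EB HB} [ChartedSpace HB B] {m : WithTop ℕ∞}
  [ContMDiffVectorBundle m F E IB]

instance whitneyPrebundle.isContMDiff : (whitneyPrebundle k F E).IsContMDiff IB m where
  exists_contMDiffCoordChange := by
    rintro _ ⟨e, he, rfl⟩ _ ⟨e', he', rfl⟩
    exact ⟨fun b => whitneyMapCLM k F (e.coordChangeL ℝ e' b : F →L[ℝ] F),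
      (whitneyMapCLM k F).contMDiff.comp_contMDiffOn (contMDiffOn_coordChangeL e e'),
      fun b hb v => whitney_coordChange k e e' hb v⟩

instance WhitneySum.contMDiffVectorBundle :
    ContMDiffVectorBundle m (Fin k → F) (WhitneySum k E) IB :=
  (whitneyPrebundle k F E).contMDiffVectorBundle IB

end WhitneySum

/-! ### Lie algebroids, their exterior differential and their morphisms -/

section LieAlgebroid

variable {EM : Type*} [NormedAddCommGroup EM] [NormedSpace ℝ EM] {H : Type*} [TopologicalSpace H]
  (I : ModelWithCorners ℝ EM H) {M : Type*} [TopologicalSpace M] [ChartedSpace H M]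

/-- The space `Sec(E)` of smooth sections of a smooth vector bundle. -/
def smoothSections (F : Type*) [NormedAddCommGroup F] [NormedSpace ℝ F] (E : M → Type*)
    [TopologicalSpace (TotalSpace F E)] [∀ x, AddCommGroup (E x)] [∀ x, Module ℝ (E x)]
    [∀ x, TopologicalSpace (E x)] [FiberBundle F E] [VectorBundle ℝ F E] :
    Submodule ℝ (∀ x, E x) where
  carrier := {σ | ContMDiff I (I.prod 𝓘(ℝ, F)) ∞ (fun x => TotalSpace.mk' F x (σ x))}
  add_mem' ha hb := ContMDiff.add_section ha hb
  zero_mem' := contMDiff_zeroSection ℝ E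
  smul_mem' _ _ ha := ContMDiff.const_smul_section ha

/-- The derivative at `x` of the real function `f` along the tangent vector `v`. -/
def tangentDeriv {x : M} (v : TangentSpace I x) (f : M → ℝ) : ℝ :=
  mfderiv I 𝓘(ℝ, ℝ) f x v

/-- A Lie algebroid structure on the vector bundle over `M` with fibres `V x`, whose space of smooth
sections is `Γ`: a Lie bracket on `Γ` and a smooth fibrewise linear anchor map into `TM` that satisfy
the Leibniz rule `⟦σ, f τ⟧ = f ⟦σ, τ⟧ + (ρ(σ) f) τ`. -/
@[ext] structure LieAlgebroid [IsManifold I 1 M] {V : M → Type*}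
    [∀ x, AddCommGroup (V x)] [∀ x, Module ℝ (V x)] (Γ : Submodule ℝ (∀ x, V x)) where
  /-- the anchor map `ρ` -/
  anchor : ∀ x, V x →ₗ[ℝ] TangentSpace I x
  /-- the Lie bracket of sections -/
  bracket : Γ →ₗ[ℝ] Γ →ₗ[ℝ] Γ
  contMDiff_anchor : ∀ σ : Γ,
    ContMDiff I I.tangent ∞ (fun x => (⟨x, anchor x (σ.1 x)⟩ : TangentBundle I M))
  bracket_self : ∀ σ : Γ, bracket σ σ = 0
  jacobi : ∀ σ τ υ : Γ,
    bracket σ (bracket τ υ) + bracket τ (bracket υ σ) + bracket υ (bracket σ τ) = 0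
  leibniz : ∀ (σ τ τ' : Γ) (f : M → ℝ), ContMDiff I 𝓘(ℝ, ℝ) ∞ f →
    (∀ x, τ'.1 x = f x • τ.1 x) →
    ∀ x, (bracket σ τ').1 x =
      f x • (bracket σ τ).1 x + tangentDeriv I (anchor x (σ.1 x)) f • τ.1 x

variable {I}
variable {V : M → Type*} [∀ x, AddCommGroup (V x)] [∀ x, Module ℝ (V x)]

/-- Families of alternating `l`-forms on the fibres: (not necessarily smooth) sections of
`⋀ˡ V*`. -/
abbrev FormField (V : M → Type*) [∀ x, AddCommGroup (V x)] [∀ x, Module ℝ (V x)] (l : ℕ) :=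
  ∀ x, (V x) [⋀^Fin l]→ₗ[ℝ] ℝ

/-- Smoothness of a section of `⋀ˡ V*`: its values on smooth sections of `V` are smooth. -/
def IsSmoothForm (I : ModelWithCorners ℝ EM H) (Γ : Submodule ℝ (∀ x, V x)) {l : ℕ}
    (μ : FormField V l) : Prop :=
  ∀ X : Fin l → Γ, ContMDiff I 𝓘(ℝ, ℝ) ∞ (fun x => μ x (fun m => (X m).1 x))

/-- A section of `V*` as a `1`-form. -/
def oneForm (θ : ∀ x, V x →ₗ[ℝ] ℝ) : FormField V 1 :=
  fun x => AlternatingMap.ofSubsingleton ℝ (V x) ℝ (0 : Fin 1) (θ x)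

namespace LieAlgebroid

variable [IsManifold I 1 M] {Γ : Submodule ℝ (∀ x, V x)} (𝓐 : LieAlgebroid I Γ)

/-- The terms of the exterior differential that contain brackets,
`∑_{i<j} (-1)^{i+j} μ(⟦X_i, X_j⟧, X_0, …, X̂_i, …, X̂_j, …)`. Here `i : Fin (l + 1)` stands for the
index `i.castSucc` of the full list, which it also labels after `X_j`, `j > i`, has been removed. -/
def bracketSum : {l : ℕ} → FormField V l → (Fin (l + 1) → Γ) → M → ℝ
  | 0, _, _, _ => 0
  | l + 1, μ, X, x =>
    ∑ j : Fin (l + 2), ∑ i : Fin (l + 1),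
      if i.castSucc < j then
        (-1 : ℝ) ^ ((i : ℕ) + (j : ℕ)) *
          μ x (Fin.cons ((𝓐.bracket (X i.castSucc) (X j)).1 x)
            (fun m : Fin l => (i.removeNth (j.removeNth X) m).1 x))
      else 0

/-- The value of the exterior differential of `μ` on the smooth sections `X_0, …, X_l`:
`∑_i (-1)^i ρ(X_i) μ(X_0, …, X̂_i, …, X_l) + ∑_{i<j} (-1)^{i+j} μ(⟦X_i, X_j⟧, …, X̂_i, …, X̂_j, …)`. -/
def koszul {l : ℕ} (μ : FormField V l) (X : Fin (l + 1) → Γ) (x : M) : ℝ :=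
  (∑ i : Fin (l + 1), (-1 : ℝ) ^ (i : ℕ) *
      tangentDeriv I (𝓐.anchor x ((X i).1 x))
        (fun y => μ y (fun m : Fin l => (i.removeNth X m).1 y)))
    + 𝓐.bracketSum μ X x

open Classical in
/-- The exterior differential: `d μ` is the `(l+1)`-form whose values on smooth sections are given by
`koszul`. -/
def d {l : ℕ} (μ : FormField V l) : FormField V (l + 1) :=
  if h : ∃ ν : FormField V (l + 1), ∀ (X : Fin (l + 1) → Γ) (x : M),
      ν x (fun m => (X m).1 x) = 𝓐.koszul μ X x
  then h.choose else 0

/-- The exterior differential of a function, `(d f)(a) = ρ(a) f`. -/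
def dFun (f : M → ℝ) (x : M) : V x →ₗ[ℝ] ℝ :=
  (mfderiv I 𝓘(ℝ, ℝ) f x).toLinearMap ∘ₗ 𝓐.anchor x

end LieAlgebroid

variable {EM' : Type*} [NormedAddCommGroup EM'] [NormedSpace ℝ EM'] {H' : Type*}
  [TopologicalSpace H'] {I' : ModelWithCorners ℝ EM' H'} {M' : Type*} [TopologicalSpace M']
  [ChartedSpace H' M'] {V' : M' → Type*} [∀ x, AddCommGroup (V' x)] [∀ x, Module ℝ (V' x)]

/-- The pullback of an `l`-form by the vector bundle map `(Φ, φ)`: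
`(Φ^* μ)_x(e_1, …, e_l) = μ_{φ x}(Φ e_1, …, Φ e_l)`. -/
def pullbackForm (φ : M → M') (Φ : ∀ x, V x →ₗ[ℝ] V' (φ x)) {l : ℕ} (μ : FormField V' l) :
    FormField V l :=
  fun x => (μ (φ x)).compLinearMap (Φ x)

/-- The pair `(Φ, φ)` is a morphism of Lie algebroids: it is a smooth vector bundle map with
`d (Φ^* μ) = Φ^* (d μ)` for the smooth forms `μ` of every degree. -/
structure IsLieAlgebroidMorphism [IsManifold I 1 M] [IsManifold I' 1 M']
    {Γ : Submodule ℝ (∀ x, V x)} {Γ' : Submodule ℝ (∀ x, V' x)}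
    (𝓐 : LieAlgebroid I Γ) (𝓑 : LieAlgebroid I' Γ')
    (φ : M → M') (Φ : ∀ x, V x →ₗ[ℝ] V' (φ x)) : Prop where
  contMDiff_base : ContMDiff I I' ∞ φ
  isSmoothForm_pullback : ∀ (l : ℕ) (μ : FormField V' l),
    IsSmoothForm I' Γ' μ → IsSmoothForm I Γ (pullbackForm φ Φ μ)
  d_pullback : ∀ (l : ℕ) (μ : FormField V' l), IsSmoothForm I' Γ' μ →
    𝓐.d (pullbackForm φ Φ μ) = pullbackForm φ Φ (𝓑.d μ)

end LieAlgebroid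

/-! ### The prolongation of a Lie algebroid over a fibration -/

section Prolongation

variable {EM : Type*} [NormedAddCommGroup EM] [NormedSpace ℝ EM] {H : Type*} [TopologicalSpace H]
  {I : ModelWithCorners ℝ EM H} {Q : Type*} [TopologicalSpace Q] [ChartedSpace H Q]
  [IsManifold I 1 Q]
  {F : Type*} [NormedAddCommGroup F] [NormedSpace ℝ F] {E : Q → Type*}
  [TopologicalSpace (TotalSpace F E)] [∀ x, AddCommGroup (E x)] [∀ x, Module ℝ (E x)]
  [∀ x, TopologicalSpace (E x)] [FiberBundle F E] [VectorBundle ℝ F E]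
  (𝓔 : LieAlgebroid I (smoothSections I F E))
  {EP : Type*} [NormedAddCommGroup EP] [NormedSpace ℝ EP] {HP : Type*} [TopologicalSpace HP]
  (IP : ModelWithCorners ℝ EP HP) {P : Type*} [TopologicalSpace P] [ChartedSpace HP P]

/-- The fibre `{(a, v) ∈ E_{π p} × T_p P | ρ(a) = T_p π (v)}` of the prolongation of the Lie
algebroid `E` over `π : P → Q`. -/
def prolongationFiber (proj : P → Q) (p : P) : Submodule ℝ (E (proj p) × TangentSpace IP p) :=
  LinearMap.eqLocus (𝓔.anchor (proj p) ∘ₗ LinearMap.fst ℝ _ _)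
    ((mfderiv IP I proj p).toLinearMap ∘ₗ LinearMap.snd ℝ _ _)

/-- The prolongation `𝒯ᴱP` of `E` over `π : P → Q`, as a family of vector spaces over `P`. -/
abbrev Prolongation (proj : P → Q) : P → Type _ := fun p => prolongationFiber 𝓔 IP proj p

/-- The smooth sections of `𝒯ᴱP ⊆ E × TP`: both components are smooth maps, into the total space of
`E` and into `TP`. -/
def prolongationSections [IsManifold IP 1 P] (proj : P → Q) (hproj : ContMDiff IP I ∞ proj) :
    Submodule ℝ (∀ p, Prolongation 𝓔 IP proj p) where
  carrier := {X |
    ContMDiff IP (I.prod 𝓘(ℝ, F)) ∞ (fun p => (⟨proj p, (X p).1.1⟩ : TotalSpace F E)) ∧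
    ContMDiff IP IP.tangent ∞ (fun p => (⟨p, (X p).1.2⟩ : TangentBundle IP P))}
  add_mem' {X Y} hX hY := by
    refine ⟨fun p => ?_, ContMDiff.add_section hX.2 hY.2⟩
    have h1 := contMDiffAt_totalSpace.1 (hX.1 p)
    have h2 := contMDiffAt_totalSpace.1 (hY.1 p)
    refine contMDiffAt_totalSpace.2 ⟨h1.1, (h1.2.add h2.2).congr_of_eventuallyEq ?_⟩
    have hc : ContinuousAt proj p := h1.1.continuousAt
    filter_upwards [hc.preimage_mem_nhds ((trivializationAt F E (proj p)).open_baseSet.mem_nhds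
      (mem_baseSet_trivializationAt F E (proj p)))] with y hy
    exact ((trivializationAt F E (proj p)).linear ℝ hy).1 _ _
  zero_mem' := ⟨(contMDiff_zeroSection ℝ E).comp hproj, contMDiff_zeroSection ℝ _⟩
  smul_mem' c X hX := by
    refine ⟨fun p => ?_, ContMDiff.const_smul_section hX.2⟩
    have h1 := contMDiffAt_totalSpace.1 (hX.1 p)
    refine contMDiffAt_totalSpace.2 ⟨h1.1, ((contMDiffAt_const (I := IP) (I' := 𝓘(ℝ, ℝ)) (c := c)).smul h1.2).congr_of_eventuallyEq ?_⟩
    have hc : ContinuousAt proj p := h1.1.continuousAt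
    filter_upwards [hc.preimage_mem_nhds ((trivializationAt F E (proj p)).open_baseSet.mem_nhds
      (mem_baseSet_trivializationAt F E (proj p)))] with y hy
    exact ((trivializationAt F E (proj p)).linear ℝ hy).2 _ _

variable {IP}

/-- `𝓐` is the prolongation Lie algebroid structure on `𝒯ᴱP`: the anchor is the projection onto the
second factor, and on projectable sections `X = (σ ∘ π, U)`, `Y = (τ ∘ π, W)` the bracket is
`⟦X, Y⟧ = (⟦σ, τ⟧ ∘ π, [U, W])`. -/
structure IsProlongation [IsManifold IP 1 P] {proj : P → Q} {hproj : ContMDiff IP I ∞ proj}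
    (𝓐 : LieAlgebroid IP (prolongationSections 𝓔 IP proj hproj)) : Prop where
  anchor_apply : ∀ (p : P) (x : Prolongation 𝓔 IP proj p), 𝓐.anchor p x = x.1.2
  bracket_projectable : ∀ (X Y : prolongationSections 𝓔 IP proj hproj)
    (σ τ : smoothSections I F E), (∀ p, (X.1 p).1.1 = σ.1 (proj p)) →
    (∀ p, (Y.1 p).1.1 = τ.1 (proj p)) → ∀ p,
      ((𝓐.bracket X Y).1 p).1 =
        ((𝓔.bracket σ τ).1 (proj p),
          VectorField.mlieBracket IP (fun y => (X.1 y).1.2) (fun y => (Y.1 y).1.2) p)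

end Prolongation

/-! ### The manifolds `ℝᵏ × (E ⊕ ⋯ ⊕ E)` and `ℝᵏ × (E* ⊕ ⋯ ⊕ E*)` -/

section PhaseSpace

/-- The total space of `ℝᵏ × (E ⊕ ⋯ ⊕ E)`. -/
abbrev PhaseSpace (k : ℕ) {Q : Type*} (F : Type*) (E : Q → Type*) :=
  EuclideanSpace ℝ (Fin k) × TotalSpace (Fin k → F) (WhitneySum k E)

/-- The projection of `ℝᵏ × (E ⊕ ⋯ ⊕ E)` onto the base of `E`. -/
abbrev phaseProj {k : ℕ} {Q : Type*} {F : Type*} {E : Q → Type*} (p : PhaseSpace k F E) : Q :=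
  p.2.proj

/-- The model with corners of `ℝᵏ × (E ⊕ ⋯ ⊕ E)`, `E` of typical fibre `F` over an `n`-manifold. -/
abbrev phaseModel (n k : ℕ) (F : Type*) [NormedAddCommGroup F] [NormedSpace ℝ F] :=
  (𝓡 k).prod ((𝓡 n).prod 𝓘(ℝ, Fin k → F))

/-- The dual `E*` of a vector bundle. -/
abbrev DualBundle {Q : Type*} (E : Q → Type*) [∀ x, AddCommGroup (E x)] [∀ x, Module ℝ (E x)]
    [∀ x, TopologicalSpace (E x)] : Q → Type _ :=
  fun q => E q →L[ℝ] ℝ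

/-- The point `(t, e_1, …, e_A + u, …, e_k)`. -/
def shiftAt {k : ℕ} {Q : Type*} {F : Type*} {E : Q → Type*} [∀ x, AddCommGroup (E x)]
    (A : Fin k) (p : PhaseSpace k F E) (u : E (phaseProj p)) : PhaseSpace k F E :=
  (p.1, ⟨p.2.proj, Function.update p.2.snd A (p.2.snd A + u)⟩)

variable {n k : ℕ} {Q : Type*} [TopologicalSpace Q] [ChartedSpace (EuclideanSpace ℝ (Fin n)) Q]
  {F : Type*} [NormedAddCommGroup F] [NormedSpace ℝ F]
  {E : Q → Type*} [TopologicalSpace (TotalSpace F E)] [∀ x, AddCommGroup (E x)]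
  [∀ x, Module ℝ (E x)] [∀ x, TopologicalSpace (E x)] [FiberBundle F E] [VectorBundle ℝ F E]

theorem contMDiff_phaseProj :
    ContMDiff (phaseModel n k F) (𝓡 n) ∞ (phaseProj : PhaseSpace k F E → Q) :=
  (contMDiff_proj (WhitneySum k E)).comp contMDiff_snd

/-- Smoothness of a map into `ℝᵏ × (E ⊕ ⋯ ⊕ E)`, read in a trivialization of `E`. -/
theorem contMDiffAt_phase_iff {EM : Type*} [NormedAddCommGroup EM] [NormedSpace ℝ EM]
    {H : Type*} [TopologicalSpace H] {I : ModelWithCorners ℝ EM H} {M : Type*} [TopologicalSpace M]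
    [ChartedSpace H M] {f : M → PhaseSpace k F E} {x₀ : M} :
    ContMDiffAt I (phaseModel n k F) ∞ f x₀ ↔
      ContMDiffAt I (𝓡 k) ∞ (fun x => (f x).1) x₀ ∧
      ContMDiffAt I (𝓡 n) ∞ (fun x => phaseProj (f x)) x₀ ∧
      ∀ B, ContMDiffAt I 𝓘(ℝ, F) ∞ (fun x =>
        (trivializationAt F E (phaseProj (f x₀))).linearMapAt ℝ (phaseProj (f x))
          ((f x).2.snd B)) x₀ := by
  rw [contMDiffAt_prod_iff, contMDiffAt_totalSpace, contMDiffAt_pi_space]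
  rfl

/-- The translation `w ↦ (t, e_1, …, e_A + w, …, e_k)`, with `w` in the typical fibre, depends
smoothly on the point and on `w`. -/
theorem contMDiffAt_shift (A : Fin k) (p₀ : PhaseSpace k F E) (w₀ : F) :
    ContMDiffAt ((phaseModel n k F).prod 𝓘(ℝ, F)) (phaseModel n k F) ∞
      (fun z : PhaseSpace k F E × F =>
        shiftAt A z.1 ((trivializationAt F E (phaseProj p₀)).symm (phaseProj z.1) z.2))
      (p₀, w₀) := by
  have hid := (contMDiffAt_phase_iff (n := n)).1
    (contMDiffAt_fst (I := phaseModel n k F) (J := 𝓘(ℝ, F)) (n := ∞) (p := (p₀, w₀)))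
  refine contMDiffAt_phase_iff.2 ⟨hid.1, hid.2.1, fun B => ?_⟩
  have hmem : ∀ᶠ z : PhaseSpace k F E × F in 𝓝 (p₀, w₀),
      phaseProj z.1 ∈ (trivializationAt F E (phaseProj p₀)).baseSet :=
    hid.2.1.continuousAt.preimage_mem_nhds
      ((trivializationAt F E (phaseProj p₀)).open_baseSet.mem_nhds
        (mem_baseSet_trivializationAt F E (phaseProj p₀)))
  by_cases hB : B = A
  · subst hB
    refine ((hid.2.2 B).add contMDiffAt_snd).congr_of_eventuallyEq ?_
    filter_upwards [hmem] with z hz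
    change (trivializationAt F E (phaseProj p₀)).linearMapAt ℝ (phaseProj z.1)
      (Function.update z.1.2.snd B _ B) = _
    rw [Function.update_self, map_add]
    congr 1
    have := (trivializationAt F E (phaseProj p₀)).linearMapAt_symmₗ (R := ℝ) hz z.2
    rwa [Trivialization.coe_symmₗ _ hz] at this
  · refine (hid.2.2 B).congr_of_eventuallyEq ?_
    filter_upwards with z
    change (trivializationAt F E (phaseProj p₀)).linearMapAt ℝ (phaseProj z.1)
      (Function.update z.1.2.snd A _ B) = _
    rw [Function.update_of_ne hB]

/-- The curve `s ↦ (t, e_1, …, e_A + s u, …, e_k)`. -/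
def shiftCurve (A : Fin k) (p : PhaseSpace k F E) (u : E (phaseProj p)) (s : ℝ) :
    PhaseSpace k F E :=
  shiftAt A p (s • u)

/-- The affine inclusion of the typical fibre into the directions of `e_A`. -/
def shiftIncl (A : Fin k) (p : PhaseSpace k F E) (w : F) : PhaseSpace k F E :=
  shiftAt A p ((trivializationAt F E (phaseProj p)).symm (phaseProj p) w)

theorem shiftIncl_zero (A : Fin k) (p : PhaseSpace k F E) : shiftIncl A p (0 : F) = p := by
  have h := mem_baseSet_trivializationAt F E (phaseProj p)
  have : (trivializationAt F E (phaseProj p)).symm (phaseProj p) (0 : F) = 0 := by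
    rw [← Trivialization.coe_symmₗ (R := ℝ) _ h, map_zero]
  simp [shiftIncl, shiftAt, this]

theorem shiftCurve_eq (A : Fin k) (p : PhaseSpace k F E) (u : E (phaseProj p)) (s : ℝ) :
    shiftCurve A p u s =
      shiftIncl A p (s • (trivializationAt F E (phaseProj p)).continuousLinearEquivAt ℝ _
        (mem_baseSet_trivializationAt F E (phaseProj p)) u) := by
  have h := mem_baseSet_trivializationAt F E (phaseProj p)
  unfold shiftCurve shiftIncl
  congr 1
  rw [← map_smul]
  exact (((trivializationAt F E (phaseProj p)).continuousLinearEquivAt ℝ _ h).symm_apply_apply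
    _).symm

theorem contMDiffAt_shiftIncl (A : Fin k) (p : PhaseSpace k F E) (w : F) :
    ContMDiffAt 𝓘(ℝ, F) (phaseModel n k F) ∞ (shiftIncl A p : F → PhaseSpace k F E) w :=
  (contMDiffAt_shift (n := n) A p w).comp w (contMDiffAt_const.prodMk contMDiffAt_id)

/-- The typical-fibre coordinates of the elements of a fibre. -/
def fiberCoord (F : Type*) [NormedAddCommGroup F] [NormedSpace ℝ F] {E : Q → Type*}
    [TopologicalSpace (TotalSpace F E)] [∀ x, AddCommGroup (E x)] [∀ x, Module ℝ (E x)]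
    [∀ x, TopologicalSpace (E x)] [FiberBundle F E] [VectorBundle ℝ F E] (q : Q) : E q ≃L[ℝ] F :=
  (trivializationAt F E q).continuousLinearEquivAt ℝ q (mem_baseSet_trivializationAt F E q)

theorem mfderiv_shiftCurve (A : Fin k) (p : PhaseSpace k F E) (u : E (phaseProj p)) :
    mfderiv 𝓘(ℝ, ℝ) (phaseModel n k F) (shiftCurve A p u) 0 (1 : ℝ) =
      mfderiv 𝓘(ℝ, F) (phaseModel n k F) (shiftIncl A p) (0 : F) (fiberCoord F _ u) := by
  set c : ℝ →L[ℝ] F := ContinuousLinearMap.toSpanSingleton ℝ (fiberCoord F _ u) with hc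
  have h0 : c 0 = 0 := map_zero c
  have hcurve : shiftCurve A p u = shiftIncl A p ∘ c := funext fun s => by
    rw [shiftCurve_eq]
    rfl
  have hd : MDifferentiableAt 𝓘(ℝ, F) (phaseModel n k F) (shiftIncl A p) (c 0) :=
    (contMDiffAt_shiftIncl (n := n) A p (c 0)).mdifferentiableAt (by simp)
  rw [hcurve, mfderiv_comp (I' := 𝓘(ℝ, F)) 0 hd
    ((c.contMDiff (n := 1)).contMDiffAt.mdifferentiableAt (by simp))]
  have hc' : mfderiv 𝓘(ℝ, ℝ) 𝓘(ℝ, F) c 0 (1 : ℝ) = fiberCoord F _ u := by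
    rw [ContinuousLinearMap.mfderiv_eq]
    exact one_smul ℝ (fiberCoord F _ u)
  change mfderiv 𝓘(ℝ, F) (phaseModel n k F) (shiftIncl A p) (c 0)
    (mfderiv 𝓘(ℝ, ℝ) 𝓘(ℝ, F) c 0 (1 : ℝ)) = _
  rw [hc', h0]

/-- The vector `(a)^{v_A} ∈ T_p(ℝᵏ × (E ⊕ ⋯ ⊕ E))`, tangent at `s = 0` to the curve
`s ↦ (t, e_1, …, e_A + s a, …, e_k)`, as a linear function of `a`. -/
def verticalVector (n : ℕ) {k : ℕ} {Q : Type*} [TopologicalSpace Q]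
    [ChartedSpace (EuclideanSpace ℝ (Fin n)) Q]
    {F : Type*} [NormedAddCommGroup F] [NormedSpace ℝ F]
    {E : Q → Type*} [TopologicalSpace (TotalSpace F E)] [∀ x, AddCommGroup (E x)]
    [∀ x, Module ℝ (E x)] [∀ x, TopologicalSpace (E x)] [FiberBundle F E] [VectorBundle ℝ F E]
    (A : Fin k) (p : PhaseSpace k F E) :
    E (phaseProj p) →ₗ[ℝ] TangentSpace (phaseModel n k F) p where
  toFun a := mfderiv 𝓘(ℝ, ℝ) (phaseModel n k F) (shiftCurve A p a) 0 (1 : ℝ)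
  map_add' a b := by
    refine (mfderiv_shiftCurve A p (a + b)).trans ?_
    rw [map_add]
    refine (map_add (mfderiv 𝓘(ℝ, F) (phaseModel n k F) (shiftIncl A p) (0 : F)) _ _).trans ?_
    exact congrArg₂ (· + ·) (mfderiv_shiftCurve A p a).symm (mfderiv_shiftCurve A p b).symm
  map_smul' c a := by
    refine (mfderiv_shiftCurve A p (c • a)).trans ?_
    rw [map_smul]
    refine (map_smul (mfderiv 𝓘(ℝ, F) (phaseModel n k F) (shiftIncl A p) (0 : F)) _ _).trans ?_
    exact congrArg (c • ·) (mfderiv_shiftCurve A p a).symm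

theorem mfderiv_phaseProj_verticalVector (A : Fin k) (p : PhaseSpace k F E)
    (a : E (phaseProj p)) :
    mfderiv (phaseModel n k F) (𝓡 n) phaseProj p (verticalVector n A p a) = 0 := by
  have h1 : verticalVector n A p a =
      mfderiv 𝓘(ℝ, F) (phaseModel n k F) (shiftIncl A p) (0 : F) (fiberCoord F _ a) :=
    mfderiv_shiftCurve A p a
  have hd : MDifferentiableAt 𝓘(ℝ, F) (phaseModel n k F) (shiftIncl A p) (0 : F) :=
    (contMDiffAt_shiftIncl (n := n) A p 0).mdifferentiableAt (by simp)
  have hp : MDifferentiableAt (phaseModel n k F) (𝓡 n) phaseProj (shiftIncl A p (0 : F)) :=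
    (contMDiff_phaseProj _).mdifferentiableAt (by simp)
  have h2 := mfderiv_comp (0 : F) hp hd
  have h3 : (phaseProj ∘ shiftIncl A p : F → Q) = fun _ => phaseProj p := rfl
  rw [h3, mfderiv_const, shiftIncl_zero] at h2
  rw [h1]
  exact (DFunLike.congr_fun h2 (fiberCoord F _ a)).symm

/-- The derivative of `L` along `s ↦ (t, e_1, …, e_A + s u, …, e_k)` is linear in `u`. -/
theorem deriv_shiftCurve (L : PhaseSpace k F E → ℝ)
    (hL : ContMDiff (phaseModel n k F) 𝓘(ℝ, ℝ) ∞ L) (A : Fin k) (p : PhaseSpace k F E)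
    (u : E (phaseProj p)) :
    deriv (fun s : ℝ => L (shiftCurve A p u s)) 0 =
      fderiv ℝ (fun w : F => L (shiftIncl A p w)) 0 (fiberCoord F _ u) := by
  set c : ℝ →L[ℝ] F := ContinuousLinearMap.toSpanSingleton ℝ (fiberCoord F _ u) with hc
  have h0 : c 0 = 0 := map_zero c
  have hcurve : (fun s : ℝ => L (shiftCurve A p u s)) = (fun w : F => L (shiftIncl A p w)) ∘ c :=
    funext fun s => by
      rw [shiftCurve_eq]
      rfl
  have hd : DifferentiableAt ℝ (fun w : F => L (shiftIncl A p w)) (c 0) :=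
    (((hL _).comp _ (contMDiffAt_shiftIncl (n := n) A p (c 0))).contDiffAt).differentiableAt
      (by simp)
  have hd' := hd.hasFDerivAt.comp_hasDerivAt (0 : ℝ) c.hasDerivAt
  rw [hcurve, hd'.deriv, h0]
  simp [hc]

/-- The component `[Leg_L(t, e)]^A ∈ E_q*`, that is,
`u ↦ d/ds|_{s = 0} L(t, e_1, …, e_A + s u, …, e_k)`. -/
def legendreComponent (L : PhaseSpace k F E → ℝ)
    (hL : ContMDiff (phaseModel n k F) 𝓘(ℝ, ℝ) ∞ L) (p : PhaseSpace k F E) (A : Fin k) :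
    DualBundle E (phaseProj p) where
  toFun u := deriv (fun s : ℝ => L (shiftCurve A p u s)) 0
  map_add' u v := by simp only [deriv_shiftCurve L hL, map_add]
  map_smul' c u := by simp only [deriv_shiftCurve L hL, map_smul, RingHom.id_apply]
  cont := by
    simp only [deriv_shiftCurve L hL]
    exact (ContinuousLinearMap.continuous _).comp (ContinuousLinearEquiv.continuous _)

/-- The Legendre transformation `Leg_L : ℝᵏ × (E ⊕ ⋯ ⊕ E) → ℝᵏ × (E* ⊕ ⋯ ⊕ E*)`. -/
def legendre (L : PhaseSpace k F E → ℝ) (hL : ContMDiff (phaseModel n k F) 𝓘(ℝ, ℝ) ∞ L)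
    (p : PhaseSpace k F E) : PhaseSpace k (F →L[ℝ] ℝ) (DualBundle E) :=
  (p.1, ⟨p.2.proj, fun A => legendreComponent L hL p A⟩)

theorem contMDiff_legendre [IsManifold (𝓡 n) ∞ Q] [ContMDiffVectorBundle ∞ F E (𝓡 n)]
    (L : PhaseSpace k F E → ℝ)
    (hL : ContMDiff (phaseModel n k F) 𝓘(ℝ, ℝ) ∞ L) :
    ContMDiff (phaseModel n k F) (phaseModel n k (F →L[ℝ] ℝ)) ∞ (legendre L hL) := by
  intro p₀
  have hid := (contMDiffAt_phase_iff (n := n)).1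
    (contMDiffAt_id (I := phaseModel n k F) (n := ∞) (x := p₀))
  refine contMDiffAt_phase_iff.2 ⟨hid.1, hid.2.1, fun A => ?_⟩
  have hmem : ∀ᶠ p : PhaseSpace k F E in 𝓝 p₀,
      phaseProj p ∈ (trivializationAt F E (phaseProj p₀)).baseSet :=
    hid.2.1.continuousAt.preimage_mem_nhds
      ((trivializationAt F E (phaseProj p₀)).open_baseSet.mem_nhds
        (mem_baseSet_trivializationAt F E (phaseProj p₀)))
  have hG := (hL _).comp _ (contMDiffAt_shift (n := n) A p₀ (0 : F))
  have hder := ContMDiffAt.mfderiv (I := 𝓘(ℝ, F)) (I' := 𝓘(ℝ, ℝ)) (m := ∞) (n := ∞) (x₀ := p₀)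
    (fun (p : PhaseSpace k F E) (w : F) =>
      L (shiftAt A p ((trivializationAt F E (phaseProj p₀)).symm (phaseProj p) w)))
    (fun _ => (0 : F)) hG contMDiffAt_const (by simp)
  have hmodel := inTangentCoordinates_model_space (I := 𝓘(ℝ, F)) (I' := 𝓘(ℝ, ℝ))
    (fun _ : PhaseSpace k F E => (0 : F))
    (fun p => L (shiftAt A p ((trivializationAt F E (phaseProj p₀)).symm (phaseProj p) 0)))
    (fun p => mfderiv 𝓘(ℝ, F) 𝓘(ℝ, ℝ) (fun w : F =>
      L (shiftAt A p ((trivializationAt F E (phaseProj p₀)).symm (phaseProj p) w))) 0) p₀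
  replace hder := hder.congr_of_eventuallyEq (Filter.EventuallyEq.of_eq hmodel.symm)
  refine hder.congr_of_eventuallyEq ?_
  filter_upwards [hmem] with p hp
  set T : F →L[ℝ] F := (fiberCoord F (E := E) (phaseProj p)).toContinuousLinearMap.comp
    ((trivializationAt F E (phaseProj p₀)).symmL ℝ (phaseProj p)) with hT
  have hfun : (fun w : F =>
      L (shiftAt A p ((trivializationAt F E (phaseProj p₀)).symm (phaseProj p) w))) =
      (fun w : F => L (shiftIncl A p w)) ∘ T := by
    funext w
    have h1 := (fiberCoord F (E := E) (phaseProj p)).symm_apply_apply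
      ((trivializationAt F E (phaseProj p₀)).symm (phaseProj p) w)
    simp only [Function.comp_apply, shiftIncl]
    congr 2
    rw [hT, ContinuousLinearMap.comp_apply, Trivialization.symmL_apply _ hp]
    exact h1.symm
  have hd : DifferentiableAt ℝ (fun w : F => L (shiftIncl A p w)) (T 0) :=
    (((hL _).comp _ (contMDiffAt_shiftIncl (n := n) A p (T 0))).contDiffAt).differentiableAt
      (by simp)
  change _ = mfderiv 𝓘(ℝ, F) 𝓘(ℝ, ℝ) _ 0
  rw [mfderiv_eq_fderiv, hfun, fderiv_comp _ hd T.differentiableAt, T.fderiv, map_zero]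
  ext w
  have h2 := deriv_shiftCurve L hL A p
    ((trivializationAt F E (phaseProj p₀)).symm (phaseProj p) w)
  rw [ContinuousLinearMap.comp_apply, hT, ContinuousLinearMap.comp_apply,
    Trivialization.symmL_apply _ hp]
  refine Eq.trans ?_ h2
  change (trivializationAt (F →L[ℝ] ℝ) (DualBundle E) (phaseProj p₀)).linearMapAt ℝ (phaseProj p)
    (legendreComponent L hL p A) w =
      legendreComponent L hL p A ((trivializationAt F E (phaseProj p₀)).symm (phaseProj p) w)
  rw [Trivialization.linearMapAt_apply, if_pos ⟨hp, Set.mem_univ _⟩]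
  rw [hom_trivializationAt_apply]
  simp [ContinuousLinearMap.inCoordinates, Trivialization.symmL_apply _ hp]

variable [IsManifold (𝓡 n) ∞ Q] [ContMDiffVectorBundle ∞ F E (𝓡 n)]
  (𝓔 : LieAlgebroid (𝓡 n) (smoothSections (𝓡 n) F E))

/-- The fibres of the Lagrangian prolongation `𝒯ᴱ(ℝᵏ × (E ⊕ ⋯ ⊕ E))`. -/
abbrev LagrangianProlongation (k : ℕ) : PhaseSpace k F E → Type _ :=
  Prolongation 𝓔 (phaseModel n k F) phaseProj

/-- The fibres of the Hamiltonian prolongation `𝒯ᴱ(ℝᵏ × (E* ⊕ ⋯ ⊕ E*))`. -/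
abbrev HamiltonianProlongation (k : ℕ) : PhaseSpace k (F →L[ℝ] ℝ) (DualBundle E) → Type _ :=
  Prolongation 𝓔 (phaseModel n k (F →L[ℝ] ℝ)) phaseProj

/-- The smooth sections of the Lagrangian prolongation. -/
abbrev lagrangianSections (k : ℕ) : Submodule ℝ (∀ p, LagrangianProlongation 𝓔 k p) :=
  prolongationSections 𝓔 (phaseModel n k F) phaseProj contMDiff_phaseProj

/-- The smooth sections of the Hamiltonian prolongation. -/
abbrev hamiltonianSections (k : ℕ) : Submodule ℝ (∀ p, HamiltonianProlongation 𝓔 k p) :=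
  prolongationSections 𝓔 (phaseModel n k (F →L[ℝ] ℝ)) phaseProj contMDiff_phaseProj

/-- The vertical endomorphism `S^A(a, v) = (0, (a)^{v_A})` of the Lagrangian prolongation. -/
def verticalEndomorphism (A : Fin k) (p : PhaseSpace k F E) :
    LagrangianProlongation 𝓔 k p →ₗ[ℝ] LagrangianProlongation 𝓔 k p where
  toFun x := ⟨(0, verticalVector n A p x.1.1), by
    change 𝓔.anchor (phaseProj p) 0 = mfderiv (phaseModel n k F) (𝓡 n) phaseProj p _
    rw [map_zero]
    exact (mfderiv_phaseProj_verticalVector A p x.1.1).symm⟩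
  map_add' x y := Subtype.ext (Prod.ext (add_zero 0).symm (map_add (verticalVector n A p) _ _))
  map_smul' c x := Subtype.ext (Prod.ext (smul_zero c).symm (map_smul (verticalVector n A p) _ _))

/-- The Poincaré-Cartan `1`-section `Θ_L^A = (d L) ∘ S^A`. -/
def poincareCartanOne (𝓐 : LieAlgebroid (phaseModel n k F) (lagrangianSections 𝓔 k))
    (L : PhaseSpace k F E → ℝ) (A : Fin k) : FormField (LagrangianProlongation 𝓔 k) 1 :=
  oneForm fun p => 𝓐.dFun L p ∘ₗ verticalEndomorphism 𝓔 A p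

/-- The Poincaré-Cartan `2`-section `Ω_L^A = - d Θ_L^A`. -/
def poincareCartanTwo (𝓐 : LieAlgebroid (phaseModel n k F) (lagrangianSections 𝓔 k))
    (L : PhaseSpace k F E → ℝ) (A : Fin k) : FormField (LagrangianProlongation 𝓔 k) 2 :=
  -𝓐.d (poincareCartanOne 𝓔 𝓐 L A)

/-- The Liouville `1`-section `Θ^A`, `Θ^A_{(t, e*)}(a, v) = e*_A(a)`. -/
def liouvilleOne (A : Fin k) : FormField (HamiltonianProlongation 𝓔 k) 1 :=
  oneForm fun p => (p.2.snd A).toLinearMap ∘ₗ LinearMap.fst ℝ _ _ ∘ₗ Submodule.subtype _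

/-- The Liouville `2`-section `Ω^A = - d Θ^A`. -/
def liouvilleTwo
    (𝓑 : LieAlgebroid (phaseModel n k (F →L[ℝ] ℝ)) (hamiltonianSections 𝓔 k)) (A : Fin k) :
    FormField (HamiltonianProlongation 𝓔 k) 2 :=
  -𝓑.d (liouvilleOne 𝓔 A)

theorem mfderiv_phaseProj_legendre (L : PhaseSpace k F E → ℝ)
    (hL : ContMDiff (phaseModel n k F) 𝓘(ℝ, ℝ) ∞ L) (p : PhaseSpace k F E)
    (v : TangentSpace (phaseModel n k F) p) :
    mfderiv (phaseModel n k (F →L[ℝ] ℝ)) (𝓡 n) phaseProj (legendre L hL p)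
      (mfderiv (phaseModel n k F) (phaseModel n k (F →L[ℝ] ℝ)) (legendre L hL) p v) =
    mfderiv (phaseModel n k F) (𝓡 n) phaseProj p v := by
  have hd : MDifferentiableAt (phaseModel n k F) (phaseModel n k (F →L[ℝ] ℝ)) (legendre L hL) p :=
    (contMDiff_legendre L hL p).mdifferentiableAt (by simp)
  have hp : MDifferentiableAt (phaseModel n k (F →L[ℝ] ℝ)) (𝓡 n) phaseProj (legendre L hL p) :=
    (contMDiff_phaseProj _).mdifferentiableAt (by simp)
  have h := mfderiv_comp p hp hd
  exact (DFunLike.congr_fun h v).symm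

/-- The prolongation `𝒯ᴱLeg_L(a, v) = (a, T Leg_L (v))` of the Legendre transformation. -/
def prolongationLegendre (L : PhaseSpace k F E → ℝ)
    (hL : ContMDiff (phaseModel n k F) 𝓘(ℝ, ℝ) ∞ L) (p : PhaseSpace k F E) :
    LagrangianProlongation 𝓔 k p →ₗ[ℝ] HamiltonianProlongation 𝓔 k (legendre L hL p) where
  toFun x := ⟨(x.1.1,
      mfderiv (phaseModel n k F) (phaseModel n k (F →L[ℝ] ℝ)) (legendre L hL) p x.1.2), by
    refine Eq.trans x.2 ?_
    exact (mfderiv_phaseProj_legendre L hL p x.1.2).symm⟩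
  map_add' x y := Subtype.ext (Prod.ext rfl (ContinuousLinearMap.map_add _ x.1.2 y.1.2))
  map_smul' c x := Subtype.ext (Prod.ext rfl (ContinuousLinearMap.map_smul _ c x.1.2))

end PhaseSpace

end

/-! A smooth bundle map Φ over φ commutes with the exterior differentials as soon as it respects
anchors and brackets. The difficulty is to say what the second condition means: for a section X, the
composite Φ X is only a section along φ, in general not of the form σ ∘ φ. Locally, however, Φ X = ∑
f_k (σ_k ∘ φ) and Φ Y = ∑ g_l (τ_l ∘ φ), and the condition is Φ ⟦X, Y⟧ = ∑ f_k g_l ⟦σ_k, τ_l⟧ + ∑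
ρ(X)(g_l) τ_l - ∑ ρ(Y)(f_k) σ_k along φ. The right-hand side is `LieAlgebroid.connBracket`. By the
Leibniz rule it is independent of the expansions once dφ matches the anchors (`connBracket_eq`).
Under both conditions, all derivatives of coefficients cancel when the expansions are put into
Koszul's formula. What is left is Koszul's formula on the target for sections with constant
coefficients (`koszul_pullbackForm`). For the identity map this says that Koszul's formula is
tensorial (`koszul_ext`), so that it does define d. The criterion for morphisms is
`isLieAlgebroidMorphism_of_bracket`. Local frames are multiplied by bump functions so that every
object is globally defined.

The projection P → Q is a linear projection in suitable charts, so the prolongation has local frames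
of projectable sections (`exists_prolongation_frame`). This gives uniqueness of its bracket. For
existence, the E-component is defined by `connBracket` along the projection and the other component
by the bracket of vector fields. The pair lies in the prolongation because both components induce
the same commutator of derivations on functions pulled back from Q. The Jacobiator is tensorial, so
it vanishes because it does on projectable sections.

The Legendre transformation covers the identity of Q, and its prolongation leaves the E-component
unchanged and applies the tangent map to the other one. The brackets are therefore compatible: the
E-components are two expressions for the same bracket along the projection to Q, and the tangent
components agree as derivations (`isLieAlgebroidMorphism_prolongation`). Finally, the pullback of
Θ^A at (a, v) is ℓ^A(a), the derivative of L in the vertical direction of a, which is Θ_L^A by the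
chain rule. Naturality of d then gives the statement on Ω^A. -/

/-! ### Calculus of directional derivatives of real functions. -/

section TangentDeriv

variable {EM : Type*} [NormedAddCommGroup EM] [NormedSpace ℝ EM] {H : Type*} [TopologicalSpace H]
  {I : ModelWithCorners ℝ EM H} {M : Type*} [TopologicalSpace M] [ChartedSpace H M]
  {EN : Type*} [NormedAddCommGroup EN] [NormedSpace ℝ EN] {HN : Type*} [TopologicalSpace HN]
  {J : ModelWithCorners ℝ EN HN} {N : Type*} [TopologicalSpace N] [ChartedSpace HN N]
  {x : M}

theorem ContMDiff.mdiffAt {f : M → N} (hf : ContMDiff I J ∞ f) (x : M) :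
    MDifferentiableAt I J f x :=
  (hf x).mdifferentiableAt (by simp)

theorem tangentDeriv_zero_vec (f : M → ℝ) : tangentDeriv I (0 : TangentSpace I x) f = 0 :=
  map_zero (mfderiv I 𝓘(ℝ, ℝ) f x)

theorem tangentDeriv_add_vec (v w : TangentSpace I x) (f : M → ℝ) :
    tangentDeriv I (v + w) f = tangentDeriv I v f + tangentDeriv I w f :=
  map_add (mfderiv I 𝓘(ℝ, ℝ) f x) v w

theorem tangentDeriv_sub_vec (v w : TangentSpace I x) (f : M → ℝ) :
    tangentDeriv I (v - w) f = tangentDeriv I v f - tangentDeriv I w f :=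
  map_sub (mfderiv I 𝓘(ℝ, ℝ) f x) v w

theorem tangentDeriv_smul_vec (c : ℝ) (v : TangentSpace I x) (f : M → ℝ) :
    tangentDeriv I (c • v) f = c * tangentDeriv I v f :=
  map_smul (mfderiv I 𝓘(ℝ, ℝ) f x) c v

theorem tangentDeriv_sum_vec {ι : Type} (s : Finset ι) (v : ι → TangentSpace I x) (f : M → ℝ) :
    tangentDeriv I (∑ i ∈ s, v i) f = ∑ i ∈ s, tangentDeriv I (v i) f :=
  map_sum (mfderiv I 𝓘(ℝ, ℝ) f x) v s

theorem tangentDeriv_congr (v : TangentSpace I x) {f g : M → ℝ} (h : f =ᶠ[𝓝 x] g) :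
    tangentDeriv I v f = tangentDeriv I v g := by
  exact congrArg (fun L : EM →L[ℝ] ℝ => L v) h.mfderiv_eq

theorem tangentDeriv_const (v : TangentSpace I x) (c : ℝ) :
    tangentDeriv I v (fun _ => c) = 0 := by
  exact congrArg (fun L : EM →L[ℝ] ℝ => L v) (mfderiv_const (I := I) (I' := 𝓘(ℝ, ℝ)) (c := c))

theorem tangentDeriv_add (v : TangentSpace I x) {f g : M → ℝ}
    (hf : MDifferentiableAt I 𝓘(ℝ, ℝ) f x) (hg : MDifferentiableAt I 𝓘(ℝ, ℝ) g x) :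
    tangentDeriv I v (fun y => f y + g y) = tangentDeriv I v f + tangentDeriv I v g := by
  have := mfderiv_add hf hg
  exact congrArg (fun L : TangentSpace I x →L[ℝ] ℝ => L v) this

theorem tangentDeriv_mul (v : TangentSpace I x) {f g : M → ℝ}
    (hf : MDifferentiableAt I 𝓘(ℝ, ℝ) f x) (hg : MDifferentiableAt I 𝓘(ℝ, ℝ) g x) :
    tangentDeriv I v (fun y => f y * g y) =
      f x * tangentDeriv I v g + g x * tangentDeriv I v f := by
  have := (hf.hasMFDerivAt.mul (F' := ℝ) hg.hasMFDerivAt).mfderiv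
  exact congrArg (fun L : TangentSpace I x →L[ℝ] ℝ => L v) this

theorem mdiffAt_fun_mul {f g : M → ℝ}
    (hf : MDifferentiableAt I 𝓘(ℝ, ℝ) f x) (hg : MDifferentiableAt I 𝓘(ℝ, ℝ) g x) :
    MDifferentiableAt I 𝓘(ℝ, ℝ) (fun y => f y * g y) x :=
  MDifferentiableAt.mul (F' := ℝ) hf hg

theorem tangentDeriv_const_mul (v : TangentSpace I x) (c : ℝ) {f : M → ℝ}
    (hf : MDifferentiableAt I 𝓘(ℝ, ℝ) f x) :
    tangentDeriv I v (fun y => c * f y) = c * tangentDeriv I v f := by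
  rw [tangentDeriv_mul v mdifferentiableAt_const hf, tangentDeriv_const]
  ring

theorem tangentDeriv_sum (v : TangentSpace I x) {ι : Type} {s : Finset ι} {f : ι → M → ℝ}
    (hf : ∀ i ∈ s, MDifferentiableAt I 𝓘(ℝ, ℝ) (f i) x) :
    tangentDeriv I v (fun y => ∑ i ∈ s, f i y) = ∑ i ∈ s, tangentDeriv I v (f i) := by
  have := (HasMFDerivAt.sum fun i hi => (hf i hi).hasMFDerivAt).mfderiv
  rw [show (∑ i ∈ s, f i) = fun y => ∑ i ∈ s, f i y from
    funext fun y => Finset.sum_apply y s f] at this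
  have h2 := congrArg (fun L : TangentSpace I x →L[ℝ] ℝ => L v) this
  refine h2.trans ?_
  exact sum_apply (F := EM →L[ℝ] ℝ) ..

theorem mdiffAt_fun_prod {ι : Type} {s : Finset ι} {f : ι → M → ℝ}
    (hf : ∀ i ∈ s, MDifferentiableAt I 𝓘(ℝ, ℝ) (f i) x) :
    MDifferentiableAt I 𝓘(ℝ, ℝ) (fun y => ∏ i ∈ s, f i y) x := by
  classical
  have := (HasMFDerivAt.prod (F' := ℝ) fun i hi => (hf i hi).hasMFDerivAt).mdifferentiableAt
  rwa [show (∏ i ∈ s, f i) = fun y => ∏ i ∈ s, f i y from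
    funext fun y => Finset.prod_apply y s f] at this

/-- The summands are products of an updated family so that they match the multilinear expansion of a
form with one argument replaced, as needed in `tangentDeriv_pullbackForm`. -/
theorem tangentDeriv_prod (v : TangentSpace I x) {ι : Type} [Fintype ι] [DecidableEq ι]
    {f : ι → M → ℝ} (hf : ∀ i, MDifferentiableAt I 𝓘(ℝ, ℝ) (f i) x) :
    tangentDeriv I v (fun y => ∏ i, f i y) =
      ∑ i, ∏ j, Function.update (fun j => f j x) i (tangentDeriv I v (f i)) j := by
  have := (HasMFDerivAt.prod (F' := ℝ) (t := Finset.univ)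
    fun i _ => (hf i).hasMFDerivAt).mfderiv
  rw [show (∏ i, f i) = fun y => ∏ i, f i y from
    funext fun y => Finset.prod_apply y _ f] at this
  have h2 := congrArg (fun L : TangentSpace I x →L[ℝ] ℝ => L v) this
  refine h2.trans ?_
  refine (sum_apply (F := EM →L[ℝ] ℝ) ..).trans (Finset.sum_congr rfl fun i _ => ?_)
  rw [Finset.prod_update_of_mem (Finset.mem_univ i), mul_comm, Finset.sdiff_singleton_eq_erase]
  rfl

theorem tangentDeriv_comp {φ : M → N} {h : N → ℝ} (v : TangentSpace I x)
    (hh : MDifferentiableAt J 𝓘(ℝ, ℝ) h (φ x)) (hφ : MDifferentiableAt I J φ x) :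
    tangentDeriv I v (fun y => h (φ y)) = tangentDeriv J (mfderiv I J φ x v) h :=
  mfderiv_comp_apply x hh hφ v

theorem contMDiff_tangentDeriv [IsManifold I 1 M] {U : ∀ x : M, TangentSpace I x} {f : M → ℝ}
    (hU : ContMDiff I I.tangent ∞ (fun x => (⟨x, U x⟩ : TangentBundle I M)))
    (hf : ContMDiff I 𝓘(ℝ, ℝ) ∞ f) :
    ContMDiff I 𝓘(ℝ, ℝ) ∞ (fun x => tangentDeriv I (U x) f) :=
  (contMDiff_snd_tangentBundle_modelSpace ℝ 𝓘(ℝ, ℝ)).comp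
    ((hf.contMDiff_tangentMap (m := ∞) (by simp)).comp hU)

end TangentDeriv

theorem sum_smul_val {M : Type*} {V : M → Type*} [∀ x, AddCommGroup (V x)] [∀ x, Module ℝ (V x)]
    {Γ : Submodule ℝ (∀ x : M, V x)} {ι : Type} [Fintype ι] (c : ι → ℝ)
    (σ : ι → Γ) (x : M) : (∑ i, c i • σ i : Γ).1 x = ∑ i, c i • (σ i).1 x := by
  simp

/-! ### Modules of sections and frames with cutoff. -/

section SmoothModules

variable {EM : Type*} [NormedAddCommGroup EM] [NormedSpace ℝ EM] {H : Type*} [TopologicalSpace H]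
  {I : ModelWithCorners ℝ EM H} {M : Type*} [TopologicalSpace M] [ChartedSpace H M]
  {V : M → Type*} [∀ x, AddCommGroup (V x)] [∀ x, Module ℝ (V x)]

/-- A space of sections that is closed under multiplication by smooth functions. -/
def IsSmoothModule (I : ModelWithCorners ℝ EM H) (Γ : Submodule ℝ (∀ x : M, V x)) : Prop :=
  ∀ f : M → ℝ, ContMDiff I 𝓘(ℝ, ℝ) ∞ f → ∀ σ ∈ Γ, (fun x => f x • σ x) ∈ Γ

/-- The product of a section with a smooth function. -/
def IsSmoothModule.smul {Γ : Submodule ℝ (∀ x : M, V x)} (hΓ : IsSmoothModule I Γ) {f : M → ℝ}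
    (hf : ContMDiff I 𝓘(ℝ, ℝ) ∞ f) (σ : Γ) : Γ :=
  ⟨fun x => f x • σ.1 x, hΓ f hf σ.1 σ.2⟩

/-- A finite family of sections and of fibrewise linear coefficients that express every section near
`x₀`, multiplied by a cutoff function so that the expression makes sense on all of `M`. -/
structure CutoffFrame (I : ModelWithCorners ℝ EM H) (Γ : Submodule ℝ (∀ x : M, V x)) (ι : Type)
    [Fintype ι] (x₀ : M) where
  /-- the sections of the frame -/
  sec : ι → Γ
  /-- the coefficients with respect to the frame -/
  coeff : ι → ∀ x, V x →ₗ[ℝ] ℝ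
  /-- the cutoff function -/
  cutoff : M → ℝ
  contMDiff_cutoff : ContMDiff I 𝓘(ℝ, ℝ) ∞ cutoff
  cutoff_eq : cutoff =ᶠ[𝓝 x₀] fun _ => 1
  sum_coeff : ∀ (x : M) (v : V x), ∑ i, coeff i x v • (sec i).1 x = cutoff x • v
  contMDiff_coeff : ∀ (i : ι) (σ : Γ), ContMDiff I 𝓘(ℝ, ℝ) ∞ (fun x => coeff i x (σ.1 x))

namespace CutoffFrame

variable {Γ : Submodule ℝ (∀ x : M, V x)} {ι : Type} [Fintype ι] {x₀ : M}
  (𝔉 : CutoffFrame I Γ ι x₀)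

/-- The section with constant coefficients through a given vector. -/
def ext (x : M) : V x →ₗ[ℝ] Γ := ∑ i, (𝔉.coeff i x).smulRight (𝔉.sec i)

theorem ext_apply (x : M) (v : V x) : 𝔉.ext x v = ∑ i, 𝔉.coeff i x v • 𝔉.sec i := by
  simp [ext]

theorem ext_val {x : M} (hx : 𝔉.cutoff x = 1) (v : V x) : (𝔉.ext x v).1 x = v := by
  rw [ext_apply, sum_smul_val, 𝔉.sum_coeff, hx, one_smul]

theorem cutoff_self : 𝔉.cutoff x₀ = 1 := 𝔉.cutoff_eq.self_of_nhds

end CutoffFrame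

end SmoothModules

/-! ### Lie algebroid brackets, also of sections along a map. -/

section LieAlgebroidCalculus

variable {EM : Type*} [NormedAddCommGroup EM] [NormedSpace ℝ EM] {H : Type*} [TopologicalSpace H]
  {I : ModelWithCorners ℝ EM H} {M : Type*} [TopologicalSpace M] [ChartedSpace H M]
  {EN : Type*} [NormedAddCommGroup EN] [NormedSpace ℝ EN] {HN : Type*} [TopologicalSpace HN]
  {J : ModelWithCorners ℝ EN HN} {N : Type*} [TopologicalSpace N] [ChartedSpace HN N]
  [IsManifold J 1 N]
  {V : N → Type*} [∀ x, AddCommGroup (V x)] [∀ x, Module ℝ (V x)]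
  {Γ : Submodule ℝ (∀ x : N, V x)}

namespace LieAlgebroid

variable (𝓑 : LieAlgebroid J Γ)

theorem bracket_swap (σ τ : Γ) : 𝓑.bracket σ τ = -𝓑.bracket τ σ :=
  (LinearMap.IsAlt.neg (B := 𝓑.bracket) 𝓑.bracket_self τ σ).symm

theorem bracket_swap_val (σ τ : Γ) (q : N) :
    (𝓑.bracket σ τ).1 q = -(𝓑.bracket τ σ).1 q := by
  rw [bracket_swap]
  rfl

theorem bracket_smul_right (hΓ : IsSmoothModule J Γ) {f : N → ℝ} (hf : ContMDiff J 𝓘(ℝ, ℝ) ∞ f)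
    (σ τ : Γ) (q : N) :
    (𝓑.bracket σ (hΓ.smul hf τ)).1 q =
      f q • (𝓑.bracket σ τ).1 q + tangentDeriv J (𝓑.anchor q (σ.1 q)) f • τ.1 q :=
  𝓑.leibniz σ τ _ f hf (fun _ => rfl) q

theorem bracket_smul_left (hΓ : IsSmoothModule J Γ) {f : N → ℝ} (hf : ContMDiff J 𝓘(ℝ, ℝ) ∞ f)
    (σ τ : Γ) (q : N) :
    (𝓑.bracket (hΓ.smul hf σ) τ).1 q =
      f q • (𝓑.bracket σ τ).1 q - tangentDeriv J (𝓑.anchor q (τ.1 q)) f • σ.1 q := by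
  rw [bracket_swap_val, bracket_smul_right, 𝓑.bracket_swap_val σ τ]
  module

theorem bracket_sum_left {ι : Type} [Fintype ι] (c : ι → ℝ) (σ : ι → Γ) (τ : Γ) (q : N) :
    (𝓑.bracket (∑ i, c i • σ i) τ).1 q = ∑ i, c i • (𝓑.bracket (σ i) τ).1 q := by
  rw [← sum_smul_val]
  simp

theorem contMDiff_anchorDeriv (σ : Γ) {f : N → ℝ} (hf : ContMDiff J 𝓘(ℝ, ℝ) ∞ f) :
    ContMDiff J 𝓘(ℝ, ℝ) ∞ (fun y => tangentDeriv J (𝓑.anchor y (σ.1 y)) f) :=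
  contMDiff_tangentDeriv (𝓑.contMDiff_anchor σ) hf

/-- The anchor intertwines the bracket with the commutator of derivations. -/
theorem tangentDeriv_anchor_bracket (hΓ : IsSmoothModule J Γ) (σ τ : Γ) {f : N → ℝ}
    (hf : ContMDiff J 𝓘(ℝ, ℝ) ∞ f) (q : N) :
    tangentDeriv J (𝓑.anchor q ((𝓑.bracket σ τ).1 q)) f =
      tangentDeriv J (𝓑.anchor q (σ.1 q))
          (fun y => tangentDeriv J (𝓑.anchor y (τ.1 y)) f) -
        tangentDeriv J (𝓑.anchor q (τ.1 q))
          (fun y => tangentDeriv J (𝓑.anchor y (σ.1 y)) f) := by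
  have hσf := 𝓑.contMDiff_anchorDeriv σ hf
  have hτf := 𝓑.contMDiff_anchorDeriv τ hf
  have key : ∀ υ : Γ, (tangentDeriv J (𝓑.anchor q (σ.1 q))
          (fun y => tangentDeriv J (𝓑.anchor y (τ.1 y)) f) -
        tangentDeriv J (𝓑.anchor q (τ.1 q))
          (fun y => tangentDeriv J (𝓑.anchor y (σ.1 y)) f) -
      tangentDeriv J (𝓑.anchor q ((𝓑.bracket σ τ).1 q)) f) • υ.1 q = 0 := by
    -- The Jacobi identity for σ, τ, fυ, compared with f times the one for σ, τ, υ, leaves the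
    -- asserted identity multiplied by υ(q).
    intro υ
    have h1 : 𝓑.bracket τ (hΓ.smul hf υ) = hΓ.smul hf (𝓑.bracket τ υ) + hΓ.smul hτf υ :=
      Subtype.ext (funext fun y => 𝓑.bracket_smul_right hΓ hf τ υ y)
    have h2 : 𝓑.bracket (hΓ.smul hf υ) σ = hΓ.smul hf (𝓑.bracket υ σ) - hΓ.smul hσf υ :=
      Subtype.ext (funext fun y => 𝓑.bracket_smul_left hΓ hf υ σ y)
    have j1 : ((𝓑.bracket σ (𝓑.bracket τ (hΓ.smul hf υ)) +
        𝓑.bracket τ (𝓑.bracket (hΓ.smul hf υ) σ) +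
        𝓑.bracket (hΓ.smul hf υ) (𝓑.bracket σ τ)).1 q) = 0 := by
      rw [𝓑.jacobi]
      rfl
    have j2 : ((𝓑.bracket σ (𝓑.bracket τ υ) + 𝓑.bracket τ (𝓑.bracket υ σ) +
        𝓑.bracket υ (𝓑.bracket σ τ)).1 q) = 0 := by
      rw [𝓑.jacobi]
      rfl
    rw [h1, h2, map_add, map_sub] at j1
    change (𝓑.bracket σ (hΓ.smul hf (𝓑.bracket τ υ))).1 q + (𝓑.bracket σ (hΓ.smul hτf υ)).1 q +
      ((𝓑.bracket τ (hΓ.smul hf (𝓑.bracket υ σ))).1 q - (𝓑.bracket τ (hΓ.smul hσf υ)).1 q) +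
      (𝓑.bracket (hΓ.smul hf υ) (𝓑.bracket σ τ)).1 q = 0 at j1
    change (𝓑.bracket σ (𝓑.bracket τ υ)).1 q + (𝓑.bracket τ (𝓑.bracket υ σ)).1 q +
      (𝓑.bracket υ (𝓑.bracket σ τ)).1 q = 0 at j2
    rw [bracket_smul_right, bracket_smul_right, bracket_smul_right, bracket_smul_right,
      bracket_smul_left, 𝓑.bracket_swap_val υ σ] at j1
    have j3 := congrArg (fun z => f q • z) j2
    simp only [smul_add, smul_zero] at j3
    rw [← j3] at j1
    linear_combination (norm := module) j1
  -- If the scalar factor were nonzero, every section would vanish at q. Then so would σ, τ and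
  -- their bracket, and both sides would be zero after all.
  by_contra hne
  have hz : ∀ υ : Γ, υ.1 q = 0 := fun υ =>
    (smul_eq_zero.1 (key υ)).resolve_left fun h => hne (sub_eq_zero.1 h).symm
  apply hne
  rw [hz σ, hz τ, hz (𝓑.bracket σ τ), map_zero, tangentDeriv_zero_vec, tangentDeriv_zero_vec,
    tangentDeriv_zero_vec, sub_zero]

variable (I) in
/-- The bracket of `∑ f_k (σ_k ∘ φ)` and `∑ g_l (τ_l ∘ φ)` for sections along a map `φ`, which are
differentiated along `u` and `w`, at the point `p`. -/
noncomputable def connBracket (φ : M → N) {p : M} (u w : TangentSpace I p)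
    {κ κ' : Type} [Fintype κ] [Fintype κ'] (f : κ → M → ℝ) (σ : κ → Γ) (g : κ' → M → ℝ)
    (τ : κ' → Γ) : V (φ p) :=
  (𝓑.bracket (∑ k, f k p • σ k) (∑ l, g l p • τ l)).1 (φ p) +
    ∑ l, tangentDeriv I u (g l) • (τ l).1 (φ p) - ∑ k, tangentDeriv I w (f k) • (σ k).1 (φ p)

variable {𝓑} {ι : Type} [Fintype ι] {q₀ : N}

/-- The Leibniz rule is applied to cutoff • σ = ∑ coeff_j(σ) • sec_j, an identity of global
sections. Near q the cutoff is constantly 1, so multiplying by it does not change the bracket at q.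
-/
theorem bracket_eq_sum_coeff (hΓ : IsSmoothModule J Γ) (𝔉 : CutoffFrame J Γ ι q₀) {q : N}
    (hq : 𝔉.cutoff =ᶠ[𝓝 q] fun _ => 1) (σ τ : Γ) :
    (𝓑.bracket σ τ).1 q = ∑ j, 𝔉.coeff j q (σ.1 q) • (𝓑.bracket (𝔉.sec j) τ).1 q -
      ∑ j, tangentDeriv J (𝓑.anchor q (τ.1 q)) (fun y => 𝔉.coeff j y (σ.1 y)) •
        (𝔉.sec j).1 q := by
  have h1 : hΓ.smul 𝔉.contMDiff_cutoff σ = ∑ j, hΓ.smul (𝔉.contMDiff_coeff j σ) (𝔉.sec j) := by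
    refine Subtype.ext (funext fun y => ?_)
    refine (𝔉.sum_coeff y (σ.1 y)).symm.trans ?_
    simp [IsSmoothModule.smul]
  have h2 := 𝓑.bracket_smul_left hΓ 𝔉.contMDiff_cutoff σ τ q
  rw [tangentDeriv_congr _ hq, tangentDeriv_const, hq.self_of_nhds, one_smul, zero_smul, sub_zero,
    h1] at h2
  rw [← h2]
  simp only [map_sum, LinearMap.sum_apply, Submodule.coe_sum, Finset.sum_apply]
  rw [← Finset.sum_sub_distrib]
  exact Finset.sum_congr rfl fun j _ => 𝓑.bracket_smul_left hΓ _ _ _ _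

/-- One half of the independence in `connBracket_eq`, with the second argument a fixed section.
Expanding each σ_k in the frame produces derivatives of its coefficients along ρ(τ). Since ρ(τ) =
dφ(w), these are derivatives along w of the composites with φ, and the product rule combines them
with the derivatives of f_k. -/
theorem sum_bracket_left_eq (hΓ : IsSmoothModule J Γ) {φ : M → N} {p : M}
    (hφ : MDifferentiableAt I J φ p) (𝔉 : CutoffFrame J Γ ι q₀)
    (hp : 𝔉.cutoff =ᶠ[𝓝 (φ p)] fun _ => 1) {κ : Type} [Fintype κ] {f : κ → M → ℝ}
    (hf : ∀ k, MDifferentiableAt I 𝓘(ℝ, ℝ) (f k) p) {σ : κ → Γ} {a : ∀ x, V (φ x)}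
    (ha : ∀ᶠ x in 𝓝 p, a x = ∑ k, f k x • (σ k).1 (φ x)) {τ : Γ} {w : TangentSpace I p}
    (hw : mfderiv I J φ p w = 𝓑.anchor (φ p) (τ.1 (φ p))) :
    ∑ k, f k p • (𝓑.bracket (σ k) τ).1 (φ p) - ∑ k, tangentDeriv I w (f k) • (σ k).1 (φ p) =
      ∑ j, 𝔉.coeff j (φ p) (a p) • (𝓑.bracket (𝔉.sec j) τ).1 (φ p) -
        ∑ j, tangentDeriv I w (fun x => 𝔉.coeff j (φ x) (a x)) • (𝔉.sec j).1 (φ p) := by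
  have hc : ∀ k j, MDifferentiableAt J 𝓘(ℝ, ℝ) (fun y => 𝔉.coeff j y ((σ k).1 y)) (φ p) :=
    fun k j => (𝔉.contMDiff_coeff j (σ k)).mdiffAt _
  have hcφ : ∀ k j, MDifferentiableAt I 𝓘(ℝ, ℝ) (fun x => 𝔉.coeff j (φ x) ((σ k).1 (φ x))) p :=
    fun k j => (hc k j).comp p hφ
  have hcoeff : ∀ j, ∀ᶠ x in 𝓝 p, 𝔉.coeff j (φ x) (a x) =
      ∑ k, f k x * 𝔉.coeff j (φ x) ((σ k).1 (φ x)) := fun j => by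
    filter_upwards [ha] with x hx
    rw [hx]
    simp
  have hd : ∀ j, tangentDeriv I w (fun x => 𝔉.coeff j (φ x) (a x)) =
      ∑ k, (f k p * tangentDeriv J (𝓑.anchor (φ p) (τ.1 (φ p)))
          (fun y => 𝔉.coeff j y ((σ k).1 y)) +
        𝔉.coeff j (φ p) ((σ k).1 (φ p)) * tangentDeriv I w (f k)) := fun j => by
    rw [tangentDeriv_congr w (hcoeff j),
      tangentDeriv_sum w fun k _ => mdiffAt_fun_mul (hf k) (hcφ k j)]
    refine Finset.sum_congr rfl fun k _ => ?_
    rw [tangentDeriv_mul w (hf k) (hcφ k j), ← hw, tangentDeriv_comp w (hc k j) hφ]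
  have hσ : ∀ k, (σ k).1 (φ p) = ∑ j, 𝔉.coeff j (φ p) ((σ k).1 (φ p)) • (𝔉.sec j).1 (φ p) :=
    fun k => by rw [𝔉.sum_coeff, hp.self_of_nhds, one_smul]
  simp only [hd, (hcoeff _).self_of_nhds]
  rw [Finset.sum_congr rfl fun k _ =>
      congrArg (f k p • ·) (bracket_eq_sum_coeff (𝓑 := 𝓑) hΓ 𝔉 hp (σ k) τ),
    Finset.sum_congr rfl fun k _ => congrArg (tangentDeriv I w (f k) • ·) (hσ k)]
  simp only [smul_sub, Finset.smul_sum, Finset.sum_smul, add_smul, Finset.sum_add_distrib,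
    Finset.sum_sub_distrib, smul_smul]
  rw [Finset.sum_comm, sub_sub, Finset.sum_comm (f := fun k j => (f k p * _) • _),
    Finset.sum_comm (f := fun k j => (tangentDeriv I w (f k) * _) • _)]
  simp only [mul_comm (tangentDeriv I w _)]

/-- The bracket of sections along `φ` is independent of the way in which they are expressed in terms
of sections over the target. -/
theorem connBracket_eq (hΓ : IsSmoothModule J Γ) {φ : M → N} {p : M}
    (hφ : MDifferentiableAt I J φ p) (𝔉 : CutoffFrame J Γ ι q₀)
    (hp : 𝔉.cutoff =ᶠ[𝓝 (φ p)] fun _ => 1) {κ κ' : Type} [Fintype κ] [Fintype κ']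
    {f : κ → M → ℝ} (hf : ∀ k, MDifferentiableAt I 𝓘(ℝ, ℝ) (f k) p) {σ : κ → Γ}
    {g : κ' → M → ℝ} (hg : ∀ k, MDifferentiableAt I 𝓘(ℝ, ℝ) (g k) p) {τ : κ' → Γ}
    {a b : ∀ x, V (φ x)}
    (ha : ∀ᶠ x in 𝓝 p, a x = ∑ k, f k x • (σ k).1 (φ x))
    (hb : ∀ᶠ x in 𝓝 p, b x = ∑ k, g k x • (τ k).1 (φ x)) {u w : TangentSpace I p}
    (hu : mfderiv I J φ p u = 𝓑.anchor (φ p) (a p))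
    (hw : mfderiv I J φ p w = 𝓑.anchor (φ p) (b p)) :
    𝓑.connBracket I φ u w f σ g τ =
      𝓑.connBracket I φ u w (fun j x => 𝔉.coeff j (φ x) (a x)) 𝔉.sec
        (fun j x => 𝔉.coeff j (φ x) (b x)) 𝔉.sec := by
  -- The two arguments are replaced one at a time: the first against the frame extension of b(p),
  -- the second against ∑ f_k(p) σ_k. The mixed bracket of these two sections occurs in both
  -- identities and cancels.
  have h1 := sum_bracket_left_eq (𝓑 := 𝓑) (τ := 𝔉.ext (φ p) (b p)) hΓ hφ 𝔉 hp hf ha (w := w)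
    (by rw [𝔉.ext_val hp.self_of_nhds, hw])
  have h2 := sum_bracket_left_eq (𝓑 := 𝓑) (τ := ∑ k, f k p • σ k) hΓ hφ 𝔉 hp hg hb (w := u)
    (by rw [sum_smul_val, ← ha.self_of_nhds, hu])
  rw [← bracket_sum_left, ← bracket_sum_left, ← 𝔉.ext_apply] at h1 h2
  unfold connBracket
  rw [← 𝔉.ext_apply (φ p) (b p), ← 𝔉.ext_apply (φ p) (a p)]
  rw [𝓑.bracket_swap_val _ (∑ l, g l p • τ l)]
  rw [𝓑.bracket_swap_val (𝔉.ext (φ p) (b p)) _] at h2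
  linear_combination (norm := module) h1 - h2

/-- The bracket of two sections in terms of their coefficients in a frame. -/
theorem bracket_eq_connBracket (hΓ : IsSmoothModule J Γ) (𝔉 : CutoffFrame J Γ ι q₀) {q : N}
    (hq : 𝔉.cutoff =ᶠ[𝓝 q] fun _ => 1) (X Y : Γ) :
    (𝓑.bracket X Y).1 q = 𝓑.connBracket J id (𝓑.anchor q (X.1 q)) (𝓑.anchor q (Y.1 q))
      (fun j x => 𝔉.coeff j x (X.1 x)) 𝔉.sec (fun j x => 𝔉.coeff j x (Y.1 x)) 𝔉.sec := by
  -- X and Y themselves serve as expansions with a single term of coefficient 1. Their derivative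
  -- terms vanish.
  have h := connBracket_eq (𝓑 := 𝓑) (I := J) (φ := id) (p := q) (κ := Unit) (κ' := Unit) hΓ
    mdifferentiableAt_id 𝔉 hq
    (f := fun _ _ => 1) (fun _ => mdifferentiableAt_const) (σ := fun _ => X)
    (g := fun _ _ => 1) (fun _ => mdifferentiableAt_const) (τ := fun _ => Y)
    (a := X.1) (b := Y.1) (by simp) (by simp) (u := 𝓑.anchor q (X.1 q))
    (w := 𝓑.anchor q (Y.1 q)) (by rw [mfderiv_id]; rfl) (by rw [mfderiv_id]; rfl)
  refine Eq.trans ?_ h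
  simp [connBracket, tangentDeriv_const]

/-- The anchor maps the bracket of sections along `φ` to the commutator of derivations. -/
theorem tangentDeriv_anchor_connBracket (hΓ : IsSmoothModule J Γ) {φ : M → N}
    (hφ : ContMDiff I J ∞ φ) {p : M} {κ κ' : Type} [Fintype κ] [Fintype κ']
    {f : κ → M → ℝ} (hf : ∀ k, MDifferentiableAt I 𝓘(ℝ, ℝ) (f k) p) {σ : κ → Γ}
    {g : κ' → M → ℝ} (hg : ∀ k, MDifferentiableAt I 𝓘(ℝ, ℝ) (g k) p) {τ : κ' → Γ}
    {U W : ∀ x : M, TangentSpace I x}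
    (hU : ∀ᶠ x in 𝓝 p, mfderiv I J φ x (U x) =
      𝓑.anchor (φ x) (∑ k, f k x • (σ k).1 (φ x)))
    (hW : ∀ᶠ x in 𝓝 p, mfderiv I J φ x (W x) =
      𝓑.anchor (φ x) (∑ k, g k x • (τ k).1 (φ x)))
    {h : N → ℝ} (hh : ContMDiff J 𝓘(ℝ, ℝ) ∞ h) :
    tangentDeriv J (𝓑.anchor (φ p) (𝓑.connBracket I φ (U p) (W p) f σ g τ)) h =
      tangentDeriv I (U p) (fun x => tangentDeriv I (W x) (fun y => h (φ y))) -
        tangentDeriv I (W p) (fun x => tangentDeriv I (U x) (fun y => h (φ y))) := by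
  -- A second derivative of h ∘ φ splits into a part with the coefficients frozen at p and a part
  -- with the derivatives of the coefficients. In the commutator, the frozen parts give the anchor
  -- of a bracket on the target and the remaining parts give the correction terms of `connBracket`.
  have expand : ∀ {κ : Type} [Fintype κ] {f : κ → M → ℝ} {σ : κ → Γ}
      {U W : ∀ x : M, TangentSpace I x}
      (_ : ∀ k, MDifferentiableAt I 𝓘(ℝ, ℝ) (f k) p)
      (_ : ∀ᶠ x in 𝓝 p, mfderiv I J φ x (U x) =
        𝓑.anchor (φ x) (∑ k, f k x • (σ k).1 (φ x))),
      tangentDeriv I (W p) (fun x => tangentDeriv I (U x) (fun y => h (φ y))) =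
        tangentDeriv J (mfderiv I J φ p (W p)) (fun y => tangentDeriv J
          (𝓑.anchor y ((∑ k, f k p • σ k : Γ).1 y)) h) +
        tangentDeriv J (𝓑.anchor (φ p)
          (∑ k, tangentDeriv I (W p) (f k) • (σ k).1 (φ p))) h := by
    intro κ _ f σ U W hf hU
    have hs : ∀ k, ContMDiff J 𝓘(ℝ, ℝ) ∞
        (fun y => tangentDeriv J (𝓑.anchor y ((σ k).1 y)) h) :=
      fun k => 𝓑.contMDiff_anchorDeriv (σ k) hh
    have hsφ : ∀ k, MDifferentiableAt I 𝓘(ℝ, ℝ)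
        (fun x => tangentDeriv J (𝓑.anchor (φ x) ((σ k).1 (φ x))) h) p :=
      fun k => ((hs k).mdiffAt _).comp p (hφ.mdiffAt p)
    have e1 : ∀ᶠ x in 𝓝 p, tangentDeriv I (U x) (fun y => h (φ y)) =
        ∑ k, f k x * tangentDeriv J (𝓑.anchor (φ x) ((σ k).1 (φ x))) h := by
      filter_upwards [hU] with x hx
      rw [tangentDeriv_comp _ (hh.mdiffAt _) (hφ.mdiffAt x), hx, map_sum, tangentDeriv_sum_vec]
      refine Finset.sum_congr rfl fun k _ => ?_
      rw [map_smul, tangentDeriv_smul_vec]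
    have e2 : (fun y => tangentDeriv J (𝓑.anchor y ((∑ k, f k p • σ k : Γ).1 y)) h) =
        fun y => ∑ k, f k p * tangentDeriv J (𝓑.anchor y ((σ k).1 y)) h := by
      funext y
      rw [sum_smul_val, map_sum, tangentDeriv_sum_vec]
      refine Finset.sum_congr rfl fun k _ => ?_
      rw [map_smul, tangentDeriv_smul_vec]
    rw [tangentDeriv_congr _ e1, e2, tangentDeriv_sum _ fun k _ => mdiffAt_fun_mul (hf k) (hsφ k),
      tangentDeriv_sum _ fun k _ => mdiffAt_fun_mul mdifferentiableAt_const ((hs k).mdiffAt _),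
      map_sum, tangentDeriv_sum_vec, ← Finset.sum_add_distrib]
    refine Finset.sum_congr rfl fun k _ => ?_
    rw [tangentDeriv_mul _ (hf k) (hsφ k), tangentDeriv_const_mul _ _ ((hs k).mdiffAt _), map_smul,
      tangentDeriv_smul_vec, tangentDeriv_comp _ ((hs k).mdiffAt _) (hφ.mdiffAt p)]
    ring
  rw [expand hg hW, expand hf hU, hU.self_of_nhds, hW.self_of_nhds, connBracket, map_sub, map_add,
    tangentDeriv_sub_vec, tangentDeriv_add_vec, tangentDeriv_anchor_bracket _ hΓ _ _ hh]
  simp only [sum_smul_val]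
  ring

end LieAlgebroid

end LieAlgebroidCalculus

/-! ### Koszul's formula: signs, cancellation, alternation. -/

section Koszul

theorem Fin.removeNth_removeNth_succ {α : Type*} {l : ℕ} (y : Fin (l + 2) → α) {i j : Fin (l + 1)}
    (hij : i ≤ j) :
    i.removeNth (j.succ.removeNth y) = j.removeNth (i.castSucc.removeNth y) := by
  have H₁ : i.castSucc.succAbove j = j.succ := by simp [Fin.succAbove_of_le_castSucc, hij]
  have H₂ : j.predAbove i.castSucc = i := by simp [Fin.predAbove_of_le_castSucc, hij]
  rw [Fin.removeNth_removeNth_eq_swap y j i.castSucc, H₁, H₂]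

/-- The terms with first derivatives of coefficients cancel in the exterior differential. -/
theorem AlternatingMap.sum_removeNth_update_add_eq_zero {V : Type*} [AddCommGroup V] [Module ℝ V]
    {l : ℕ} (μ : V [⋀^Fin (l + 1)]→ₗ[ℝ] ℝ) (y : Fin (l + 2) → V)
    (D : Fin (l + 2) → Fin (l + 2) → V) :
    ∑ i : Fin (l + 2), (-1 : ℝ) ^ (i : ℕ) *
        ∑ m : Fin (l + 1), μ (Function.update (i.removeNth y) m (D i (i.succAbove m))) -
      ∑ i : Fin (l + 1), ∑ j ≥ i, (-1 : ℝ) ^ ((i : ℕ) + (j : ℕ)) *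
        μ (Fin.cons (D i.castSucc j.succ - D j.succ i.castSucc)
          (j.removeNth (i.castSucc.removeNth y))) = 0 := by
  have h1 : ∀ (i : Fin (l + 2)) (m : Fin (l + 1)) (d : V),
      μ (Function.update (i.removeNth y) m d) =
        (-1 : ℝ) ^ (m : ℕ) * μ (Fin.cons d (m.removeNth (i.removeNth y))) := by
    intro i m d
    rw [← Fin.insertNth_removeNth, AlternatingMap.map_insertNth]
    simp [Matrix.vecCons]
  simp only [h1, Finset.mul_sum]
  -- Every pair of positions a < b of the full list occurs twice: a is removed and then b is
  -- replaced, or the reverse. With a = i.castSucc and b = j.succ, i ≤ j, the two terms have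
  -- opposite signs and add up to the difference of the two values of D.
  rw [Fin.sum_sum_eq_sum_triangle_add, sub_eq_zero]
  refine Fintype.sum_congr _ _ fun i ↦ Finset.sum_congr rfl fun j hj ↦ ?_
  rw [Finset.mem_Ici] at hj
  have H₁ : i.castSucc.succAbove j = j.succ := by simp [Fin.succAbove_of_le_castSucc, hj]
  have H₃ : j.succ.succAbove i = i.castSucc := by simp [Fin.succAbove_of_castSucc_lt, hj]
  have hsub : μ (Fin.cons (D i.castSucc j.succ - D j.succ i.castSucc)
      (j.removeNth (i.castSucc.removeNth y))) =
      μ (Fin.cons (D i.castSucc j.succ) (j.removeNth (i.castSucc.removeNth y))) -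
      μ (Fin.cons (D j.succ i.castSucc) (j.removeNth (i.castSucc.removeNth y))) := by
    change μ.curryLeft (D i.castSucc j.succ - D j.succ i.castSucc) _ = _
    rw [map_sub]
    rfl
  rw [hsub, H₁, H₃, Fin.removeNth_removeNth_succ y hj]
  simp only [Fin.val_castSucc, Fin.val_succ, pow_add, pow_one]
  ring

variable {EM : Type*} [NormedAddCommGroup EM] [NormedSpace ℝ EM] {H : Type*} [TopologicalSpace H]
  {I : ModelWithCorners ℝ EM H} {M : Type*} [TopologicalSpace M] [ChartedSpace H M]
  [IsManifold I 1 M] {V : M → Type*} [∀ x, AddCommGroup (V x)] [∀ x, Module ℝ (V x)]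
  {Γ : Submodule ℝ (∀ x : M, V x)}

namespace LieAlgebroid

variable (𝓐 : LieAlgebroid I Γ)

/-- The index j = 0 contributes nothing, and shifting the other indices to j.succ turns the
condition into i ≤ j at the price of one sign. In this form the sum can be compared with iterated
alternatizations and with `sum_removeNth_update_add_eq_zero`. -/
theorem bracketSum_succ {l : ℕ} (μ : FormField V (l + 1)) (X : Fin (l + 2) → Γ) (x : M) :
    𝓐.bracketSum μ X x =
      -∑ i : Fin (l + 1), ∑ j ≥ i, (-1 : ℝ) ^ ((i : ℕ) + (j : ℕ)) *
        μ x (Fin.cons ((𝓐.bracket (X i.castSucc) (X j.succ)).1 x)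
          (j.removeNth (i.castSucc.removeNth fun m => (X m).1 x))) := by
  refine (Fin.sum_univ_succ (n := l + 1) _).trans ?_
  simp only [Fin.not_lt_zero, if_false, Finset.sum_const_zero, zero_add]
  rw [Finset.sum_comm, ← Finset.sum_neg_distrib]
  refine Finset.sum_congr rfl fun i _ => ?_
  rw [← Finset.sum_filter, ← Finset.sum_neg_distrib]
  refine Finset.sum_congr (by ext j; simp [Fin.castSucc_lt_succ_iff])
    fun j hj => ?_
  have hij : i ≤ j := by simpa using hj
  rw [Fin.removeNth_removeNth_succ X hij, Fin.val_succ, ← add_assoc, pow_succ, mul_neg_one, neg_mul]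
  rfl

end LieAlgebroid

/-- The smooth functions, as a subspace of all functions. -/
def smoothFunctions (I : ModelWithCorners ℝ EM H) (M : Type*) [TopologicalSpace M]
    [ChartedSpace H M] : Submodule ℝ (M → ℝ) where
  carrier := {f | ContMDiff I 𝓘(ℝ, ℝ) ∞ f}
  add_mem' hf hg := hf.add hg
  zero_mem' := contMDiff_const
  smul_mem' _ _ hf := contMDiff_const.mul hf

/-- A tangent vector as a linear form on the smooth functions. -/
noncomputable def tangentDerivLM {x : M} (v : TangentSpace I x) : smoothFunctions I M →ₗ[ℝ] ℝ where
  toFun f := tangentDeriv I v f.1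
  map_add' f g := tangentDeriv_add v (ContMDiff.mdiffAt f.2 x) (ContMDiff.mdiffAt g.2 x)
  map_smul' c f := tangentDeriv_const_mul v c (ContMDiff.mdiffAt f.2 x)

/-- The evaluation of sections at a point. -/
def evalSection (Γ : Submodule ℝ (∀ x : M, V x)) (x : M) : Γ →ₗ[ℝ] V x :=
  (LinearMap.proj x).comp Γ.subtype

/-- A smooth form as an alternating map from sections to smooth functions. -/
def IsSmoothForm.toAlternatingMap {l : ℕ} {μ : FormField V l} (hμ : IsSmoothForm I Γ μ) :
    Γ [⋀^Fin l]→ₗ[ℝ] smoothFunctions I M :=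
  (AlternatingMap.pi fun x => (μ x).compLinearMap (evalSection Γ x)).codRestrict _ fun X => hμ X

namespace LieAlgebroid

variable (𝓐 : LieAlgebroid I Γ)

/-- Both parts of Koszul's formula are alternatizations of ℝ-multilinear expressions, X ↦ ρ(X) μ(…)
and (X, Y) ↦ μ(⟦X, Y⟧, …). Composed with extensions of vectors to sections, the result gives an
alternating form on the fibre. -/
theorem exists_alternatingMap_koszul {l : ℕ} {μ : FormField V l} (hμ : IsSmoothForm I Γ μ) (x : M) :
    ∃ K : Γ [⋀^Fin (l + 1)]→ₗ[ℝ] ℝ, ∀ X, K X = 𝓐.koszul μ X x := by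
  let f₁ : Γ →ₗ[ℝ] Γ [⋀^Fin l]→ₗ[ℝ] ℝ :=
    { toFun := fun X => (tangentDerivLM (𝓐.anchor x (X.1 x))).compAlternatingMap hμ.toAlternatingMap
      map_add' := fun X Y => by
        ext Z
        change tangentDeriv I (𝓐.anchor x (X.1 x + Y.1 x)) _ = _
        rw [map_add, tangentDeriv_add_vec]
        rfl
      map_smul' := fun c X => by
        ext Z
        change tangentDeriv I (𝓐.anchor x (c • X.1 x)) _ = _
        rw [map_smul, tangentDeriv_smul_vec]
        rfl }
  have h₁ : ∀ X, AlternatingMap.alternatizeUncurryFin f₁ X =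
      ∑ i : Fin (l + 1), (-1 : ℝ) ^ (i : ℕ) * tangentDeriv I (𝓐.anchor x ((X i).1 x))
        (fun y => μ y (fun m : Fin l => (i.removeNth X m).1 y)) := by
    intro X
    rw [AlternatingMap.alternatizeUncurryFin_apply]
    refine Finset.sum_congr rfl fun i _ => ?_
    rw [zsmul_eq_mul]
    push_cast
    rfl
  cases l with
  | zero =>
    refine ⟨AlternatingMap.alternatizeUncurryFin f₁, fun X => ?_⟩
    rw [h₁, koszul, bracketSum, add_zero]
  | succ l =>
    let c : V x →ₗ[ℝ] Γ [⋀^Fin l]→ₗ[ℝ] ℝ :=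
      { toFun := fun v => ((μ x).curryLeft v).compLinearMap (evalSection Γ x)
        map_add' := fun v w => by
          rw [map_add]
          rfl
        map_smul' := fun c v => by
          rw [map_smul]
          rfl }
    let f₂ : Γ →ₗ[ℝ] Γ →ₗ[ℝ] Γ [⋀^Fin l]→ₗ[ℝ] ℝ :=
      𝓐.bracket.compr₂ (c ∘ₗ evalSection Γ x)
    -- The double alternatization takes the difference of the two orders of each pair. As the
    -- bracket is skew, it counts each term twice, whence the factor 1/2; the minus sign is that of
    -- `bracketSum_succ`.
    refine ⟨AlternatingMap.alternatizeUncurryFin f₁ - (1 / 2 : ℝ) •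
      AlternatingMap.alternatizeUncurryFin (AlternatingMap.alternatizeUncurryFinLM ∘ₗ f₂),
      fun X => ?_⟩
    rw [AlternatingMap.sub_apply, AlternatingMap.smul_apply, h₁,
      AlternatingMap.alternatizeUncurryFin_alternatizeUncurryFinLM_comp_apply, koszul,
      bracketSum_succ, sub_eq_add_neg]
    congr 2
    rw [smul_eq_mul, Finset.mul_sum]
    refine Finset.sum_congr rfl fun i _ => ?_
    rw [Finset.mul_sum]
    refine Finset.sum_congr rfl fun j _ => ?_
    have hanti : f₂ (X j.succ) (X i.castSucc) = -f₂ (X i.castSucc) (X j.succ) := by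
      change c (evalSection Γ x (𝓐.bracket _ _)) = -c (evalSection Γ x (𝓐.bracket _ _))
      rw [𝓐.bracket_swap, map_neg, map_neg]
    rw [hanti, AlternatingMap.neg_apply, sub_neg_eq_add, zsmul_eq_mul]
    push_cast
    have : f₂ (X i.castSucc) (X j.succ) (j.removeNth (i.castSucc.removeNth X)) =
        μ x (Fin.cons ((𝓐.bracket (X i.castSucc) (X j.succ)).1 x)
          (j.removeNth (i.castSucc.removeNth fun m => (X m).1 x))) := rfl
    rw [this]
    ring

end LieAlgebroid

end Koszul

/-! ### Naturality of Koszul's formula and the criterion for morphisms. -/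

section KoszulPullback

variable {EM : Type*} [NormedAddCommGroup EM] [NormedSpace ℝ EM] {H : Type*} [TopologicalSpace H]
  {I : ModelWithCorners ℝ EM H} {M : Type*} [TopologicalSpace M] [ChartedSpace H M]
  [IsManifold I 1 M] {V : M → Type*} [∀ x, AddCommGroup (V x)] [∀ x, Module ℝ (V x)]
  {Γ : Submodule ℝ (∀ x : M, V x)}
  {EN : Type*} [NormedAddCommGroup EN] [NormedSpace ℝ EN] {HN : Type*} [TopologicalSpace HN]
  {J : ModelWithCorners ℝ EN HN} {N : Type*} [TopologicalSpace N] [ChartedSpace HN N]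
  [IsManifold J 1 N] {V' : N → Type*} [∀ x, AddCommGroup (V' x)] [∀ x, Module ℝ (V' x)]
  {Γ' : Submodule ℝ (∀ x : N, V' x)}

/-- Every point of the base has a cutoff frame. -/
def HasCutoffFrames (I : ModelWithCorners ℝ EM H) (Γ : Submodule ℝ (∀ x : M, V x)) : Prop :=
  ∀ x, ∃ (ι : Type) (_ : Fintype ι), Nonempty (CutoffFrame I Γ ι x)

omit [IsManifold J 1 N] [TopologicalSpace N] [ChartedSpace HN N] in
theorem FormField.map_sum_smul {l : ℕ} (μ : FormField V' l) {ι : Type} [Fintype ι]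
    (Z : ι → Γ') (c : Fin l → ι → ℝ) (z : N) :
    μ z (fun m => ∑ j, c m j • (Z j).1 z) =
      ∑ s : Fin l → ι, (∏ m, c m (s m)) * μ z (fun m => (Z (s m)).1 z) := by
  classical
  refine ((μ z).toMultilinearMap.map_sum fun m j => c m j • (Z j).1 z).trans ?_
  exact Finset.sum_congr rfl fun s _ => (μ z).toMultilinearMap.map_smul_univ _ _

omit [IsManifold I 1 M] [IsManifold J 1 N] in
-- Near p the function is a sum of products of coefficients with values of μ on frame sections,
-- composed with φ. The product rule separates the derivative of those values, with coefficients
-- frozen at p, from the terms in which one coefficient is differentiated.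
theorem tangentDeriv_pullbackForm {l : ℕ} {μ : FormField V' l} (hμ : IsSmoothForm J Γ' μ)
    {φ : M → N} {Φ : ∀ x, V x →ₗ[ℝ] V' (φ x)} {p : M} (hφ : MDifferentiableAt I J φ p)
    {ι : Type} [Fintype ι] {q₀ : N} (𝔉 : CutoffFrame J Γ' ι q₀)
    (hp : 𝔉.cutoff ∘ φ =ᶠ[𝓝 p] fun _ => 1) {X : Fin l → Γ}
    (hcoeff : ∀ m j, MDifferentiableAt I 𝓘(ℝ, ℝ)
      (fun x => 𝔉.coeff j (φ x) (Φ x ((X m).1 x))) p) (v : TangentSpace I p) :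
    tangentDeriv I v (fun x => pullbackForm φ Φ μ x (fun m => (X m).1 x)) =
      tangentDeriv J (mfderiv I J φ p v)
        (fun z => μ z (fun m => (𝔉.ext (φ p) (Φ p ((X m).1 p))).1 z)) +
      ∑ m, μ (φ p) (Function.update (fun m => Φ p ((X m).1 p)) m
        (∑ j, tangentDeriv I v (fun x => 𝔉.coeff j (φ x) (Φ x ((X m).1 x))) •
          (𝔉.sec j).1 (φ p))) := by
  set f : Fin l → ι → M → ℝ := fun m j x => 𝔉.coeff j (φ x) (Φ x ((X m).1 x)) with hf
  have hΦ : ∀ᶠ x in 𝓝 p, ∀ m, Φ x ((X m).1 x) = ∑ j, f m j x • (𝔉.sec j).1 (φ x) := by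
    filter_upwards [hp] with x hx m
    rw [𝔉.sum_coeff, show 𝔉.cutoff (φ x) = 1 from hx, one_smul]
  have hn : ∀ s : Fin l → ι, ContMDiff J 𝓘(ℝ, ℝ) ∞
      (fun z => μ z (fun m => (𝔉.sec (s m)).1 z)) := fun s => hμ fun m => 𝔉.sec (s m)
  have hnφ : ∀ s : Fin l → ι, MDifferentiableAt I 𝓘(ℝ, ℝ)
      (fun x => μ (φ x) (fun m => (𝔉.sec (s m)).1 (φ x))) p :=
    fun s => ((hn s).mdiffAt _).comp p hφ
  have hprod : ∀ s : Fin l → ι, MDifferentiableAt I 𝓘(ℝ, ℝ) (fun x => ∏ m, f m (s m) x) p :=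
    fun s => mdiffAt_fun_prod fun m _ => hcoeff m (s m)
  have e1 : (fun x => pullbackForm φ Φ μ x (fun m => (X m).1 x)) =ᶠ[𝓝 p]
      fun x => ∑ s : Fin l → ι, (∏ m, f m (s m) x) *
        μ (φ x) (fun m => (𝔉.sec (s m)).1 (φ x)) := by
    filter_upwards [hΦ] with x hx
    rw [← FormField.map_sum_smul μ 𝔉.sec (fun m j => f m j x) (φ x)]
    exact congrArg (μ (φ x)) (funext fun m => hx m)
  have e2 : (fun z => μ z (fun m => (𝔉.ext (φ p) (Φ p ((X m).1 p))).1 z)) =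
      fun z => ∑ s : Fin l → ι, (∏ m, f m (s m) p) * μ z (fun m => (𝔉.sec (s m)).1 z) := by
    funext z
    rw [← FormField.map_sum_smul μ 𝔉.sec (fun m j => f m j p) z]
    congr 1
    funext m
    rw [𝔉.ext_apply, sum_smul_val]
  have e3 : ∀ m, Function.update (fun m => Φ p ((X m).1 p)) m
      (∑ j, tangentDeriv I v (f m j) • (𝔉.sec j).1 (φ p)) =
      fun m' => ∑ j, (Function.update (fun m j => f m j p) m
        (fun j => tangentDeriv I v (f m j)) m' j) • (𝔉.sec j).1 (φ p) := by
    intro m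
    funext m'
    rcases eq_or_ne m' m with rfl | hne
    · simp
    · rw [Function.update_of_ne hne, Function.update_of_ne hne]
      exact hΦ.self_of_nhds m'
  have e4 : ∀ (m : Fin l) (s : Fin l → ι),
      (∏ m', Function.update (fun m j => f m j p) m (fun j => tangentDeriv I v (f m j)) m' (s m')) =
        ∏ m', Function.update (fun m => f m (s m) p) m (tangentDeriv I v (f m (s m))) m' := by
    intro m s
    refine Finset.prod_congr rfl fun m' _ => ?_
    rcases eq_or_ne m' m with rfl | hne
    · simp
    · rw [Function.update_of_ne hne, Function.update_of_ne hne]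
  rw [tangentDeriv_congr v e1, e2, tangentDeriv_sum v fun s _ => mdiffAt_fun_mul (hprod s) (hnφ s),
    tangentDeriv_sum _ fun s _ => mdiffAt_fun_mul mdifferentiableAt_const ((hn s).mdiffAt _)]
  have e5 : ∀ m, μ (φ p) (Function.update (fun m => Φ p ((X m).1 p)) m
      (∑ j, tangentDeriv I v (f m j) • (𝔉.sec j).1 (φ p))) =
      ∑ s : Fin l → ι,
        (∏ m', Function.update (fun m => f m (s m) p) m (tangentDeriv I v (f m (s m))) m') *
          μ (φ p) (fun m => (𝔉.sec (s m)).1 (φ p)) := by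
    intro m
    rw [e3, FormField.map_sum_smul μ 𝔉.sec _ (φ p)]
    simp only [e4]
  rw [Finset.sum_congr rfl fun m _ => e5 m, Finset.sum_comm, ← Finset.sum_add_distrib]
  refine Finset.sum_congr rfl fun s _ => ?_
  rw [tangentDeriv_mul v (hprod s) (hnφ s), tangentDeriv_const_mul _ _ ((hn s).mdiffAt _),
    tangentDeriv_comp v ((hn s).mdiffAt _) hφ, tangentDeriv_prod v fun m => hcoeff m (s m),
    Finset.mul_sum]
  congr 1
  exact Finset.sum_congr rfl fun m _ => mul_comm _ _

omit [IsManifold I 1 M] [IsManifold J 1 N] in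
-- Locally the value is a polynomial in the frame coefficients of the Φ X_m, with the values of μ on
-- frame sections, pulled back by φ, as its coefficients.
theorem isSmoothForm_pullbackForm {φ : M → N} (hφ : ContMDiff I J ∞ φ)
    {Φ : ∀ x, V x →ₗ[ℝ] V' (φ x)}
    (hframe : ∀ q, ∃ (ι : Type) (_ : Fintype ι) (𝔉 : CutoffFrame J Γ' ι q),
      ∀ (X : Γ) (j : ι), ContMDiff I 𝓘(ℝ, ℝ) ∞ (fun x => 𝔉.coeff j (φ x) (Φ x (X.1 x))))
    {l : ℕ} {μ : FormField V' l} (hμ : IsSmoothForm J Γ' μ) :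
    IsSmoothForm I Γ (pullbackForm φ Φ μ) := by
  intro X p
  obtain ⟨ι, _, 𝔉, hcoeff⟩ := hframe (φ p)
  have e1 : (fun x => pullbackForm φ Φ μ x (fun m => (X m).1 x)) =ᶠ[𝓝 p]
      fun x => ∑ s : Fin l → ι, (∏ m, 𝔉.coeff (s m) (φ x) (Φ x ((X m).1 x))) *
        μ (φ x) (fun m => (𝔉.sec (s m)).1 (φ x)) := by
    filter_upwards [hφ.continuous.continuousAt.eventually 𝔉.cutoff_eq] with x hx
    rw [← FormField.map_sum_smul μ 𝔉.sec
      (fun m j => 𝔉.coeff j (φ x) (Φ x ((X m).1 x))) (φ x)]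
    refine congrArg (μ (φ x)) (funext fun m => ?_)
    rw [𝔉.sum_coeff, hx, one_smul]
  refine ContMDiffAt.congr_of_eventuallyEq ?_ e1
  have hs : ContMDiff I 𝓘(ℝ, ℝ) ∞ fun x => ∑ s : Fin l → ι,
      (∏ m, 𝔉.coeff (s m) (φ x) (Φ x ((X m).1 x))) *
        μ (φ x) (fun m => (𝔉.sec (s m)).1 (φ x)) :=
    contMDiff_finsetSum fun s _ => (contMDiff_finsetProd fun m _ => hcoeff (X m) (s m)).mul
      ((hμ fun m => 𝔉.sec (s m)).comp hφ)
  exact hs p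

namespace LieAlgebroid

variable {𝓐 : LieAlgebroid I Γ} {𝓑 : LieAlgebroid J Γ'}

/-- Koszul's formula is natural with respect to bundle maps that are compatible with the anchors and
with the brackets. -/
theorem koszul_pullbackForm {l : ℕ} {μ : FormField V' l} (hμ : IsSmoothForm J Γ' μ)
    {φ : M → N} {Φ : ∀ x, V x →ₗ[ℝ] V' (φ x)} {p : M} (hφ : MDifferentiableAt I J φ p)
    {ι : Type} [Fintype ι] {q₀ : N} (𝔉 : CutoffFrame J Γ' ι q₀)
    (hp : 𝔉.cutoff ∘ φ =ᶠ[𝓝 p] fun _ => 1)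
    (hcoeff : ∀ (X : Γ) (j : ι), MDifferentiableAt I 𝓘(ℝ, ℝ)
      (fun x => 𝔉.coeff j (φ x) (Φ x (X.1 x))) p)
    (hanchor : ∀ v, mfderiv I J φ p (𝓐.anchor p v) = 𝓑.anchor (φ p) (Φ p v))
    (hbracket : ∀ X Y : Γ, Φ p ((𝓐.bracket X Y).1 p) =
      𝓑.connBracket I φ (𝓐.anchor p (X.1 p)) (𝓐.anchor p (Y.1 p))
        (fun j x => 𝔉.coeff j (φ x) (Φ x (X.1 x))) 𝔉.sec
        (fun j x => 𝔉.coeff j (φ x) (Φ x (Y.1 x))) 𝔉.sec)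
    (X : Fin (l + 1) → Γ) :
    𝓐.koszul (pullbackForm φ Φ μ) X p =
      𝓑.koszul μ (fun m => 𝔉.ext (φ p) (Φ p ((X m).1 p))) (φ p) := by
  have hval : ∀ v : V' (φ p), (𝔉.ext (φ p) v).1 (φ p) = v :=
    fun v => 𝔉.ext_val hp.self_of_nhds v
  -- D i k is the derivative of Φ X_k along X_i at p, taken as if the frame sections were constant.
  set D : Fin (l + 1) → Fin (l + 1) → V' (φ p) := fun i k =>
    ∑ j, tangentDeriv I (𝓐.anchor p ((X i).1 p))
      (fun x => 𝔉.coeff j (φ x) (Φ x ((X k).1 x))) • (𝔉.sec j).1 (φ p) with hD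
  have hder : ∀ i : Fin (l + 1), tangentDeriv I (𝓐.anchor p ((X i).1 p))
      (fun y => pullbackForm φ Φ μ y (fun m : Fin l => (i.removeNth X m).1 y)) =
      tangentDeriv J (𝓑.anchor (φ p) (Φ p ((X i).1 p)))
        (fun z => μ z (fun m : Fin l =>
          (i.removeNth (fun m => 𝔉.ext (φ p) (Φ p ((X m).1 p))) m).1 z)) +
      ∑ m : Fin l, μ (φ p) (Function.update (i.removeNth fun m => Φ p ((X m).1 p)) m
        (D i (i.succAbove m))) := by
    intro i
    rw [← hanchor]
    exact tangentDeriv_pullbackForm hμ hφ 𝔉 hp (X := i.removeNth X)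
      (fun m j => hcoeff (i.removeNth X m) j) _
  -- In terms of D the bracket condition says that Φ ⟦X_i, X_k⟧ differs from the bracket of the
  -- frozen extensions by D i k - D k i.
  have hbr : ∀ i k : Fin (l + 1), Φ p ((𝓐.bracket (X i) (X k)).1 p) =
      (𝓑.bracket (𝔉.ext (φ p) (Φ p ((X i).1 p))) (𝔉.ext (φ p) (Φ p ((X k).1 p)))).1 (φ p) +
        (D i k - D k i) := by
    intro i k
    rw [hbracket, connBracket, ← 𝔉.ext_apply, ← 𝔉.ext_apply, add_sub_assoc]
  unfold koszul
  simp only [hder, mul_add, Finset.sum_add_distrib, hval]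
  rw [add_assoc]
  congr 1
  cases l with
  | zero => simp [bracketSum]
  | succ l =>
    -- The contributions of D to the derivative terms and to the bracket terms cancel, whatever D
    -- is.
    have hC := (μ (φ p)).sum_removeNth_update_add_eq_zero (fun m => Φ p ((X m).1 p)) D
    have hcons : ∀ (a b : V' (φ p)) (w : Fin l → V' (φ p)),
        μ (φ p) (Fin.cons (a + b) w) = μ (φ p) (Fin.cons a w) + μ (φ p) (Fin.cons b w) := by
      intro a b w
      change (μ (φ p)).curryLeft (a + b) w = _
      rw [map_add]
      rfl
    have hpull : ∀ (v : V p) (w : Fin l → V p),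
        pullbackForm φ Φ μ p (Fin.cons v w) = μ (φ p) (Fin.cons (Φ p v) (fun m => Φ p (w m))) := by
      intro v w
      refine congrArg (μ (φ p)) (funext fun m => ?_)
      refine Fin.cases rfl (fun m => rfl) m
    rw [bracketSum_succ, bracketSum_succ]
    simp only [hval]
    have hsum : ∀ i j : Fin (l + 1), (-1 : ℝ) ^ ((i : ℕ) + (j : ℕ)) *
        pullbackForm φ Φ μ p (Fin.cons ((𝓐.bracket (X i.castSucc) (X j.succ)).1 p)
          (j.removeNth (i.castSucc.removeNth fun m => (X m).1 p))) =
        (-1 : ℝ) ^ ((i : ℕ) + (j : ℕ)) * μ (φ p) (Fin.cons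
          ((𝓑.bracket (𝔉.ext (φ p) (Φ p ((X i.castSucc).1 p)))
            (𝔉.ext (φ p) (Φ p ((X j.succ).1 p)))).1 (φ p))
          (j.removeNth (i.castSucc.removeNth fun m => Φ p ((X m).1 p)))) +
        (-1 : ℝ) ^ ((i : ℕ) + (j : ℕ)) *
          μ (φ p) (Fin.cons (D i.castSucc j.succ - D j.succ i.castSucc)
          (j.removeNth (i.castSucc.removeNth fun m => Φ p ((X m).1 p)))) := by
      intro i j
      rw [hpull, hbr, hcons, mul_add]
      rfl
    simp only [hsum, Finset.sum_add_distrib]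
    linear_combination hC

/-- Koszul's formula only depends on the values of the sections. -/
theorem koszul_ext (hΓ : IsSmoothModule I Γ) {l : ℕ} {μ : FormField V l}
    (hμ : IsSmoothForm I Γ μ) {ι : Type} [Fintype ι] {p : M} (𝔉 : CutoffFrame I Γ ι p)
    (X : Fin (l + 1) → Γ) :
    𝓐.koszul μ X p = 𝓐.koszul μ (fun m => 𝔉.ext p ((X m).1 p)) p :=
  -- This is naturality for the identity map: the formula on the target is evaluated on the
  -- extensions with frozen coefficients, which depend only on the values of the sections at p.
  koszul_pullbackForm (𝓐 := 𝓐) (𝓑 := 𝓐) hμ (φ := id) (Φ := fun _ => LinearMap.id)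
    mdifferentiableAt_id 𝔉 𝔉.cutoff_eq (fun X j => (𝔉.contMDiff_coeff j X).mdiffAt p)
    (fun v => by
      rw [mfderiv_id]
      rfl)
    (fun X Y => bracket_eq_connBracket hΓ 𝔉 𝔉.cutoff_eq X Y) X

/-- The exterior differential of a smooth form is given by Koszul's formula. -/
theorem d_apply (hΓ : IsSmoothModule I Γ) (hfr : HasCutoffFrames I Γ) {l : ℕ} {μ : FormField V l}
    (hμ : IsSmoothForm I Γ μ) (X : Fin (l + 1) → Γ) (x : M) :
    𝓐.d μ x (fun m => (X m).1 x) = 𝓐.koszul μ X x := by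
  have hex : ∃ ν : FormField V (l + 1), ∀ (X : Fin (l + 1) → Γ) (x : M),
      ν x (fun m => (X m).1 x) = 𝓐.koszul μ X x := by
    choose ι hι 𝔉 using hfr
    choose K hK using 𝓐.exists_alternatingMap_koszul hμ
    -- The form at x extends the given vectors to sections by a frame around x and evaluates
    -- Koszul's formula there. By `koszul_ext`, other extensions give the same value.
    refine ⟨fun x => (K x).compLinearMap ((𝔉 x).some.ext x), fun X x => ?_⟩
    rw [koszul_ext hΓ hμ (𝔉 x).some X, ← hK]
    rfl
  unfold d
  rw [dif_pos hex]
  exact hex.choose_spec X x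

/-- A smooth bundle map that is compatible with the anchors and with the brackets is a morphism of
Lie algebroids. -/
theorem isLieAlgebroidMorphism_of_bracket (hΓ : IsSmoothModule I Γ) (hfr : HasCutoffFrames I Γ)
    (hΓ' : IsSmoothModule J Γ') {φ : M → N} (hφ : ContMDiff I J ∞ φ)
    {Φ : ∀ x, V x →ₗ[ℝ] V' (φ x)}
    (hanchor : ∀ p v, mfderiv I J φ p (𝓐.anchor p v) = 𝓑.anchor (φ p) (Φ p v))
    (hframe : ∀ q, ∃ (ι : Type) (_ : Fintype ι) (𝔉 : CutoffFrame J Γ' ι q),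
      (∀ (X : Γ) (j : ι), ContMDiff I 𝓘(ℝ, ℝ) ∞ (fun x => 𝔉.coeff j (φ x) (Φ x (X.1 x)))) ∧
      ∀ p, φ p = q → ∀ X Y : Γ, Φ p ((𝓐.bracket X Y).1 p) =
        𝓑.connBracket I φ (𝓐.anchor p (X.1 p)) (𝓐.anchor p (Y.1 p))
          (fun j x => 𝔉.coeff j (φ x) (Φ x (X.1 x))) 𝔉.sec
          (fun j x => 𝔉.coeff j (φ x) (Φ x (Y.1 x))) 𝔉.sec) :
    IsLieAlgebroidMorphism 𝓐 𝓑 φ Φ where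
  contMDiff_base := hφ
  isSmoothForm_pullback _ _ hμ := isSmoothForm_pullbackForm hφ
    (fun q => (hframe q).imp fun _ h => h.imp fun _ h => h.imp fun _ h => h.1) hμ
  d_pullback l μ hμ := by
    funext p
    ext v
    obtain ⟨ι, _, 𝔉, hcoeff, hbracket⟩ := hframe (φ p)
    obtain ⟨κ, _, ⟨𝔊⟩⟩ := hfr p
    have hfr' : HasCutoffFrames J Γ' := fun q => by
      obtain ⟨ι, h, 𝔉, -⟩ := hframe q
      exact ⟨ι, h, ⟨𝔉⟩⟩
    have hμ' : IsSmoothForm I Γ (pullbackForm φ Φ μ) := isSmoothForm_pullbackForm hφ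
      (fun q => (hframe q).imp fun _ h => h.imp fun _ h => h.imp fun _ h => h.1) hμ
    -- Vectors in the fibre at p are values of sections, so both differentials can be evaluated by
    -- Koszul's formula.
    have hv : (fun m => (𝔊.ext p (v m)).1 p) = v :=
      funext fun m => 𝔊.ext_val 𝔊.cutoff_self _
    have h1 := d_apply (𝓐 := 𝓐) hΓ hfr hμ' (fun m => 𝔊.ext p (v m)) p
    rw [hv, koszul_pullbackForm (𝓑 := 𝓑) hμ (hφ.mdiffAt p) 𝔉
      (hφ.continuous.continuousAt.eventually 𝔉.cutoff_eq) (fun X j => (hcoeff X j).mdiffAt p)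
      (hanchor p) (hbracket p rfl), ← d_apply hΓ' hfr' hμ] at h1
    rw [h1]
    refine congrArg (𝓑.d μ (φ p)) (funext fun m => ?_)
    rw [𝔉.ext_val 𝔉.cutoff_self, 𝔊.ext_val 𝔊.cutoff_self]

end LieAlgebroid

end KoszulPullback

/-! ### Frames of vector bundles and smooth sections along maps. -/

section BundleFrame

variable {EM : Type*} [NormedAddCommGroup EM] [NormedSpace ℝ EM] {H : Type*} [TopologicalSpace H]
  {I : ModelWithCorners ℝ EM H} {B : Type*} [TopologicalSpace B] [ChartedSpace H B]
  {F : Type*} [NormedAddCommGroup F] [NormedSpace ℝ F] {E : B → Type*}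
  [TopologicalSpace (TotalSpace F E)] [∀ x, AddCommGroup (E x)] [∀ x, Module ℝ (E x)]
  [∀ x, TopologicalSpace (E x)] [FiberBundle F E] [VectorBundle ℝ F E]
  {EN : Type*} [NormedAddCommGroup EN] [NormedSpace ℝ EN] {HN : Type*} [TopologicalSpace HN]
  {J : ModelWithCorners ℝ EN HN} {N : Type*} [TopologicalSpace N] [ChartedSpace HN N]

theorem exists_contMDiff_cutoff [FiniteDimensional ℝ EM] [T2Space B] [IsManifold I ∞ B] (q : B)
    {s : Set B} (hs : s ∈ 𝓝 q) :
    ∃ χ : B → ℝ, ContMDiff I 𝓘(ℝ, ℝ) ∞ χ ∧ χ =ᶠ[𝓝 q] (fun _ => 1) ∧ tsupport χ ⊆ s := by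
  obtain ⟨f, -, hf⟩ := (SmoothBumpFunction.nhds_basis_tsupport (I := I) q).mem_iff.1 hs
  exact ⟨f, f.contMDiff, f.eventuallyEq_one, hf⟩

theorem eq_zero_of_notMem_tsupport {X R : Type*} [TopologicalSpace X] [Zero R]
    {f : X → R} {s : Set X} (hf : tsupport f ⊆ s) {x : X} (hx : x ∉ s) : f x = 0 :=
  image_eq_zero_of_notMem_tsupport fun h => hx (hf h)

theorem contMDiffAt_along_zero {g : N → B} {x : N} (hg : ContMDiffAt J I ∞ g x) :
    ContMDiffAt J (I.prod 𝓘(ℝ, F)) ∞ (fun x => (⟨g x, 0⟩ : TotalSpace F E)) x :=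
  (contMDiff_zeroSection ℝ E (IB := I) (n := ∞) (g x)).comp x hg

/-- A section along g is a map into the total space that covers g, not a section over its own
domain. The vector operations are therefore checked in a trivialization around g(x), where they are
fibrewise linear. -/
theorem contMDiffAt_along_add {g : N → B} {x : N} {a b : ∀ x, E (g x)}
    (ha : ContMDiffAt J (I.prod 𝓘(ℝ, F)) ∞ (fun x => (⟨g x, a x⟩ : TotalSpace F E)) x)
    (hb : ContMDiffAt J (I.prod 𝓘(ℝ, F)) ∞ (fun x => (⟨g x, b x⟩ : TotalSpace F E)) x) :
    ContMDiffAt J (I.prod 𝓘(ℝ, F)) ∞ (fun x => (⟨g x, a x + b x⟩ : TotalSpace F E)) x := by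
  have h1 := contMDiffAt_totalSpace.1 ha
  have h2 := contMDiffAt_totalSpace.1 hb
  refine contMDiffAt_totalSpace.2 ⟨h1.1, (h1.2.add h2.2).congr_of_eventuallyEq ?_⟩
  filter_upwards [h1.1.continuousAt.preimage_mem_nhds
    ((trivializationAt F E (g x)).open_baseSet.mem_nhds
      (mem_baseSet_trivializationAt F E (g x)))] with y hy
  exact ((trivializationAt F E (g x)).linear ℝ hy).1 _ _

theorem contMDiffAt_along_smul {g : N → B} {x : N} {f : N → ℝ} {a : ∀ x, E (g x)}
    (hf : ContMDiffAt J 𝓘(ℝ, ℝ) ∞ f x)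
    (ha : ContMDiffAt J (I.prod 𝓘(ℝ, F)) ∞ (fun x => (⟨g x, a x⟩ : TotalSpace F E)) x) :
    ContMDiffAt J (I.prod 𝓘(ℝ, F)) ∞ (fun x => (⟨g x, f x • a x⟩ : TotalSpace F E)) x := by
  have h1 := contMDiffAt_totalSpace.1 ha
  refine contMDiffAt_totalSpace.2 ⟨h1.1, (hf.smul h1.2).congr_of_eventuallyEq ?_⟩
  filter_upwards [h1.1.continuousAt.preimage_mem_nhds
    ((trivializationAt F E (g x)).open_baseSet.mem_nhds
      (mem_baseSet_trivializationAt F E (g x)))] with y hy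
  exact ((trivializationAt F E (g x)).linear ℝ hy).2 _ _

theorem contMDiffAt_along_sum {g : N → B} {x : N} (hg : ContMDiffAt J I ∞ g x) {ι : Type*}
    (s : Finset ι) {a : ι → ∀ x, E (g x)}
    (ha : ∀ i ∈ s, ContMDiffAt J (I.prod 𝓘(ℝ, F)) ∞
      (fun x => (⟨g x, a i x⟩ : TotalSpace F E)) x) :
    ContMDiffAt J (I.prod 𝓘(ℝ, F)) ∞ (fun x => (⟨g x, ∑ i ∈ s, a i x⟩ : TotalSpace F E)) x := by
  classical
  induction s using Finset.induction_on with
  | empty =>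
    simp only [Finset.sum_empty]
    exact contMDiffAt_along_zero hg
  | insert i s hi ih =>
    simp only [Finset.sum_insert hi]
    exact contMDiffAt_along_add (ha i (Finset.mem_insert_self i s))
      (ih fun j hj => ha j (Finset.mem_insert_of_mem hj))

variable (e : Trivialization F (π F E)) [MemTrivializationAtlas e]

/-- A compactly supported local representative defines a smooth section. -/
theorem contMDiff_symmₗ_section [ContMDiffVectorBundle ∞ F E I] {K : Set B} (hK : IsClosed K)
    (hKe : K ⊆ e.baseSet) {s : B → F} (hs : ∀ x ∈ e.baseSet, ContMDiffAt I 𝓘(ℝ, F) ∞ s x)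
    (hs0 : ∀ x ∉ K, s x = 0) :
    ContMDiff I (I.prod 𝓘(ℝ, F)) ∞ (fun x => (⟨x, e.symmₗ ℝ x (s x)⟩ : TotalSpace F E)) := by
  intro x
  by_cases hx : x ∈ e.baseSet
  · refine (e.contMDiffAt_section_iff hx).2 ((hs x hx).congr_of_eventuallyEq ?_)
    filter_upwards [e.open_baseSet.mem_nhds hx] with y hy
    have := e.linearMapAt_symmₗ (R := ℝ) hy (s y)
    rwa [e.coe_linearMapAt_of_mem hy] at this
  · refine (contMDiff_zeroSection ℝ E (IB := I) (n := ∞) x).congr_of_eventuallyEq ?_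
    filter_upwards [hK.isOpen_compl.mem_nhds fun h => hx (hKe h)] with y hy
    rw [hs0 y hy, map_zero]
    rfl

theorem contMDiffAt_linearMapAt [ContMDiffVectorBundle ∞ F E I] {g : N → B} {x : N}
    (hx : g x ∈ e.baseSet) {a : ∀ x, E (g x)}
    (ha : ContMDiffAt J (I.prod 𝓘(ℝ, F)) ∞ (fun x => (⟨g x, a x⟩ : TotalSpace F E)) x) :
    ContMDiffAt J 𝓘(ℝ, F) ∞ (fun x => e.linearMapAt ℝ (g x) (a x)) x := by
  have h := (e.contMDiffAt_iff (e.mem_source.2 hx)).1 ha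
  refine h.2.congr_of_eventuallyEq ?_
  filter_upwards [h.1.continuousAt.preimage_mem_nhds (e.open_baseSet.mem_nhds hx)] with y hy
  rw [e.coe_linearMapAt_of_mem hy]

/-- The coordinates in e are smooth only over its base set. Around the points that g maps outside
it, the cutoff annihilates them. -/
theorem contMDiff_cutoff_mul_linearMapAt [ContMDiffVectorBundle ∞ F E I] {K : Set B}
    (hK : IsClosed K) (hKe : K ⊆ e.baseSet) {χ : B → ℝ} (hχ : ContMDiff I 𝓘(ℝ, ℝ) ∞ χ)
    (hχ0 : ∀ x ∉ K, χ x = 0) {g : N → B} (hg : ContMDiff J I ∞ g) {a : ∀ x, E (g x)}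
    (ha : ContMDiff J (I.prod 𝓘(ℝ, F)) ∞ (fun x => (⟨g x, a x⟩ : TotalSpace F E)))
    (ℓ : F →L[ℝ] ℝ) :
    ContMDiff J 𝓘(ℝ, ℝ) ∞ (fun x => χ (g x) * ℓ (e.linearMapAt ℝ (g x) (a x))) := by
  intro x
  by_cases hx : g x ∈ e.baseSet
  · exact ((hχ.comp hg) x).mul
      (ℓ.contMDiff.contMDiffAt.comp x (contMDiffAt_linearMapAt e hx (ha x)))
  · refine (contMDiffAt_const (c := (0 : ℝ))).congr_of_eventuallyEq ?_
    filter_upwards [hg.continuous.continuousAt.preimage_mem_nhds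
      (hK.isOpen_compl.mem_nhds fun h => hx (hKe h))] with y hy
    rw [hχ0 _ hy, zero_mul]

theorem isSmoothModule_smoothSections : IsSmoothModule I (smoothSections I F E) :=
  fun _ hf _ hσ => ContMDiff.smul_section hf hσ

variable [FiniteDimensional ℝ F] [ContMDiffVectorBundle ∞ F E I]

/-- The cutoff frame of a vector bundle given by a trivialization. -/
noncomputable def bundleFrame {q : B} {χ : B → ℝ} (hχ : ContMDiff I 𝓘(ℝ, ℝ) ∞ χ)
    (hχ1 : χ =ᶠ[𝓝 q] fun _ => 1) (hχe : tsupport χ ⊆ e.baseSet) :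
    CutoffFrame I (smoothSections I F E) (Fin (Module.finrank ℝ F)) q where
  sec i := ⟨fun x => e.symmₗ ℝ x (χ x • Module.finBasis ℝ F i),
    contMDiff_symmₗ_section e (isClosed_tsupport χ) hχe
      (fun x _ => (hχ x).smul contMDiffAt_const)
      (fun x hx => by rw [image_eq_zero_of_notMem_tsupport hx, zero_smul])⟩
  coeff i x := χ x • ((Module.finBasis ℝ F).coord i ∘ₗ e.linearMapAt ℝ x)
  -- The sections and the coefficients each carry one factor χ, since each of them has to be
  -- extended by zero outside the base set.
  cutoff x := χ x * χ x
  contMDiff_cutoff := hχ.mul hχ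
  cutoff_eq := by
    filter_upwards [hχ1] with x hx
    rw [hx, mul_one]
  sum_coeff x v := by
    by_cases hx : x ∈ e.baseSet
    · conv_rhs => rw [← e.symmₗ_linearMapAt (R := ℝ) hx v,
        ← (Module.finBasis ℝ F).sum_repr (e.linearMapAt ℝ x v)]
      simp only [LinearMap.smul_apply, LinearMap.comp_apply, Module.Basis.coord_apply, map_smul,
        map_sum, Finset.smul_sum, smul_smul, smul_eq_mul]
      refine Finset.sum_congr rfl fun i _ => ?_
      congr 1
      ring
    · rw [eq_zero_of_notMem_tsupport hχe hx]
      simp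
  contMDiff_coeff i σ := contMDiff_cutoff_mul_linearMapAt e (isClosed_tsupport χ) hχe hχ
    (fun _ h => image_eq_zero_of_notMem_tsupport h) contMDiff_id σ.2
    ((Module.finBasis ℝ F).coord i).toContinuousLinearMap

theorem contMDiff_bundleFrame_coeff {q : B} {χ : B → ℝ} (hχ : ContMDiff I 𝓘(ℝ, ℝ) ∞ χ)
    (hχ1 : χ =ᶠ[𝓝 q] fun _ => 1) (hχe : tsupport χ ⊆ e.baseSet) {g : N → B}
    (hg : ContMDiff J I ∞ g) {a : ∀ x, E (g x)}
    (ha : ContMDiff J (I.prod 𝓘(ℝ, F)) ∞ (fun x => (⟨g x, a x⟩ : TotalSpace F E)))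
    (i : Fin (Module.finrank ℝ F)) :
    ContMDiff J 𝓘(ℝ, ℝ) ∞ (fun x => (bundleFrame e hχ hχ1 hχe).coeff i (g x) (a x)) :=
  contMDiff_cutoff_mul_linearMapAt e (isClosed_tsupport χ) hχe hχ
    (fun _ h => image_eq_zero_of_notMem_tsupport h) hg ha
    ((Module.finBasis ℝ F).coord i).toContinuousLinearMap

end BundleFrame

/-! ### Frames of projectable sections of a prolongation. -/

section ProlongationFrame

variable {EM : Type*} [NormedAddCommGroup EM] [NormedSpace ℝ EM] {H : Type*} [TopologicalSpace H]
  {I : ModelWithCorners ℝ EM H} {Q : Type*} [TopologicalSpace Q] [ChartedSpace H Q]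
  {EP : Type*} [NormedAddCommGroup EP] [NormedSpace ℝ EP] {HP : Type*} [TopologicalSpace HP]
  {IP : ModelWithCorners ℝ EP HP} {P : Type*} [TopologicalSpace P] [ChartedSpace HP P]

/-- In the preferred charts at `p₀` and `proj p₀`, `proj` is a linear projection `A` with section
`S`, and the domain of the chart at `p₀` contains the preimage of a neighbourhood of `proj p₀`. -/
structure IsChartProjectionAt (I : ModelWithCorners ℝ EM H) (IP : ModelWithCorners ℝ EP HP)
    (proj : P → Q) (p₀ : P) (A : EP →L[ℝ] EM) (S : EM →L[ℝ] EP) : Prop where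
  apply_section : ∀ x, A (S x) = x
  mem_source : ∀ p ∈ (chartAt HP p₀).source, proj p ∈ (chartAt H (proj p₀)).source
  exists_preimage_subset : ∃ W ∈ 𝓝 (proj p₀), ∀ p, proj p ∈ W → p ∈ (chartAt HP p₀).source
  extChartAt_proj : ∀ p ∈ (chartAt HP p₀).source,
    extChartAt I (proj p₀) (proj p) = A (extChartAt IP p₀ p)

variable [IsManifold I 1 Q] [IsManifold IP 1 P] {proj : P → Q} {p₀ : P} {A : EP →L[ℝ] EM}
  {S : EM →L[ℝ] EP}

/-- The tangent trivializations are the derivatives of the preferred charts, so this is the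
derivative of the identity that expresses proj as A in these charts. -/
theorem IsChartProjectionAt.linearMapAt_mfderiv (hA : IsChartProjectionAt I IP proj p₀ A S)
    (hproj : ContMDiff IP I ∞ proj) {p : P} (hp : p ∈ (chartAt HP p₀).source)
    (v : TangentSpace IP p) :
    (trivializationAt EM (TangentSpace I) (proj p₀)).linearMapAt ℝ (proj p)
      (mfderiv IP I proj p v) =
      A ((trivializationAt EP (TangentSpace IP) p₀).linearMapAt ℝ p v) := by
  have hq : proj p ∈ (chartAt H (proj p₀)).source := hA.mem_source p hp
  have h1 := congrArg (fun L : EM →L[ℝ] EM => L (mfderiv IP I proj p v))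
    (TangentBundle.continuousLinearMapAt_trivializationAt (I := I) hq)
  have h2 := congrArg (fun L : EP →L[ℝ] EP => L v)
    (TangentBundle.continuousLinearMapAt_trivializationAt (I := IP) hp)
  refine h1.trans (Eq.trans ?_ (congrArg A h2).symm)
  have h3 : (extChartAt I (proj p₀) ∘ proj) =ᶠ[𝓝 p] (A ∘ extChartAt IP p₀) := by
    filter_upwards [(chartAt HP p₀).open_source.mem_nhds hp] with y hy
    exact hA.extChartAt_proj y hy
  have h4 := h3.mfderiv_eq (I := IP) (I' := 𝓘(ℝ, EM))
  rw [mfderiv_comp p (mdifferentiableAt_extChartAt hq) (hproj.mdiffAt p),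
    mfderiv_comp p (I' := 𝓘(ℝ, EP))
      ((A.contMDiff (n := 1)).contMDiffAt.mdifferentiableAt one_ne_zero)
      (mdifferentiableAt_extChartAt hp), ContinuousLinearMap.mfderiv_eq] at h4
  exact congrArg (fun L : EP →L[ℝ] EM => L v) h4

variable {F : Type*} [NormedAddCommGroup F] [NormedSpace ℝ F] {E : Q → Type*}
  [TopologicalSpace (TotalSpace F E)] [∀ x, AddCommGroup (E x)] [∀ x, Module ℝ (E x)]
  [∀ x, TopologicalSpace (E x)] [FiberBundle F E] [VectorBundle ℝ F E]
  (𝓔 : LieAlgebroid I (smoothSections I F E)) {hproj : ContMDiff IP I ∞ proj}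

theorem isSmoothModule_prolongationSections :
    IsSmoothModule IP (prolongationSections 𝓔 IP proj hproj) :=
  fun _ hf _ hX => ⟨fun p => contMDiffAt_along_smul (hf p) (hX.1 p),
    ContMDiff.smul_section hf hX.2⟩

variable [IsManifold I ∞ Q] [IsManifold IP ∞ P]

omit [IsManifold I 1 Q] [IsManifold I ∞ Q] in
theorem contMDiff_chart_lift (hproj : ContMDiff IP I ∞ proj)
    {χ : Q → ℝ} (hχs : ∀ p, proj p ∈ tsupport χ → p ∈ (chartAt HP p₀).source) {s : P → EP}
    (hs : ∀ p ∈ (chartAt HP p₀).source, ContMDiffAt IP 𝓘(ℝ, EP) ∞ s p)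
    (hs0 : ∀ p, proj p ∉ tsupport χ → s p = 0) :
    ContMDiff IP IP.tangent ∞ (fun p => (⟨p,
      (trivializationAt EP (TangentSpace IP) p₀).symmₗ ℝ p (s p)⟩ : TangentBundle IP P)) :=
  contMDiff_symmₗ_section (trivializationAt EP (TangentSpace IP) p₀)
    ((isClosed_tsupport χ).preimage hproj.continuous)
    (fun p hp => hχs p hp) hs hs0

variable [FiniteDimensional ℝ EP] [FiniteDimensional ℝ EM] [FiniteDimensional ℝ F] [T2Space Q]
  [ContMDiffVectorBundle ∞ F E I]

/-- Every point of `P` has a cutoff frame of the prolongation that consists of projectable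
sections. Its coefficients are smooth on sections along smooth maps. -/
theorem exists_prolongation_frame (hA : IsChartProjectionAt I IP proj p₀ A S) :
    ∃ (ι : Type) (_ : Fintype ι)
      (𝔉 : CutoffFrame IP (prolongationSections 𝓔 IP proj hproj) ι p₀)
      (σ : ι → smoothSections I F E),
      (∀ i p, ((𝔉.sec i).1 p).1.1 = (σ i).1 (proj p)) ∧
      ∀ {EN : Type*} [NormedAddCommGroup EN] [NormedSpace ℝ EN] {HN : Type*} [TopologicalSpace HN]
        {J : ModelWithCorners ℝ EN HN} {N : Type*} [TopologicalSpace N] [ChartedSpace HN N]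
        (g : N → P) (_ : ContMDiff J IP ∞ g) (a : ∀ x, Prolongation 𝓔 IP proj (g x))
        (_ : ContMDiff J (I.prod 𝓘(ℝ, F)) ∞ (fun x => (⟨proj (g x), (a x).1.1⟩ : TotalSpace F E)))
        (_ : ContMDiff J IP.tangent ∞ (fun x => (⟨g x, (a x).1.2⟩ : TangentBundle IP P))) (i : ι),
        ContMDiff J 𝓘(ℝ, ℝ) ∞ (fun x => 𝔉.coeff i (g x) (a x)) := by
  set e := trivializationAt F E (proj p₀) with he
  set eQ := trivializationAt EM (TangentSpace I) (proj p₀) with heQ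
  set eP := trivializationAt EP (TangentSpace IP) p₀ with heP
  -- The cutoff has to be pulled back from Q, for otherwise the frame sections would not be
  -- projectable. Since the domain of the chart on P contains the whole preimage of W, a cutoff with
  -- support in W is enough to stay in that domain.
  obtain ⟨W, hWq, hW⟩ := hA.exists_preimage_subset
  obtain ⟨χ, hχ, hχ1, hχs⟩ := exists_contMDiff_cutoff (I := I) (proj p₀)
    (Filter.inter_mem (e.open_baseSet.mem_nhds (mem_baseSet_trivializationAt F E (proj p₀))) hWq)
  have hχe : tsupport χ ⊆ e.baseSet := hχs.trans inter_subset_left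
  have hχc : tsupport χ ⊆ W := hχs.trans inter_subset_right
  set 𝔈 := bundleFrame e hχ hχ1 hχe with h𝔈
  have h𝔈0 : ∀ i q, q ∉ tsupport χ → (𝔈.sec i).1 q = 0 := fun i q hq => by
    change e.symmₗ ℝ q (χ q • _) = 0
    rw [image_eq_zero_of_notMem_tsupport hq, zero_smul, map_zero]
  have hbP : ∀ p, p ∈ (chartAt HP p₀).source → p ∈ eP.baseSet := fun p hp => hp
  have hbQ : ∀ p, p ∈ (chartAt HP p₀).source → proj p ∈ eQ.baseSet :=
    fun p hp => hA.mem_source p hp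
  have hAP : ∀ p ∈ (chartAt HP p₀).source, ∀ v : TangentSpace IP p,
      eQ.linearMapAt ℝ (proj p) (mfderiv IP I proj p v) = A (eP.linearMapAt ℝ p v) :=
    fun p hp v => hA.linearMapAt_mfderiv hproj hp v
  -- R is the projection onto ker A, the vertical directions in the chart, along the image of S. A
  -- vector x is the sum of its horizontal part S (A x) and its vertical part R x.
  set R : EP →L[ℝ] EP := ContinuousLinearMap.id ℝ EP - S.comp A with hR
  have hRapply : ∀ x, R x = x - S (A x) := fun x => rfl
  have hAR : ∀ x, A (R x) = 0 := fun x => by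
    rw [hRapply, map_sub, hA.apply_section, sub_self]
  let b := Module.finBasis ℝ EP
  -- Horizontal frame sections pair a frame section of E with the lift of its anchor through S, and
  -- vertical ones pair 0 with a spanning family of ker A. The vectors R (b i) are in general
  -- linearly dependent, which a cutoff frame permits.
  let horS : Fin (Module.finrank ℝ F) → P → EP := fun i p =>
    S (eQ.linearMapAt ℝ (proj p) (𝓔.anchor (proj p) ((𝔈.sec i).1 (proj p))))
  have horS0 : ∀ i p, proj p ∉ tsupport χ → horS i p = 0 := fun i p hp => by
    simp only [horS]
    rw [h𝔈0 i _ hp, map_zero, map_zero, map_zero]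
  let verS : Fin (Module.finrank ℝ EP) → P → EP := fun i p => χ (proj p) • R (b i)
  have verS0 : ∀ i p, proj p ∉ tsupport χ → verS i p = 0 := fun i p hp => by
    simp only [verS]
    rw [image_eq_zero_of_notMem_tsupport hp, zero_smul]
  let hor : Fin (Module.finrank ℝ F) → prolongationSections 𝓔 IP proj hproj := fun i =>
    ⟨fun p => ⟨((𝔈.sec i).1 (proj p), eP.symmₗ ℝ p (horS i p)), by
      change 𝓔.anchor (proj p) ((𝔈.sec i).1 (proj p)) =
        mfderiv IP I proj p (eP.symmₗ ℝ p (horS i p))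
      by_cases hp : p ∈ (chartAt HP p₀).source
      · rw [← eQ.symmₗ_linearMapAt (R := ℝ) (hbQ p hp) (mfderiv IP I proj p _), hAP p hp,
          eP.linearMapAt_symmₗ (hbP p hp), hA.apply_section,
          eQ.symmₗ_linearMapAt (R := ℝ) (hbQ p hp)]
      · have hp' : proj p ∉ tsupport χ := fun h => hp (hW p (hχc h))
        rw [horS0 i p hp', h𝔈0 i _ hp', map_zero, map_zero, map_zero]⟩,
    (𝔈.sec i).2.comp hproj,
    contMDiff_chart_lift hproj (fun p h => hW p (hχc h)) (fun p hp => S.contMDiff.contMDiffAt.comp p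
      (contMDiffAt_linearMapAt eQ (hbQ p hp)
        (((𝓔.contMDiff_anchor (𝔈.sec i)).comp hproj) p))) (horS0 i)⟩
  let ver : Fin (Module.finrank ℝ EP) → prolongationSections 𝓔 IP proj hproj := fun i =>
    ⟨fun p => ⟨(0, eP.symmₗ ℝ p (verS i p)), by
      change 𝓔.anchor (proj p) 0 = mfderiv IP I proj p (eP.symmₗ ℝ p (verS i p))
      rw [map_zero]
      by_cases hp : p ∈ (chartAt HP p₀).source
      · rw [← eQ.symmₗ_linearMapAt (R := ℝ) (hbQ p hp) (mfderiv IP I proj p _), hAP p hp,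
          eP.linearMapAt_symmₗ (hbP p hp)]
        simp only [verS]
        rw [map_smul, hAR, smul_zero, map_zero]
      · have hp' : proj p ∉ tsupport χ := fun h => hp (hW p (hχc h))
        rw [verS0 i p hp', map_zero, map_zero]⟩,
    fun p => contMDiffAt_along_zero (hproj p),
    contMDiff_chart_lift hproj (fun p h => hW p (hχc h))
      (fun p _ => ((hχ.comp hproj) p).smul contMDiffAt_const) (verS0 i)⟩
  let coeff : Fin (Module.finrank ℝ F) ⊕ Fin (Module.finrank ℝ EP) →
      ∀ p, Prolongation 𝓔 IP proj p →ₗ[ℝ] ℝ := fun j p =>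
    j.elim (fun i => 𝔈.coeff i (proj p) ∘ₗ LinearMap.fst ℝ _ _ ∘ₗ Submodule.subtype _)
      (fun i => χ (proj p) • (b.coord i ∘ₗ R.toLinearMap ∘ₗ eP.linearMapAt ℝ p ∘ₗ
        LinearMap.snd ℝ _ _ ∘ₗ Submodule.subtype _))
  refine ⟨Fin (Module.finrank ℝ F) ⊕ Fin (Module.finrank ℝ EP), inferInstance,
    { sec := Sum.elim hor ver
      coeff := coeff
      cutoff := fun p => 𝔈.cutoff (proj p)
      contMDiff_cutoff := 𝔈.contMDiff_cutoff.comp hproj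
      cutoff_eq := hproj.continuous.continuousAt.eventually 𝔈.cutoff_eq
      sum_coeff := ?_
      contMDiff_coeff := fun j X => ?_ }, Sum.elim 𝔈.sec (fun _ => 0), ?_, ?_⟩
  · intro p x
    rw [Fintype.sum_sum_type]
    refine Subtype.ext (Prod.ext ?_ ?_)
    · simp only [Submodule.coe_add, Submodule.coe_sum, Submodule.coe_smul, Prod.fst_add,
        Prod.fst_sum, Prod.smul_fst]
      refine Eq.trans ?_ (𝔈.sum_coeff (proj p) x.1.1)
      refine (congrArg₂ (· + ·) rfl (Finset.sum_eq_zero fun i _ => ?_)).trans (add_zero _)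
      exact smul_zero _
    · simp only [Submodule.coe_add, Submodule.coe_sum, Submodule.coe_smul, Prod.snd_add,
        Prod.snd_sum, Prod.smul_snd]
      have h1 : ∑ i, coeff (Sum.inl i) p x • eP.symmₗ ℝ p (horS i p) =
          𝔈.cutoff (proj p) • eP.symmₗ ℝ p (S (eQ.linearMapAt ℝ (proj p)
            (𝓔.anchor (proj p) x.1.1))) := by
        have h2 := congrArg (fun y => eP.symmₗ ℝ p (S (eQ.linearMapAt ℝ (proj p)
            (𝓔.anchor (proj p) y)))) (𝔈.sum_coeff (proj p) x.1.1)
        simp only [map_sum, map_smul] at h2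
        exact h2
      have h2 : ∑ i, coeff (Sum.inr i) p x • eP.symmₗ ℝ p (verS i p) =
          𝔈.cutoff (proj p) • eP.symmₗ ℝ p (R (eP.linearMapAt ℝ p x.1.2)) := by
        -- R is idempotent, and the second application is the one contained in the vertical frame
        -- sections.
        have hRR : R (eP.linearMapAt ℝ p x.1.2) = R (R (eP.linearMapAt ℝ p x.1.2)) := by
          rw [hRapply (R _), hAR, map_zero, sub_zero]
        rw [hRR, ← b.sum_repr (R (eP.linearMapAt ℝ p x.1.2)), map_sum, map_sum, Finset.smul_sum]
        refine Finset.sum_congr rfl fun i _ => ?_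
        rw [map_smul, map_smul, map_smul, smul_smul, smul_smul]
        change (χ (proj p) * b.repr (R (eP.linearMapAt ℝ p x.1.2)) i * χ (proj p)) • _ =
          (χ (proj p) * χ (proj p) * b.repr (R (eP.linearMapAt ℝ p x.1.2)) i) • _
        congr 1
        ring
      refine (congrArg₂ (· + ·) h1 h2).trans ?_
      rw [← smul_add, ← map_add]
      by_cases hp : p ∈ (chartAt HP p₀).source
      -- Here the defining condition of the fibre enters: ρ(a) = dproj(v) turns the sum of the two
      -- parts into S (A v) + R v = v, in the coordinates of the chart.
      · have hx : 𝓔.anchor (proj p) x.1.1 = mfderiv IP I proj p x.1.2 := x.2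
        rw [hx, hAP p hp, hRapply, add_sub_cancel, eP.symmₗ_linearMapAt (R := ℝ) (hbP p hp)]
      · have h0 : 𝔈.cutoff (proj p) = 0 := by
          change χ (proj p) * χ (proj p) = 0
          rw [eq_zero_of_notMem_tsupport hχc fun h => hp (hW p h), zero_mul]
        rw [h0, zero_smul, zero_smul]
  · rcases j with i | i
    · exact contMDiff_bundleFrame_coeff e hχ hχ1 hχe hproj X.2.1 i
    · exact contMDiff_cutoff_mul_linearMapAt eP
        ((isClosed_tsupport χ).preimage hproj.continuous)
        (fun p hp => hbP p (hW p (hχc hp))) (χ := χ ∘ proj) (hχ.comp hproj)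
        (fun p (hp : proj p ∉ tsupport χ) => image_eq_zero_of_notMem_tsupport (f := χ) hp)
        contMDiff_id X.2.2 ((b.coord i).toContinuousLinearMap.comp R)
  · rintro (i | i) p <;> rfl
  · intro EN _ _ HN _ J N _ _ g hg a ha1 ha2 i
    rcases i with i | i
    · exact contMDiff_bundleFrame_coeff e hχ hχ1 hχe (hproj.comp hg) ha1 i
    · exact contMDiff_cutoff_mul_linearMapAt eP
        ((isClosed_tsupport χ).preimage hproj.continuous)
        (fun p hp => hbP p (hW p (hχc hp))) (χ := χ ∘ proj) (hχ.comp hproj)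
        (fun p (hp : proj p ∉ tsupport χ) => image_eq_zero_of_notMem_tsupport (f := χ) hp)
        hg ha2 ((b.coord i).toContinuousLinearMap.comp R)

end ProlongationFrame

/-! ### The tangent bundle: vector fields as derivations. -/

section TangentAlgebroid

open VectorField

variable {EM : Type*} [NormedAddCommGroup EM] [NormedSpace ℝ EM] {H : Type*} [TopologicalSpace H]
  {I : ModelWithCorners ℝ EM H} {M : Type*} [TopologicalSpace M] [ChartedSpace H M]
  [IsManifold I 1 M] [IsManifold I ∞ M]

theorem minSmoothness_two_le_infty : minSmoothness ℝ 2 ≤ (∞ : WithTop ℕ∞) := by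
  rw [minSmoothness_of_isRCLikeNormedField]
  exact WithTop.coe_le_coe.2 (le_top (a := (2 : ℕ∞)))

theorem minSmoothness_three_le_infty : minSmoothness ℝ 3 ≤ (∞ : WithTop ℕ∞) := by
  rw [minSmoothness_of_isRCLikeNormedField]
  exact WithTop.coe_le_coe.2 (le_top (a := (3 : ℕ∞)))

theorem contMDiff_mlieBracket [CompleteSpace EM] {U W : ∀ x : M, TangentSpace I x}
    (hU : ContMDiff I I.tangent ∞ (fun x => (⟨x, U x⟩ : TangentBundle I M)))
    (hW : ContMDiff I I.tangent ∞ (fun x => (⟨x, W x⟩ : TangentBundle I M))) :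
    ContMDiff I I.tangent ∞ (fun x => (⟨x, mlieBracket I U W x⟩ : TangentBundle I M)) := by
  have : IsManifold I (((⊤ : ℕ∞) : WithTop ℕ∞) + 1) M := ‹IsManifold I ∞ M›
  have : IsManifold I (minSmoothness ℝ 2) M := IsManifold.of_le minSmoothness_two_le_infty
  exact fun x => ContMDiffAt.mlieBracket_vectorField (m := ⊤) (n := ⊤) (hU x) (hW x) (by simp)

/-- This is the Leibniz identity of the bracket of vector fields, rearranged into a cyclic sum by
skew symmetry. -/
theorem mlieBracket_jacobi [CompleteSpace EM] {U V W : ∀ x : M, TangentSpace I x}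
    (hU : ContMDiff I I.tangent ∞ (fun x => (⟨x, U x⟩ : TangentBundle I M)))
    (hV : ContMDiff I I.tangent ∞ (fun x => (⟨x, V x⟩ : TangentBundle I M)))
    (hW : ContMDiff I I.tangent ∞ (fun x => (⟨x, W x⟩ : TangentBundle I M))) (x : M) :
    mlieBracket I U (mlieBracket I V W) x + mlieBracket I V (mlieBracket I W U) x +
      mlieBracket I W (mlieBracket I U V) x = 0 := by
  have : IsManifold I (minSmoothness ℝ 3) M := IsManifold.of_le minSmoothness_three_le_infty
  have hle := minSmoothness_two_le_infty
  have h := leibniz_identity_mlieBracket_apply (I := I) (x := x)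
    ((hU x).of_le hle) ((hV x).of_le hle) ((hW x).of_le hle)
  rw [mlieBracket_swap (V := W) (W := U), mlieBracket_swap_apply (V := W), h]
  have h2 : mlieBracket I V (-mlieBracket I U W) x = -mlieBracket I V (mlieBracket I U W) x := by
    have := mlieBracket_const_smul_right (I := I) (c := (-1 : ℝ)) (V := V) (x := x)
      (W := mlieBracket I U W) ((contMDiff_mlieBracket hU hW).mdiffAt x)
    simpa using this
  rw [h2]
  abel

/-- The tangent bundle as a Lie algebroid. -/
noncomputable def tangentAlgebroid [CompleteSpace EM] :
    LieAlgebroid I (smoothSections I EM (TangentSpace I : M → Type _)) where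
  anchor _ := LinearMap.id
  bracket := LinearMap.mk₂ ℝ (fun U W => ⟨mlieBracket I U.1 W.1, contMDiff_mlieBracket U.2 W.2⟩)
    (fun U U' W => Subtype.ext (funext fun x =>
      mlieBracket_add_left (ContMDiff.mdiffAt U.2 x) (ContMDiff.mdiffAt U'.2 x)))
    (fun c U W => Subtype.ext (funext fun x =>
      mlieBracket_const_smul_left (ContMDiff.mdiffAt U.2 x)))
    (fun U W W' => Subtype.ext (funext fun x =>
      mlieBracket_add_right (ContMDiff.mdiffAt W.2 x) (ContMDiff.mdiffAt W'.2 x)))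
    (fun c U W => Subtype.ext (funext fun x =>
      mlieBracket_const_smul_right (ContMDiff.mdiffAt W.2 x)))
  contMDiff_anchor σ := σ.2
  bracket_self U := Subtype.ext mlieBracket_self
  jacobi U V W := Subtype.ext (funext fun x => mlieBracket_jacobi U.2 V.2 W.2 x)
  leibniz U W W' f hf hW' x := by
    change mlieBracket I U.1 W'.1 x = f x • mlieBracket I U.1 W.1 x + _
    have h : W'.1 = f • W.1 := funext hW'
    rw [h, mlieBracket_smul_right (hf.mdiffAt x) (ContMDiff.mdiffAt W.2 x), add_comm]
    rfl

/-- The Lie bracket of vector fields is the commutator of derivations. -/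
theorem tangentDeriv_mlieBracket [CompleteSpace EM] {U W : ∀ x : M, TangentSpace I x}
    (hU : ContMDiff I I.tangent ∞ (fun x => (⟨x, U x⟩ : TangentBundle I M)))
    (hW : ContMDiff I I.tangent ∞ (fun x => (⟨x, W x⟩ : TangentBundle I M))) {f : M → ℝ}
    (hf : ContMDiff I 𝓘(ℝ, ℝ) ∞ f) (x : M) :
    tangentDeriv I (mlieBracket I U W x) f =
      tangentDeriv I (U x) (fun y => tangentDeriv I (W y) f) -
        tangentDeriv I (W x) (fun y => tangentDeriv I (U y) f) :=
  -- The anchor of the tangent algebroid is the identity, so the general relation between anchor and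
  -- bracket is the assertion.
  tangentAlgebroid.tangentDeriv_anchor_bracket isSmoothModule_smoothSections ⟨U, hU⟩ ⟨W, hW⟩ hf x

/-- Tangent vectors are determined by their action on smooth functions. -/
theorem eq_of_tangentDeriv_eq [FiniteDimensional ℝ EM] [T2Space M] {x : M}
    {v w : TangentSpace I x}
    (h : ∀ f : M → ℝ, ContMDiff I 𝓘(ℝ, ℝ) ∞ f → tangentDeriv I v f = tangentDeriv I w f) :
    v = w := by
  have hinv := isInvertible_mfderiv_extChartAt (I := I) (mem_extChartAt_source (I := I) x)
  obtain ⟨L, hL⟩ := hinv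
  apply L.injective
  have key : ∀ ℓ : EM →L[ℝ] ℝ, ℓ (L v) = ℓ (L w) := by
    intro ℓ
    obtain ⟨χ, hχ, hχ1, hχs⟩ := exists_contMDiff_cutoff (I := I) x
      ((chartAt H x).open_source.mem_nhds (mem_chart_source H x))
    -- A linear functional of the chart, cut off near x, is a global smooth function whose
    -- derivative along v is ℓ (L v). Such functionals separate the vectors of the model space.
    set g : M → ℝ := fun y => χ y * ℓ (extChartAt I x y) with hg
    have hgs : ContMDiff I 𝓘(ℝ, ℝ) ∞ g := by
      intro y
      by_cases hy : y ∈ (chartAt H x).source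
      · exact (hχ y).mul (ℓ.contMDiff.contMDiffAt.comp y (contMDiffAt_extChartAt' hy))
      · refine (contMDiffAt_const (c := (0 : ℝ))).congr_of_eventuallyEq ?_
        filter_upwards [(isClosed_tsupport χ).isOpen_compl.mem_nhds fun h => hy (hχs h)] with z hz
        rw [hg]
        simp only
        rw [image_eq_zero_of_notMem_tsupport hz, zero_mul]
    have hv : ∀ v : TangentSpace I x, tangentDeriv I v g = ℓ (L v) := by
      intro v
      have h1 : g =ᶠ[𝓝 x] ℓ ∘ extChartAt I x := by
        filter_upwards [hχ1] with y hy
        rw [hg]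
        simp only
        rw [hy, one_mul]
        rfl
      rw [tangentDeriv_congr v h1]
      have h2 := mfderiv_comp x (I := I) (I' := 𝓘(ℝ, EM)) (I'' := 𝓘(ℝ, ℝ)) (g := ℓ)
        ((ℓ.contMDiff (n := 1)).contMDiffAt.mdifferentiableAt one_ne_zero)
        (mdifferentiableAt_extChartAt (mem_chart_source H x))
      rw [ContinuousLinearMap.mfderiv_eq, ← hL] at h2
      exact congrArg (fun T : EM →L[ℝ] ℝ => T v) h2
    rw [← hv, ← hv, h g hgs]
  exact (SeparatingDual.eq_iff_forall_dual_eq (R := ℝ) (V := EM)).2 key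

end TangentAlgebroid

/-! ### Skew symmetry, additivity and Leibniz rule for sections along a map. -/

section ConnBracketAlgebra

variable {EM : Type*} [NormedAddCommGroup EM] [NormedSpace ℝ EM] {H : Type*} [TopologicalSpace H]
  {I : ModelWithCorners ℝ EM H} {M : Type*} [TopologicalSpace M] [ChartedSpace H M]
  {EN : Type*} [NormedAddCommGroup EN] [NormedSpace ℝ EN] {HN : Type*} [TopologicalSpace HN]
  {J : ModelWithCorners ℝ EN HN} {N : Type*} [TopologicalSpace N] [ChartedSpace HN N]
  [IsManifold J 1 N]
  {V : N → Type*} [∀ x, AddCommGroup (V x)] [∀ x, Module ℝ (V x)]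
  {Γ : Submodule ℝ (∀ x : N, V x)}

namespace LieAlgebroid

variable (𝓑 : LieAlgebroid J Γ) {φ : M → N} {p : M} {κ κ' : Type} [Fintype κ] [Fintype κ']

theorem connBracket_swap (u w : TangentSpace I p) (f : κ → M → ℝ) (σ : κ → Γ) (g : κ' → M → ℝ)
    (τ : κ' → Γ) :
    𝓑.connBracket I φ u w f σ g τ = -𝓑.connBracket I φ w u g τ f σ := by
  unfold connBracket
  rw [𝓑.bracket_swap_val]
  abel

theorem connBracket_add_left (u u' w : TangentSpace I p) {f f' : κ → M → ℝ} (σ : κ → Γ)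
    (g : κ' → M → ℝ) (τ : κ' → Γ) (hf : ∀ k, MDifferentiableAt I 𝓘(ℝ, ℝ) (f k) p)
    (hf' : ∀ k, MDifferentiableAt I 𝓘(ℝ, ℝ) (f' k) p) :
    𝓑.connBracket I φ (u + u') w (fun k x => f k x + f' k x) σ g τ =
      𝓑.connBracket I φ u w f σ g τ + 𝓑.connBracket I φ u' w f' σ g τ := by
  unfold connBracket
  simp only [add_smul, Finset.sum_add_distrib, tangentDeriv_add_vec, map_add, LinearMap.add_apply,
    fun k => tangentDeriv_add w (hf k) (hf' k)]
  rw [Submodule.coe_add, Pi.add_apply]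
  module

theorem connBracket_smul_right (u w : TangentSpace I p) (f : κ → M → ℝ) (σ : κ → Γ)
    {g : κ' → M → ℝ} (τ : κ' → Γ) {h : M → ℝ} (hg : ∀ k, MDifferentiableAt I 𝓘(ℝ, ℝ) (g k) p)
    (hh : MDifferentiableAt I 𝓘(ℝ, ℝ) h p) :
    𝓑.connBracket I φ u (h p • w) f σ (fun k x => h x * g k x) τ =
      h p • 𝓑.connBracket I φ u w f σ g τ +
        tangentDeriv I u h • ∑ k, g k p • (τ k).1 (φ p) := by
  unfold connBracket
  have h1 : ∑ k, (h p * g k p) • τ k = h p • ∑ k, g k p • τ k := by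
    simp only [Finset.smul_sum, smul_smul]
  rw [h1, map_smul]
  simp only [tangentDeriv_smul_vec, fun k => tangentDeriv_mul u hh (hg k), mul_smul, add_smul,
    Finset.sum_add_distrib, smul_sub, smul_add, Finset.smul_sum]
  have h2 : ∀ k, g k p • tangentDeriv I u h • (τ k).1 (φ p) =
    tangentDeriv I u h • g k p • (τ k).1 (φ p) := fun k => smul_comm _ _ _
  simp only [h2]
  rw [Submodule.coe_smul, Pi.smul_apply]
  abel

theorem connBracket_eq_sum (u w : TangentSpace I p) (f : κ → M → ℝ) (σ : κ → Γ)
    (g : κ' → M → ℝ) (τ : κ' → Γ) :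
    𝓑.connBracket I φ u w f σ g τ =
      ∑ k, ∑ l, (f k p * g l p) • (𝓑.bracket (σ k) (τ l)).1 (φ p) +
        ∑ l, tangentDeriv I u (g l) • (τ l).1 (φ p) -
          ∑ k, tangentDeriv I w (f k) • (σ k).1 (φ p) := by
  unfold connBracket
  rw [bracket_sum_left]
  simp only [map_sum, map_smul, sum_smul_val, Finset.smul_sum, smul_smul]

end LieAlgebroid

end ConnBracketAlgebra

/-! ### Tensoriality of the Jacobiator. -/

section Jacobi

variable {EM : Type*} [NormedAddCommGroup EM] [NormedSpace ℝ EM] {H : Type*} [TopologicalSpace H]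
  {I : ModelWithCorners ℝ EM H} {M : Type*} [TopologicalSpace M] [ChartedSpace H M]
  {V : M → Type*} [∀ x, AddCommGroup (V x)] [∀ x, Module ℝ (V x)] {Γ : Submodule ℝ (∀ x : M, V x)}

/-- The Jacobiator of a bracket of sections. -/
def jacobiator (br : Γ →ₗ[ℝ] Γ →ₗ[ℝ] Γ) (σ τ υ : Γ) : Γ :=
  br σ (br τ υ) + br τ (br υ σ) + br υ (br σ τ)

omit [TopologicalSpace M] in
theorem jacobiator_rotate (br : Γ →ₗ[ℝ] Γ →ₗ[ℝ] Γ) (σ τ υ : Γ) :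
    jacobiator br σ τ υ = jacobiator br τ υ σ := by
  unfold jacobiator
  abel

/-- The Jacobi identity may be verified on frames. -/
theorem jacobi_of_frames (hΓ : IsSmoothModule I Γ) {br : Γ →ₗ[ℝ] Γ →ₗ[ℝ] Γ}
    {ρ : ∀ x, V x →ₗ[ℝ] TangentSpace I x} (hself : ∀ σ, br σ σ = 0)
    (hρ : ∀ (σ : Γ) (f : M → ℝ), ContMDiff I 𝓘(ℝ, ℝ) ∞ f →
      ContMDiff I 𝓘(ℝ, ℝ) ∞ (fun x => tangentDeriv I (ρ x (σ.1 x)) f))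
    (hleib : ∀ (σ τ : Γ) (f : M → ℝ) (hf : ContMDiff I 𝓘(ℝ, ℝ) ∞ f) (x : M),
      (br σ (hΓ.smul hf τ)).1 x = f x • (br σ τ).1 x + tangentDeriv I (ρ x (σ.1 x)) f • τ.1 x)
    (hanchor : ∀ (σ τ : Γ) (f : M → ℝ), ContMDiff I 𝓘(ℝ, ℝ) ∞ f → ∀ x,
      tangentDeriv I (ρ x ((br σ τ).1 x)) f =
        tangentDeriv I (ρ x (σ.1 x)) (fun y => tangentDeriv I (ρ y (τ.1 y)) f) -
          tangentDeriv I (ρ x (τ.1 x)) (fun y => tangentDeriv I (ρ y (σ.1 y)) f))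
    (hframe : ∀ x, ∃ (ι : Type) (_ : Fintype ι) (𝔉 : CutoffFrame I Γ ι x),
      ∀ i j k, (jacobiator br (𝔉.sec i) (𝔉.sec j) (𝔉.sec k)).1 x = 0)
    (σ τ υ : Γ) : jacobiator br σ τ υ = 0 := by
  have hswap : ∀ (σ τ : Γ) (x : M), (br σ τ).1 x = -(br τ σ).1 x := fun σ τ x => by
    rw [← LinearMap.IsAlt.neg (B := br) hself τ σ]
    rfl
  have hleib' : ∀ (σ τ : Γ) (f : M → ℝ) (hf : ContMDiff I 𝓘(ℝ, ℝ) ∞ f) (x : M),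
      (br (hΓ.smul hf σ) τ).1 x =
        f x • (br σ τ).1 x - tangentDeriv I (ρ x (τ.1 x)) f • σ.1 x := fun σ τ f hf x => by
    rw [hswap, hleib, hswap σ τ]
    module
  -- The terms with first derivatives of f cancel by skew symmetry, and those with second
  -- derivatives cancel by `hanchor`. For a bracket whose Jacobi identity is still to be proved,
  -- `hanchor` has to be an assumption.
  have tens : ∀ (σ τ υ : Γ) (f : M → ℝ) (hf : ContMDiff I 𝓘(ℝ, ℝ) ∞ f) (x : M),
      (jacobiator br σ τ (hΓ.smul hf υ)).1 x = f x • (jacobiator br σ τ υ).1 x := by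
    intro σ τ υ f hf x
    have h1 : br τ (hΓ.smul hf υ) = hΓ.smul hf (br τ υ) + hΓ.smul (hρ τ f hf) υ :=
      Subtype.ext (funext fun y => hleib τ υ f hf y)
    have h2 : br (hΓ.smul hf υ) σ = hΓ.smul hf (br υ σ) - hΓ.smul (hρ σ f hf) υ :=
      Subtype.ext (funext fun y => hleib' υ σ f hf y)
    unfold jacobiator
    rw [h1, h2, map_add, map_sub]
    change (br σ (hΓ.smul hf (br τ υ))).1 x + (br σ (hΓ.smul (hρ τ f hf) υ)).1 x +
      ((br τ (hΓ.smul hf (br υ σ))).1 x - (br τ (hΓ.smul (hρ σ f hf) υ)).1 x) +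
      (br (hΓ.smul hf υ) (br σ τ)).1 x =
        f x • ((br σ (br τ υ)).1 x + (br τ (br υ σ)).1 x + (br υ (br σ τ)).1 x)
    rw [hleib, hleib, hleib, hleib, hleib', hanchor σ τ f hf, hswap υ σ]
    module
  have red : ∀ (x : M) (ι : Type) (_ : Fintype ι) (𝔉 : CutoffFrame I Γ ι x) (σ τ υ : Γ),
      (∀ i, (jacobiator br σ τ (𝔉.sec i)).1 x = 0) → (jacobiator br σ τ υ).1 x = 0 := by
    intro x ι _ 𝔉 σ τ υ h
    have h1 : hΓ.smul 𝔉.contMDiff_cutoff υ = ∑ j, hΓ.smul (𝔉.contMDiff_coeff j υ) (𝔉.sec j) := by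
      refine Subtype.ext (funext fun y => ?_)
      refine (𝔉.sum_coeff y (υ.1 y)).symm.trans ?_
      simp [IsSmoothModule.smul]
    have h2 := tens σ τ υ 𝔉.cutoff 𝔉.contMDiff_cutoff x
    rw [𝔉.cutoff_self, one_smul, h1] at h2
    have h3 : jacobiator br σ τ (∑ j, hΓ.smul (𝔉.contMDiff_coeff j υ) (𝔉.sec j)) =
        ∑ j, jacobiator br σ τ (hΓ.smul (𝔉.contMDiff_coeff j υ) (𝔉.sec j)) := by
      simp only [jacobiator, map_sum, LinearMap.sum_apply, Finset.sum_add_distrib]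
    rw [← h2, h3, Submodule.coe_sum, Finset.sum_apply]
    refine Finset.sum_eq_zero fun j _ => ?_
    rw [tens, h, smul_zero]
  refine Subtype.ext (funext fun x => ?_)
  obtain ⟨ι, _, 𝔉, h𝔉⟩ := hframe x
  refine red x ι _ 𝔉 _ _ _ fun k => ?_
  -- The reduction to frame sections concerns the last argument only, so the arguments are rotated
  -- and each takes its turn there.
  rw [← jacobiator_rotate]
  refine red x ι _ 𝔉 _ _ _ fun j => ?_
  rw [← jacobiator_rotate]
  refine red x ι _ 𝔉 _ _ _ fun i => ?_
  exact h𝔉 j k i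

end Jacobi

/-! ### Existence and uniqueness of the prolongation. -/

section ProlongationAlgebroid

open VectorField

variable {EM : Type*} [NormedAddCommGroup EM] [NormedSpace ℝ EM] {H : Type*} [TopologicalSpace H]
  {I : ModelWithCorners ℝ EM H} {Q : Type*} [TopologicalSpace Q] [ChartedSpace H Q]
  {EP : Type*} [NormedAddCommGroup EP] [NormedSpace ℝ EP] {HP : Type*} [TopologicalSpace HP]
  {IP : ModelWithCorners ℝ EP HP} {P : Type*} [TopologicalSpace P] [ChartedSpace HP P]
  [IsManifold I 1 Q] [IsManifold IP 1 P] [IsManifold I ∞ Q] [IsManifold IP ∞ P] {proj : P → Q}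
  {F : Type*} [NormedAddCommGroup F] [NormedSpace ℝ F] {E : Q → Type*}
  [TopologicalSpace (TotalSpace F E)] [∀ x, AddCommGroup (E x)] [∀ x, Module ℝ (E x)]
  [∀ x, TopologicalSpace (E x)] [FiberBundle F E] [VectorBundle ℝ F E]
  [FiniteDimensional ℝ EM] [FiniteDimensional ℝ F] [T2Space Q] [ContMDiffVectorBundle ∞ F E I]

variable (I F E) in
/-- A cutoff frame of a vector bundle around a given point. -/
noncomputable def bundleFrameAt (q : Q) :
    CutoffFrame I (smoothSections I F E) (Fin (Module.finrank ℝ F)) q :=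
  have h := exists_contMDiff_cutoff (I := I) q ((trivializationAt F E q).open_baseSet.mem_nhds
    (mem_baseSet_trivializationAt F E q))
  bundleFrame (trivializationAt F E q) h.choose_spec.1 h.choose_spec.2.1 h.choose_spec.2.2

omit [IsManifold I 1 Q] [IsManifold IP 1 P] [IsManifold IP ∞ P] in
theorem contMDiff_bundleFrameAt_coeff (q : Q) {g : P → Q} (hg : ContMDiff IP I ∞ g)
    {a : ∀ x, E (g x)}
    (ha : ContMDiff IP (I.prod 𝓘(ℝ, F)) ∞ (fun x => (⟨g x, a x⟩ : TotalSpace F E)))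
    (i : Fin (Module.finrank ℝ F)) :
    ContMDiff IP 𝓘(ℝ, ℝ) ∞ (fun x => (bundleFrameAt I F E q).coeff i (g x) (a x)) :=
  have h := exists_contMDiff_cutoff (I := I) q ((trivializationAt F E q).open_baseSet.mem_nhds
    (mem_baseSet_trivializationAt F E q))
  contMDiff_bundleFrame_coeff (trivializationAt F E q) h.choose_spec.1 h.choose_spec.2.1
    h.choose_spec.2.2 hg ha i

variable (𝓔 : LieAlgebroid I (smoothSections I F E)) {hproj : ContMDiff IP I ∞ proj}
  (X X' Y : prolongationSections 𝓔 IP proj hproj)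

/-- The coefficients of the `E`-component of a section of the prolongation. -/
noncomputable def fstCoeff (q : Q) (i : Fin (Module.finrank ℝ F)) (x : P) : ℝ :=
  (bundleFrameAt I F E q).coeff i (proj x) (X.1 x).1.1

omit [IsManifold IP ∞ P] in
theorem contMDiff_fstCoeff (q : Q) (i : Fin (Module.finrank ℝ F)) :
    ContMDiff IP 𝓘(ℝ, ℝ) ∞ (fstCoeff 𝓔 X q i) :=
  contMDiff_bundleFrameAt_coeff q hproj X.2.1 i

omit [IsManifold IP ∞ P] in
theorem eventually_eq_sum_fstCoeff (q : Q) {p : P}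
    (hp : (bundleFrameAt I F E q).cutoff =ᶠ[𝓝 (proj p)] fun _ => 1) :
    ∀ᶠ x in 𝓝 p, (X.1 x).1.1 =
      ∑ i, fstCoeff 𝓔 X q i x • ((bundleFrameAt I F E q).sec i).1 (proj x) := by
  filter_upwards [hproj.continuous.continuousAt.eventually hp] with x hx
  exact ((one_smul ℝ _).symm.trans (congrArg (· • (X.1 x).1.1) hx.symm)).trans
    ((bundleFrameAt I F E q).sum_coeff (proj x) (X.1 x).1.1).symm

/-- The `E`-component of the bracket of two sections of the prolongation. -/
noncomputable def prolongationBracketFst (p : P) : E (proj p) :=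
  𝓔.connBracket IP proj (X.1 p).1.2 (Y.1 p).1.2 (fstCoeff 𝓔 X (proj p))
    (bundleFrameAt I F E (proj p)).sec (fstCoeff 𝓔 Y (proj p))
    (bundleFrameAt I F E (proj p)).sec

omit [IsManifold IP ∞ P] in
variable {X Y} in
-- The condition ρ(a) = dproj(v) that defines the fibres of the prolongation is what
-- `connBracket_eq` requires of the two tangent vectors. Any local expansions may therefore be used
-- to compute the bracket.
theorem prolongationBracketFst_eq {p : P} {κ κ' : Type} [Fintype κ] [Fintype κ']
    {f : κ → P → ℝ} (hf : ∀ k, MDifferentiableAt IP 𝓘(ℝ, ℝ) (f k) p)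
    {σ : κ → smoothSections I F E} {g : κ' → P → ℝ}
    (hg : ∀ k, MDifferentiableAt IP 𝓘(ℝ, ℝ) (g k) p) {τ : κ' → smoothSections I F E}
    (ha : ∀ᶠ x in 𝓝 p, (X.1 x).1.1 = ∑ k, f k x • (σ k).1 (proj x))
    (hb : ∀ᶠ x in 𝓝 p, (Y.1 x).1.1 = ∑ k, g k x • (τ k).1 (proj x)) :
    prolongationBracketFst 𝓔 X Y p =
      𝓔.connBracket IP proj (X.1 p).1.2 (Y.1 p).1.2 f σ g τ :=
  (LieAlgebroid.connBracket_eq (𝓑 := 𝓔) (a := fun x => (X.1 x).1.1) (b := fun x => (Y.1 x).1.1)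
    isSmoothModule_smoothSections (hproj.mdiffAt p)
    (bundleFrameAt I F E (proj p)) (bundleFrameAt I F E (proj p)).cutoff_eq hf hg ha hb
    (X.1 p).2.symm (Y.1 p).2.symm).symm

omit [IsManifold IP ∞ P] in
-- The definition uses a frame chosen separately for each point proj p. Near a given point a single
-- frame can be used instead, and this makes smoothness visible.
theorem prolongationBracketFst_eq_fstCoeff (q : Q) {p : P}
    (hp : (bundleFrameAt I F E q).cutoff =ᶠ[𝓝 (proj p)] fun _ => 1) :
    prolongationBracketFst 𝓔 X Y p =
      𝓔.connBracket IP proj (X.1 p).1.2 (Y.1 p).1.2 (fstCoeff 𝓔 X q)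
        (bundleFrameAt I F E q).sec (fstCoeff 𝓔 Y q) (bundleFrameAt I F E q).sec :=
  prolongationBracketFst_eq 𝓔 (fun i => (contMDiff_fstCoeff 𝓔 X q i).mdiffAt p)
    (fun i => (contMDiff_fstCoeff 𝓔 Y q i).mdiffAt p) (eventually_eq_sum_fstCoeff 𝓔 X q hp)
    (eventually_eq_sum_fstCoeff 𝓔 Y q hp)

omit [IsManifold IP ∞ P] in
theorem prolongationBracketFst_swap (p : P) :
    prolongationBracketFst 𝓔 X Y p = -prolongationBracketFst 𝓔 Y X p :=
  𝓔.connBracket_swap _ _ _ _ _ _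

omit [IsManifold IP ∞ P] in
theorem prolongationBracketFst_self (p : P) : prolongationBracketFst 𝓔 X X p = 0 := by
  have h : (2 : ℝ) • prolongationBracketFst 𝓔 X X p = 0 := by
    rw [two_smul]
    exact eq_neg_iff_add_eq_zero.1 (prolongationBracketFst_swap 𝓔 X X p)
  exact (smul_eq_zero.1 h).resolve_left two_ne_zero

omit [IsManifold IP ∞ P] in
theorem prolongationBracketFst_add_left (p : P) :
    prolongationBracketFst 𝓔 (X + X') Y p =
      prolongationBracketFst 𝓔 X Y p + prolongationBracketFst 𝓔 X' Y p := by
  refine Eq.trans ?_ (𝓔.connBracket_add_left _ _ _ _ _ _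
    (fun k => (contMDiff_fstCoeff 𝓔 X (proj p) k).mdiffAt p)
    (fun k => (contMDiff_fstCoeff 𝓔 X' (proj p) k).mdiffAt p))
  have h : fstCoeff 𝓔 (X + X') (proj p) =
      fun k x => fstCoeff 𝓔 X (proj p) k x + fstCoeff 𝓔 X' (proj p) k x :=
    funext fun k => funext fun x => map_add ((bundleFrameAt I F E (proj p)).coeff k (proj x)) _ _
  unfold prolongationBracketFst
  rw [h]
  rfl

omit [IsManifold IP ∞ P] in
variable {Y} in
theorem prolongationBracketFst_smul_right {Z : prolongationSections 𝓔 IP proj hproj} {h : P → ℝ}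
    (hh : ContMDiff IP 𝓘(ℝ, ℝ) ∞ h) (hZ : ∀ x, Z.1 x = h x • Y.1 x) (p : P) :
    prolongationBracketFst 𝓔 X Z p =
      h p • prolongationBracketFst 𝓔 X Y p + tangentDeriv IP (X.1 p).1.2 h • (Y.1 p).1.1 := by
  have h1 := 𝓔.connBracket_smul_right (φ := proj) (X.1 p).1.2 (Y.1 p).1.2
    (fstCoeff 𝓔 X (proj p)) (bundleFrameAt I F E (proj p)).sec (bundleFrameAt I F E (proj p)).sec
    (fun k => (contMDiff_fstCoeff 𝓔 Y (proj p) k).mdiffAt p) (hh.mdiffAt p)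
  rw [← (eventually_eq_sum_fstCoeff 𝓔 Y (proj p)
    (bundleFrameAt I F E (proj p)).cutoff_eq).self_of_nhds] at h1
  refine Eq.trans ?_ h1
  have h2 : fstCoeff 𝓔 Z (proj p) = fun k x => h x * fstCoeff 𝓔 Y (proj p) k x :=
    funext fun k => funext fun x => by
      unfold fstCoeff
      rw [hZ]
      exact map_smul ((bundleFrameAt I F E (proj p)).coeff k (proj x)) _ _
  have h3 : (Z.1 p).1.2 = h p • (Y.1 p).1.2 := by
    rw [hZ]
    rfl
  unfold prolongationBracketFst
  rw [h2, h3]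

omit [IsManifold IP ∞ P] in
variable {X Y} in
theorem prolongationBracketFst_of_projectable {σ τ : smoothSections I F E}
    (hX : ∀ p, (X.1 p).1.1 = σ.1 (proj p)) (hY : ∀ p, (Y.1 p).1.1 = τ.1 (proj p)) (p : P) :
    prolongationBracketFst 𝓔 X Y p = (𝓔.bracket σ τ).1 (proj p) := by
  refine (prolongationBracketFst_eq 𝓔 (κ := Unit) (κ' := Unit) (f := fun _ _ => 1)
    (fun _ => mdifferentiableAt_const) (σ := fun _ => σ) (g := fun _ _ => 1)
    (fun _ => mdifferentiableAt_const) (τ := fun _ => τ) (by simp [hX]) (by simp [hY])).trans ?_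
  simp [LieAlgebroid.connBracket, tangentDeriv_const]

omit [IsManifold IP ∞ P] in
theorem contMDiff_prolongationBracketFst :
    ContMDiff IP (I.prod 𝓘(ℝ, F)) ∞
      (fun p => (⟨proj p, prolongationBracketFst 𝓔 X Y p⟩ : TotalSpace F E)) := by
  intro p₀
  set 𝔉 := bundleFrameAt I F E (proj p₀) with h𝔉
  have e1 : (fun p => (⟨proj p, prolongationBracketFst 𝓔 X Y p⟩ : TotalSpace F E)) =ᶠ[𝓝 p₀]
      fun p => ⟨proj p,
        ∑ k, ∑ l, (fstCoeff 𝓔 X (proj p₀) k p * fstCoeff 𝓔 Y (proj p₀) l p) •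
          (𝓔.bracket (𝔉.sec k) (𝔉.sec l)).1 (proj p) +
        (∑ l, tangentDeriv IP (X.1 p).1.2 (fstCoeff 𝓔 Y (proj p₀) l) • (𝔉.sec l).1 (proj p) +
        ∑ k, (-1 * tangentDeriv IP (Y.1 p).1.2 (fstCoeff 𝓔 X (proj p₀) k)) •
          (𝔉.sec k).1 (proj p))⟩ := by
    -- At the nearby points p the cutoff has to be 1 on a neighbourhood of proj p, not only at proj
    -- p, because coefficients are differentiated there.
    filter_upwards [hproj.continuous.continuousAt.eventually 𝔉.cutoff_eq.eventually_nhds]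
      with p hp
    rw [prolongationBracketFst_eq_fstCoeff 𝓔 X Y (proj p₀) hp, 𝓔.connBracket_eq_sum]
    simp only [neg_mul, one_mul, neg_smul, Finset.sum_neg_distrib]
    rw [add_sub_assoc, sub_eq_add_neg]
  refine ContMDiffAt.congr_of_eventuallyEq ?_ e1
  have hp := hproj p₀
  have hs : ∀ σ : smoothSections I F E, ContMDiffAt IP (I.prod 𝓘(ℝ, F)) ∞
      (fun p => (⟨proj p, σ.1 (proj p)⟩ : TotalSpace F E)) p₀ := fun σ => (σ.2.comp hproj) p₀
  refine contMDiffAt_along_add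
    (contMDiffAt_along_sum hp _ fun k _ => contMDiffAt_along_sum hp _ fun l _ =>
      contMDiffAt_along_smul ?_ (hs _))
    (contMDiffAt_along_add (contMDiffAt_along_sum hp _ fun l _ => contMDiffAt_along_smul ?_ (hs _))
      (contMDiffAt_along_sum hp _ fun k _ => contMDiffAt_along_smul ?_ (hs _)))
  · exact (contMDiff_fstCoeff 𝓔 X _ k p₀).mul (contMDiff_fstCoeff 𝓔 Y _ l p₀)
  · exact contMDiff_tangentDeriv X.2.2 (contMDiff_fstCoeff 𝓔 Y _ l) p₀
  · exact contMDiffAt_const.mul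
      (contMDiff_tangentDeriv Y.2.2 (contMDiff_fstCoeff 𝓔 X _ k) p₀)

variable [CompleteSpace EP]

/-- Both vectors act on a function h on Q as the commutator of the two vector fields acts on h ∘
proj. Hence the two components of the bracket define an element of the prolongation. -/
theorem anchor_prolongationBracketFst (p : P) :
    𝓔.anchor (proj p) (prolongationBracketFst 𝓔 X Y p) = mfderiv IP I proj p
      (mlieBracket IP (fun y => (X.1 y).1.2) (fun y => (Y.1 y).1.2) p) := by
  refine eq_of_tangentDeriv_eq fun h hh => ?_
  have hp := (bundleFrameAt I F E (proj p)).cutoff_eq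
  have hfr : ∀ X : prolongationSections 𝓔 IP proj hproj, ∀ᶠ x in 𝓝 p,
      mfderiv IP I proj x (X.1 x).1.2 = 𝓔.anchor (proj x)
        (∑ k, fstCoeff 𝓔 X (proj p) k x • ((bundleFrameAt I F E (proj p)).sec k).1 (proj x)) := by
    intro X
    filter_upwards [eventually_eq_sum_fstCoeff 𝓔 X (proj p) hp] with x hx
    rw [← hx]
    exact (X.1 x).2.symm
  refine (LieAlgebroid.tangentDeriv_anchor_connBracket (𝓑 := 𝓔) isSmoothModule_smoothSections hproj
    (U := fun x => (X.1 x).1.2) (W := fun x => (Y.1 x).1.2)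
    (fun k => (contMDiff_fstCoeff 𝓔 X (proj p) k).mdiffAt p)
    (fun k => (contMDiff_fstCoeff 𝓔 Y (proj p) k).mdiffAt p) (hfr X) (hfr Y) hh).trans ?_
  rw [← tangentDeriv_comp _ (hh.mdiffAt _) (hproj.mdiffAt p)]
  exact (tangentDeriv_mlieBracket X.2.2 Y.2.2 (hh.comp hproj) p).symm

/-- The bracket of two sections of the prolongation. -/
noncomputable def prolongationBracket : prolongationSections 𝓔 IP proj hproj :=
  ⟨fun p => ⟨(prolongationBracketFst 𝓔 X Y p,
      mlieBracket IP (fun y => (X.1 y).1.2) (fun y => (Y.1 y).1.2) p),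
      anchor_prolongationBracketFst 𝓔 X Y p⟩,
    contMDiff_prolongationBracketFst 𝓔 X Y, contMDiff_mlieBracket X.2.2 Y.2.2⟩

theorem prolongationBracket_swap :
    prolongationBracket 𝓔 X Y = -prolongationBracket 𝓔 Y X :=
  Subtype.ext (funext fun p => Subtype.ext (Prod.ext (prolongationBracketFst_swap 𝓔 X Y p)
    mlieBracket_swap_apply))

theorem prolongationBracket_add_left :
    prolongationBracket 𝓔 (X + X') Y = prolongationBracket 𝓔 X Y + prolongationBracket 𝓔 X' Y :=
  Subtype.ext (funext fun p => Subtype.ext (Prod.ext (prolongationBracketFst_add_left 𝓔 X X' Y p)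
    (mlieBracket_add_left (ContMDiff.mdiffAt X.2.2 p) (ContMDiff.mdiffAt X'.2.2 p))))

variable {Y} in
theorem prolongationBracket_leibniz {Z : prolongationSections 𝓔 IP proj hproj} {h : P → ℝ}
    (hh : ContMDiff IP 𝓘(ℝ, ℝ) ∞ h) (hZ : ∀ x, Z.1 x = h x • Y.1 x) (p : P) :
    (prolongationBracket 𝓔 X Z).1 p =
      h p • (prolongationBracket 𝓔 X Y).1 p + tangentDeriv IP (X.1 p).1.2 h • Y.1 p := by
  refine Subtype.ext (Prod.ext (prolongationBracketFst_smul_right 𝓔 X hh hZ p) ?_)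
  change mlieBracket IP (fun y => (X.1 y).1.2) (fun y => (Z.1 y).1.2) p =
    h p • mlieBracket IP (fun y => (X.1 y).1.2) (fun y => (Y.1 y).1.2) p + _
  have h1 : (fun y => (Z.1 y).1.2) = h • fun y => (Y.1 y).1.2 := funext fun y => by
    rw [hZ]
    rfl
  rw [h1, mlieBracket_smul_right (hh.mdiffAt p) (ContMDiff.mdiffAt Y.2.2 p), add_comm]
  rfl

/-- The bracket of sections of the prolongation, as a bilinear map. -/
noncomputable def prolongationBracketₗ :
    prolongationSections 𝓔 IP proj hproj →ₗ[ℝ] prolongationSections 𝓔 IP proj hproj →ₗ[ℝ]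
      prolongationSections 𝓔 IP proj hproj :=
  have hadd : ∀ X Y Y' : prolongationSections 𝓔 IP proj hproj, prolongationBracket 𝓔 X (Y + Y') =
      prolongationBracket 𝓔 X Y + prolongationBracket 𝓔 X Y' := fun X Y Y' => by
    refine Subtype.ext (funext fun p => Subtype.ext (Prod.ext ?_
      (mlieBracket_add_right (ContMDiff.mdiffAt Y.2.2 p) (ContMDiff.mdiffAt Y'.2.2 p))))
    change prolongationBracketFst 𝓔 X (Y + Y') p =
      prolongationBracketFst 𝓔 X Y p + prolongationBracketFst 𝓔 X Y' p
    rw [prolongationBracketFst_swap, prolongationBracketFst_add_left,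
      prolongationBracketFst_swap 𝓔 X Y, prolongationBracketFst_swap 𝓔 X Y', neg_add]
  have hsmul : ∀ (c : ℝ) (X Y : prolongationSections 𝓔 IP proj hproj),
      prolongationBracket 𝓔 X (c • Y) = c • prolongationBracket 𝓔 X Y := fun c X Y =>
    Subtype.ext (funext fun p => by
      refine (prolongationBracket_leibniz 𝓔 X (contMDiff_const (c := c)) (Y := Y)
        (fun _ => rfl) p).trans ?_
      rw [tangentDeriv_const, zero_smul, add_zero]
      rfl)
  LinearMap.mk₂ ℝ (fun X Y : prolongationSections 𝓔 IP proj hproj => prolongationBracket 𝓔 X Y)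
    (fun X X' Y => prolongationBracket_add_left 𝓔 X X' Y)
    (fun c X Y => by
      rw [prolongationBracket_swap, hsmul, prolongationBracket_swap 𝓔 X Y]
      exact Subtype.ext (funext fun p => (smul_neg c ((prolongationBracket 𝓔 Y X).1 p)).symm))
    hadd hsmul

variable [FiniteDimensional ℝ EP]

/-- The prolongation of a Lie algebroid exists. -/
theorem exists_isProlongation (hA : ∀ p₀, ∃ A S, IsChartProjectionAt I IP proj p₀ A S) :
    ∃ 𝓐 : LieAlgebroid IP (prolongationSections 𝓔 IP proj hproj), IsProlongation 𝓔 𝓐 ∧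
      ∀ X Y p, ((𝓐.bracket X Y).1 p).1.1 = prolongationBracketFst 𝓔 X Y p := by
  have hself : ∀ X : prolongationSections 𝓔 IP proj hproj, prolongationBracketₗ 𝓔 X X = 0 :=
    fun X => Subtype.ext (funext fun p => Subtype.ext (Prod.ext
      (prolongationBracketFst_self 𝓔 X p) (congrFun mlieBracket_self p)))
  let ρ : ∀ p, Prolongation 𝓔 IP proj p →ₗ[ℝ] TangentSpace IP p := fun p =>
    LinearMap.snd ℝ _ _ ∘ₗ Submodule.subtype _
  refine ⟨{
    anchor := ρ
    bracket := prolongationBracketₗ 𝓔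
    contMDiff_anchor := fun X => X.2.2
    bracket_self := hself
    jacobi := fun X Y Z => jacobi_of_frames (I := IP) (ρ := ρ)
      (isSmoothModule_prolongationSections 𝓔) hself
      (fun X f hf => contMDiff_tangentDeriv X.2.2 hf)
      (fun X Y f hf p => prolongationBracket_leibniz 𝓔 X hf (fun _ => rfl) p)
      (fun X Y f hf p => tangentDeriv_mlieBracket X.2.2 Y.2.2 hf p) ?_ X Y Z
    leibniz := fun X Y Z f hf hZ p => prolongationBracket_leibniz 𝓔 X hf hZ p },
    ⟨fun _ _ => rfl, fun X Y σ τ hX hY p =>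
      Prod.ext (prolongationBracketFst_of_projectable 𝓔 hX hY p) rfl⟩, fun _ _ _ => rfl⟩
  -- Only the Jacobi identity for frame sections remains. These are projectable, and so are their
  -- brackets, so the identity splits into those of 𝓔 and of vector fields.
  intro p
  obtain ⟨A, S, hAS⟩ := hA p
  obtain ⟨ι, _, 𝔉, σ, hσ, -⟩ :=
    exists_prolongation_frame.{_, _, _, _, _, _, _, _, 0, 0, 0} 𝓔 (hproj := hproj) hAS
  refine ⟨ι, inferInstance, 𝔉, fun i j k => Subtype.ext (Prod.ext ?_ ?_)⟩
  · have hb : ∀ i j p, (((prolongationBracketₗ 𝓔 (𝔉.sec i) (𝔉.sec j)).1 p).1).1 =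
        (𝓔.bracket (σ i) (σ j)).1 (proj p) := fun i j p =>
      prolongationBracketFst_of_projectable 𝓔 (hσ i) (hσ j) p
    have hj := congrArg (fun τ : smoothSections I F E => τ.1 (proj p))
      (𝓔.jacobi (σ i) (σ j) (σ k))
    refine Eq.trans ?_ hj
    exact congrArg₂ (· + ·) (congrArg₂ (· + ·)
      (prolongationBracketFst_of_projectable 𝓔 (hσ i) (hb j k) p)
      (prolongationBracketFst_of_projectable 𝓔 (hσ j) (hb k i) p))
      (prolongationBracketFst_of_projectable 𝓔 (hσ k) (hb i j) p)
  · exact mlieBracket_jacobi (𝔉.sec i).2.2 (𝔉.sec j).2.2 (𝔉.sec k).2.2 p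

omit [FiniteDimensional ℝ EP] [CompleteSpace EP] [T2Space Q] [FiniteDimensional ℝ EM]
  [FiniteDimensional ℝ F] [ContMDiffVectorBundle ∞ F E I] [IsManifold I ∞ Q]
  [IsManifold IP ∞ P] in
variable {𝓔} in
-- Projectable sections form a real vector space, but not a module over the functions on P. Constant
-- coefficients are enough, since `connBracket` takes brackets only of combinations with
-- coefficients frozen at a point.
theorem IsProlongation.bracket_sum_smul
    {𝓐 : LieAlgebroid IP (prolongationSections 𝓔 IP proj hproj)}
    (h : IsProlongation 𝓔 𝓐) {ι κ : Type} [Fintype ι] [Fintype κ] (c : ι → ℝ) (d : κ → ℝ)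
    {Z : ι → prolongationSections 𝓔 IP proj hproj} {W : κ → prolongationSections 𝓔 IP proj hproj}
    {σ : ι → smoothSections I F E} {τ : κ → smoothSections I F E}
    (hZ : ∀ i p, ((Z i).1 p).1.1 = (σ i).1 (proj p))
    (hW : ∀ i p, ((W i).1 p).1.1 = (τ i).1 (proj p)) (p : P) :
    ((𝓐.bracket (∑ i, c i • Z i) (∑ j, d j • W j)).1 p).1 =
      ((𝓔.bracket (∑ i, c i • σ i) (∑ j, d j • τ j)).1 (proj p),
        mlieBracket IP (fun y => ((∑ i, c i • Z i : prolongationSections 𝓔 IP proj hproj).1 y).1.2)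
          (fun y => ((∑ j, d j • W j : prolongationSections 𝓔 IP proj hproj).1 y).1.2) p) := by
  have key : ∀ {ι : Type} [Fintype ι] (c : ι → ℝ) {Z : ι → prolongationSections 𝓔 IP proj hproj}
      {σ : ι → smoothSections I F E} (_ : ∀ i p, ((Z i).1 p).1.1 = (σ i).1 (proj p)) (p : P),
      ((∑ i, c i • Z i : prolongationSections 𝓔 IP proj hproj).1 p).1.1 =
        (∑ i, c i • σ i : smoothSections I F E).1 (proj p) := by
    intro ι _ c Z σ hZ p
    rw [sum_smul_val, sum_smul_val, Submodule.coe_sum, Prod.fst_sum]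
    refine Finset.sum_congr rfl fun i _ => ?_
    rw [← hZ]
    rfl
  exact h.bracket_projectable _ _ _ _ (key c hZ) (key d hW) p

omit [CompleteSpace EP] in
variable {𝓔} in
/-- The prolongation of a Lie algebroid is unique. -/
theorem IsProlongation.unique (hA : ∀ p₀, ∃ A S, IsChartProjectionAt I IP proj p₀ A S)
    {𝓐 𝓐' : LieAlgebroid IP (prolongationSections 𝓔 IP proj hproj)} (h : IsProlongation 𝓔 𝓐)
    (h' : IsProlongation 𝓔 𝓐') : 𝓐 = 𝓐' := by
  have hanchor : 𝓐.anchor = 𝓐'.anchor := funext fun p => LinearMap.ext fun x =>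
    (h.anchor_apply p x).trans (h'.anchor_apply p x).symm
  refine LieAlgebroid.ext hanchor (LinearMap.ext fun X => LinearMap.ext fun Y =>
    Subtype.ext (funext fun p => ?_))
  obtain ⟨A, S, hAS⟩ := hA p
  obtain ⟨ι, _, 𝔉, σ, hσ, -⟩ :=
    exists_prolongation_frame.{_, _, _, _, _, _, _, _, 0, 0, 0} 𝓔 (hproj := hproj) hAS
  have hΓ := isSmoothModule_prolongationSections 𝓔 (hproj := hproj)
  -- In a frame of projectable sections, a bracket is determined by the anchor and by its values on
  -- constant combinations of the frame. Both of these are prescribed.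
  rw [LieAlgebroid.bracket_eq_connBracket hΓ 𝔉 𝔉.cutoff_eq X Y,
    LieAlgebroid.bracket_eq_connBracket hΓ 𝔉 𝔉.cutoff_eq X Y]
  unfold LieAlgebroid.connBracket
  rw [hanchor]
  congr 2
  exact Subtype.ext ((h.bracket_sum_smul _ _ hσ hσ p).trans
    (h'.bracket_sum_smul _ _ hσ hσ p).symm)

theorem existsUnique_isProlongation
    (hA : ∀ p₀, ∃ A S, IsChartProjectionAt I IP proj p₀ A S) :
    ∃! 𝓐 : LieAlgebroid IP (prolongationSections 𝓔 IP proj hproj), IsProlongation 𝓔 𝓐 :=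
  (exists_isProlongation 𝓔 hA).imp fun _ h => ⟨h.1, fun _ h' => h'.unique hA h.1⟩

variable {𝓔} in
-- By uniqueness, any prolongation structure is the constructed one, so the formula for its
-- E-component holds for sections that are not projectable as well.
theorem IsProlongation.bracket_fst (hA : ∀ p₀, ∃ A S, IsChartProjectionAt I IP proj p₀ A S)
    {𝓐 : LieAlgebroid IP (prolongationSections 𝓔 IP proj hproj)} (h : IsProlongation 𝓔 𝓐)
    (X Y : prolongationSections 𝓔 IP proj hproj) (p : P) :
    ((𝓐.bracket X Y).1 p).1.1 = prolongationBracketFst 𝓔 X Y p := by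
  obtain ⟨𝓐', h', hfst⟩ := exists_isProlongation 𝓔 hA
  rw [h.unique hA h']
  exact hfst X Y p

end ProlongationAlgebroid

/-! ### Maps over the base induce morphisms of prolongations. -/

section ProlongationMorphism

open VectorField

variable {EM : Type*} [NormedAddCommGroup EM] [NormedSpace ℝ EM] {H : Type*} [TopologicalSpace H]
  {I : ModelWithCorners ℝ EM H} {Q : Type*} [TopologicalSpace Q] [ChartedSpace H Q]
  {EP : Type*} [NormedAddCommGroup EP] [NormedSpace ℝ EP] {HP : Type*} [TopologicalSpace HP]
  {IP : ModelWithCorners ℝ EP HP} {P : Type*} [TopologicalSpace P] [ChartedSpace HP P]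
  {ER : Type*} [NormedAddCommGroup ER] [NormedSpace ℝ ER] {HR : Type*} [TopologicalSpace HR]
  {IR : ModelWithCorners ℝ ER HR} {R : Type*} [TopologicalSpace R] [ChartedSpace HR R]
  [IsManifold I 1 Q] [IsManifold IP 1 P] [IsManifold IR 1 R]
  [IsManifold I ∞ Q] [IsManifold IP ∞ P] [IsManifold IR ∞ R]
  {F : Type*} [NormedAddCommGroup F] [NormedSpace ℝ F] {E : Q → Type*}
  [TopologicalSpace (TotalSpace F E)] [∀ x, AddCommGroup (E x)] [∀ x, Module ℝ (E x)]
  [∀ x, TopologicalSpace (E x)] [FiberBundle F E] [VectorBundle ℝ F E]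
  [FiniteDimensional ℝ EM] [FiniteDimensional ℝ F] [T2Space Q] [ContMDiffVectorBundle ∞ F E I]
  [FiniteDimensional ℝ EP] [FiniteDimensional ℝ ER] [T2Space R]
  {𝓔 : LieAlgebroid I (smoothSections I F E)}

/-- A smooth map over `Q` prolongs to a morphism of the prolongations. -/
theorem isLieAlgebroidMorphism_prolongation {proj : R → Q} {hproj : ContMDiff IR I ∞ proj}
    {φ : P → R} (hφ : ContMDiff IP IR ∞ φ) {hprojφ : ContMDiff IP I ∞ (fun p => proj (φ p))}
    (hP : ∀ p₀, ∃ A S, IsChartProjectionAt I IP (fun p => proj (φ p)) p₀ A S)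
    (hR : ∀ r₀, ∃ A S, IsChartProjectionAt I IR proj r₀ A S)
    {Φ : ∀ p, Prolongation 𝓔 IP (fun p => proj (φ p)) p →ₗ[ℝ] Prolongation 𝓔 IR proj (φ p)}
    (hΦ1 : ∀ p x, (Φ p x).1.1 = x.1.1) (hΦ2 : ∀ p x, (Φ p x).1.2 = mfderiv IP IR φ p x.1.2)
    {𝓐 : LieAlgebroid IP (prolongationSections 𝓔 IP (fun p => proj (φ p)) hprojφ)}
    {𝓑 : LieAlgebroid IR (prolongationSections 𝓔 IR proj hproj)}
    (h𝓐 : IsProlongation 𝓔 𝓐) (h𝓑 : IsProlongation 𝓔 𝓑) :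
    IsLieAlgebroidMorphism 𝓐 𝓑 φ Φ := by
  have : CompleteSpace EP := FiniteDimensional.complete ℝ EP
  have : CompleteSpace ER := FiniteDimensional.complete ℝ ER
  have hanchor : ∀ p v, mfderiv IP IR φ p (𝓐.anchor p v) = 𝓑.anchor (φ p) (Φ p v) := fun p v => by
    rw [h𝓐.anchor_apply, h𝓑.anchor_apply, hΦ2]
  have hΓ := isSmoothModule_prolongationSections 𝓔 (hproj := hproj)
  have hsnd : ∀ (X Y : prolongationSections 𝓔 IP (fun p => proj (φ p)) hprojφ) (p : P)
      (h : R → ℝ), ContMDiff IR 𝓘(ℝ, ℝ) ∞ h →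
      tangentDeriv IP ((𝓐.bracket X Y).1 p).1.2 (fun y => h (φ y)) =
        tangentDeriv IP (X.1 p).1.2 (fun x => tangentDeriv IP (Y.1 x).1.2 (fun y => h (φ y))) -
          tangentDeriv IP (Y.1 p).1.2
            (fun x => tangentDeriv IP (X.1 x).1.2 (fun y => h (φ y))) := by
    intro X Y p h hh
    have h1 := 𝓐.tangentDeriv_anchor_bracket (isSmoothModule_prolongationSections 𝓔) X Y
      (f := fun y => h (φ y)) (hh.comp hφ) p
    simp only [h𝓐.anchor_apply] at h1
    exact h1
  refine LieAlgebroid.isLieAlgebroidMorphism_of_bracket (isSmoothModule_prolongationSections 𝓔)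
    (fun p => ?_) hΓ hφ hanchor fun r => ?_
  · obtain ⟨A, S, hAS⟩ := hP p
    obtain ⟨ι, _, 𝔉, -⟩ := exists_prolongation_frame.{_, _, _, _, _, _, _, _, 0, 0, 0} 𝓔
      (hproj := hprojφ) hAS
    exact ⟨ι, inferInstance, ⟨𝔉⟩⟩
  · obtain ⟨A, S, hAS⟩ := hR r
    obtain ⟨ι, _, 𝔉, σ, hσ, hcoeff⟩ := exists_prolongation_frame 𝓔 (hproj := hproj) hAS
    have hc : ∀ (X : prolongationSections 𝓔 IP (fun p => proj (φ p)) hprojφ) (i : ι),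
        ContMDiff IP 𝓘(ℝ, ℝ) ∞ (fun x => 𝔉.coeff i (φ x) (Φ x (X.1 x))) := by
      intro X i
      refine hcoeff φ hφ (fun x => Φ x (X.1 x)) ?_ ?_ i
      · simp only [hΦ1]
        exact X.2.1
      · simp only [hΦ2]
        exact (hφ.contMDiff_tangentMap (m := ∞) (by simp)).comp X.2.2
    refine ⟨ι, inferInstance, 𝔉, hc, ?_⟩
    rintro p rfl X Y
    have hsum : ∀ X : prolongationSections 𝓔 IP (fun p => proj (φ p)) hprojφ, ∀ᶠ x in 𝓝 p,
        Φ x (X.1 x) = ∑ i, 𝔉.coeff i (φ x) (Φ x (X.1 x)) • (𝔉.sec i).1 (φ x) := by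
      intro X
      filter_upwards [hφ.continuous.continuousAt.eventually 𝔉.cutoff_eq] with x hx
      rw [𝔉.sum_coeff, hx, one_smul]
    -- The frame over R projects to the sections σ of E and Φ leaves the E-component unchanged. The
    -- coefficients of Φ X in the frame therefore also expand the E-component of X along proj ∘ φ.
    have hfst : ∀ X : prolongationSections 𝓔 IP (fun p => proj (φ p)) hprojφ, ∀ᶠ x in 𝓝 p,
        (X.1 x).1.1 = ∑ i, 𝔉.coeff i (φ x) (Φ x (X.1 x)) • (σ i).1 (proj (φ x)) := by
      intro X
      filter_upwards [hsum X] with x hx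
      rw [← hΦ1 x (X.1 x)]
      conv_lhs => rw [hx]
      rw [Submodule.coe_sum, Prod.fst_sum]
      exact Finset.sum_congr rfl fun i _ => congrArg _ (hσ i (φ x))
    rw [h𝓐.anchor_apply, h𝓐.anchor_apply]
    refine Subtype.ext (Prod.ext ?_ ?_)
    -- The E-components of both sides are the bracket of 𝓔 along proj ∘ φ for the same coefficients
    -- and the same sections σ.
    · rw [hΦ1, h𝓐.bracket_fst hP, prolongationBracketFst_eq 𝓔 (fun i => (hc X i).mdiffAt p)
        (fun i => (hc Y i).mdiffAt p) (hfst X) (hfst Y)]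
      have hb := congrArg Prod.fst (h𝓑.bracket_sum_smul
        (fun i => 𝔉.coeff i (φ p) (Φ p (X.1 p))) (fun i => 𝔉.coeff i (φ p) (Φ p (Y.1 p)))
        hσ hσ (φ p))
      have hs : ∀ c : ι → ℝ, ((∑ i, c i • (𝔉.sec i).1 (φ p) :
          Prolongation 𝓔 IR proj (φ p)).1).1 = ∑ i, c i • (σ i).1 (proj (φ p)) := by
        intro c
        rw [Submodule.coe_sum, Prod.fst_sum]
        exact Finset.sum_congr rfl fun i _ => congrArg _ (hσ i (φ p))
      unfold LieAlgebroid.connBracket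
      rw [← hs, ← hs]
      exact (congrArg₂ (· - ·) (congrArg₂ (· + ·) hb rfl) rfl).symm
    -- The tangent components are compared through their action on functions h on R: on both sides
    -- it is the commutator of the two vector fields on P, applied to h ∘ φ.
    · rw [hΦ2]
      refine eq_of_tangentDeriv_eq fun h hh => ?_
      rw [← tangentDeriv_comp _ (hh.mdiffAt _) (hφ.mdiffAt p), hsnd X Y p h hh,
        ← h𝓑.anchor_apply]
      refine (LieAlgebroid.tangentDeriv_anchor_connBracket (𝓑 := 𝓑) hΓ hφ
        (U := fun x => (X.1 x).1.2) (W := fun x => (Y.1 x).1.2)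
        (fun i => (hc X i).mdiffAt p) (fun i => (hc Y i).mdiffAt p) ?_ ?_ hh).symm
      · filter_upwards [hsum X] with x hx
        rw [← hx, h𝓑.anchor_apply, hΦ2]
      · filter_upwards [hsum Y] with x hx
        rw [← hx, h𝓑.anchor_apply, hΦ2]

end ProlongationMorphism

/-! ### Hausdorff total spaces. -/

section TotalSpaceTopology

/-- Points over the same base point are separated in a trivialization, all others in the base. The
Hausdorff property of the Hamiltonian phase space provides the bump functions with which its tangent
vectors are distinguished. -/
theorem FiberBundle.t2Space_totalSpace {B F : Type*} [TopologicalSpace B] [TopologicalSpace F]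
    [T2Space B] [T2Space F] {E : B → Type*} [TopologicalSpace (TotalSpace F E)]
    [∀ x, TopologicalSpace (E x)] [FiberBundle F E] : T2Space (TotalSpace F E) := by
  refine ⟨fun x y hxy => ?_⟩
  by_cases h : x.proj = y.proj
  · set e := trivializationAt F E x.proj with he
    have hx : x ∈ e.source := e.mem_source.2 (mem_baseSet_trivializationAt F E x.proj)
    have hy : y ∈ e.source := e.mem_source.2 (h ▸ mem_baseSet_trivializationAt F E x.proj)
    obtain ⟨U, V, hU, hV, hxU, hyV, hUV⟩ := t2_separation fun h => hxy (e.injOn hx hy h)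
    exact ⟨e.source ∩ e ⁻¹' U, e.source ∩ e ⁻¹' V,
      e.toOpenPartialHomeomorph.isOpen_inter_preimage hU,
      e.toOpenPartialHomeomorph.isOpen_inter_preimage hV, ⟨hx, hxU⟩, ⟨hy, hyV⟩,
      (hUV.preimage e).mono inter_subset_right inter_subset_right⟩
  · exact separated_by_continuous (FiberBundle.continuous_proj F E) h

end TotalSpaceTopology

/-! ### Charts, pairings and vertical derivatives on the phase spaces. -/

section PhaseSpaceGeometry

variable {n k : ℕ} {Q : Type*} [TopologicalSpace Q] [ChartedSpace (EuclideanSpace ℝ (Fin n)) Q]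
  {F : Type*} [NormedAddCommGroup F] [NormedSpace ℝ F]
  {E : Q → Type*} [TopologicalSpace (TotalSpace F E)] [∀ x, AddCommGroup (E x)]
  [∀ x, Module ℝ (E x)] [∀ x, TopologicalSpace (E x)] [FiberBundle F E] [VectorBundle ℝ F E]

/-- Vector bundle charts restrict only the base point, and the chart of ℝᵏ is global. This is why
the domain of a chart is a full preimage, as `IsChartProjectionAt` demands. -/
theorem mem_phaseSpace_chart_source_iff (p₀ p : PhaseSpace k F E) :
    p ∈ (chartAt (ModelProd (EuclideanSpace ℝ (Fin k))
      (ModelProd (EuclideanSpace ℝ (Fin n)) (Fin k → F))) p₀).source ↔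
      phaseProj p ∈ (trivializationAt F E (phaseProj p₀)).baseSet ∧
        phaseProj p ∈ (chartAt (EuclideanSpace ℝ (Fin n)) (phaseProj p₀)).source := by
  rw [prodChartedSpace_chartAt, FiberBundle.chartedSpace_chartAt]
  constructor
  · rintro ⟨-, h1, h2, -⟩
    exact ⟨h1, h2⟩
  · rintro ⟨h1, h2⟩
    exact ⟨mem_univ _, h1, h2, mem_univ _⟩

theorem isChartProjectionAt_phaseProj (p₀ : PhaseSpace k F E) :
    ∃ A S, IsChartProjectionAt (𝓡 n) (phaseModel n k F) phaseProj p₀ A S := by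
  refine ⟨(ContinuousLinearMap.fst ℝ (EuclideanSpace ℝ (Fin n)) (Fin k → F)).comp
      (ContinuousLinearMap.snd ℝ (EuclideanSpace ℝ (Fin k)) _),
    (ContinuousLinearMap.inr ℝ (EuclideanSpace ℝ (Fin k)) _).comp
      (ContinuousLinearMap.inl ℝ (EuclideanSpace ℝ (Fin n)) (Fin k → F)), ⟨fun _ => rfl,
    fun p hp => ((mem_phaseSpace_chart_source_iff p₀ p).1 hp).2,
    ⟨(trivializationAt F E (phaseProj p₀)).baseSet ∩
        (chartAt (EuclideanSpace ℝ (Fin n)) (phaseProj p₀)).source, Filter.inter_mem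
      ((trivializationAt F E (phaseProj p₀)).open_baseSet.mem_nhds
        (mem_baseSet_trivializationAt F E (phaseProj p₀)))
      ((chartAt _ (phaseProj p₀)).open_source.mem_nhds (mem_chart_source _ _)),
      fun p hp => (mem_phaseSpace_chart_source_iff p₀ p).2 hp⟩, fun p hp => ?_⟩⟩
  rw [extChartAt_prod, FiberBundle.extChartAt]
  rfl

/-- The pairing of a section of the dual bundle with a section of the bundle is smooth. -/
theorem contMDiff_dual_apply {EM : Type*} [NormedAddCommGroup EM] [NormedSpace ℝ EM]
    {H : Type*} [TopologicalSpace H] {I : ModelWithCorners ℝ EM H} {M : Type*} [TopologicalSpace M]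
    [ChartedSpace H M] [ContMDiffVectorBundle ∞ F E (𝓡 n)] [IsManifold (𝓡 n) ∞ Q]
    {f : M → PhaseSpace k (F →L[ℝ] ℝ) (DualBundle E)}
    (hf : ContMDiff I (phaseModel n k (F →L[ℝ] ℝ)) ∞ f) (A : Fin k)
    {a : ∀ x, E (phaseProj (f x))}
    (ha : ContMDiff I ((𝓡 n).prod 𝓘(ℝ, F)) ∞
      (fun x => (⟨phaseProj (f x), a x⟩ : TotalSpace F E))) :
    ContMDiff I 𝓘(ℝ, ℝ) ∞ (fun x => (f x).2.snd A (a x)) := by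
  intro x₀
  have h1 := contMDiffAt_phase_iff.1 (hf x₀)
  set e := trivializationAt F E (phaseProj (f x₀)) with he
  have hx₀ : phaseProj (f x₀) ∈ e.baseSet := mem_baseSet_trivializationAt F E _
  refine ((h1.2.2 A).clm_apply (contMDiffAt_linearMapAt e (g := fun x => phaseProj (f x)) hx₀
    (ha x₀))).congr_of_eventuallyEq ?_
  filter_upwards [h1.2.1.continuousAt.preimage_mem_nhds (e.open_baseSet.mem_nhds hx₀)] with x hx
  rw [Trivialization.linearMapAt_apply _ ((f x).2.snd A), if_pos ⟨hx, Set.mem_univ _⟩,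
    hom_trivializationAt_apply]
  have h2 := e.symmₗ_linearMapAt (R := ℝ) hx (a x)
  rw [Trivialization.coe_symmₗ _ hx] at h2
  conv_lhs => rw [← h2]
  simp [ContinuousLinearMap.inCoordinates, Trivialization.symmL_apply _ hx]

/-- The chain rule along the shift curve identifies dL on a vertical vector with the derivative that
defines the Legendre transformation. -/
theorem mfderiv_verticalVector {L : PhaseSpace k F E → ℝ}
    (hL : ContMDiff (phaseModel n k F) 𝓘(ℝ, ℝ) ∞ L) (A : Fin k) (p : PhaseSpace k F E)
    (a : E (phaseProj p)) :
    mfderiv (phaseModel n k F) 𝓘(ℝ, ℝ) L p (verticalVector n A p a) =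
      deriv (fun s : ℝ => L (shiftCurve A p a s)) 0 := by
  have h0 : shiftCurve A p a 0 = p := by
    rw [shiftCurve_eq, zero_smul, shiftIncl_zero]
  have hs : MDifferentiableAt 𝓘(ℝ, ℝ) (phaseModel n k F) (shiftCurve A p a) 0 := by
    rw [show shiftCurve A p a = fun s : ℝ => shiftIncl A p (s • fiberCoord F _ a) from
      funext fun s => shiftCurve_eq A p a s]
    exact ((contMDiffAt_shiftIncl (n := n) A p _).comp (0 : ℝ)
      (contMDiffAt_id.smul contMDiffAt_const)).mdifferentiableAt (by simp)
  have h1 := mfderiv_comp_of_eq (hL.mdiffAt p) hs h0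
  change _ = fderiv ℝ (fun s : ℝ => L (shiftCurve A p a s)) 0 1
  rw [← mfderiv_eq_fderiv]
  rw [h0] at h1
  exact (congrArg (fun T : ℝ →L[ℝ] ℝ => T 1) h1).symm

end PhaseSpaceGeometry

/-! ### The Legendre transformation. -/

theorem theorem5 {n k : ℕ}
    {Q : Type*} [TopologicalSpace Q] [T2Space Q] [SecondCountableTopology Q]
    [ChartedSpace (EuclideanSpace ℝ (Fin n)) Q] [IsManifold (𝓡 n) ∞ Q]
    {F : Type*} [NormedAddCommGroup F] [NormedSpace ℝ F] [FiniteDimensional ℝ F]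
    {E : Q → Type*} [TopologicalSpace (TotalSpace F E)] [∀ q, AddCommGroup (E q)]
    [∀ q, Module ℝ (E q)] [∀ q, TopologicalSpace (E q)] [FiberBundle F E] [VectorBundle ℝ F E]
    [ContMDiffVectorBundle ∞ F E (𝓡 n)]
    (𝓔 : LieAlgebroid (𝓡 n) (smoothSections (𝓡 n) F E))
    (L : PhaseSpace k F E → ℝ) (hL : ContMDiff (phaseModel n k F) 𝓘(ℝ, ℝ) ∞ L) :
    (∃! 𝓐 : LieAlgebroid (phaseModel n k F) (lagrangianSections 𝓔 k), IsProlongation 𝓔 𝓐) ∧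
    (∃! 𝓑 : LieAlgebroid (phaseModel n k (F →L[ℝ] ℝ)) (hamiltonianSections 𝓔 k),
      IsProlongation 𝓔 𝓑) ∧
    ∀ (𝓐 : LieAlgebroid (phaseModel n k F) (lagrangianSections 𝓔 k))
      (𝓑 : LieAlgebroid (phaseModel n k (F →L[ℝ] ℝ)) (hamiltonianSections 𝓔 k)),
      IsProlongation 𝓔 𝓐 → IsProlongation 𝓔 𝓑 →
      IsLieAlgebroidMorphism 𝓐 𝓑 (legendre L hL) (prolongationLegendre 𝓔 L hL) ∧
      ∀ A : Fin k,
        pullbackForm (legendre L hL) (prolongationLegendre 𝓔 L hL) (liouvilleOne 𝓔 A) =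
          poincareCartanOne 𝓔 𝓐 L A ∧
        pullbackForm (legendre L hL) (prolongationLegendre 𝓔 L hL) (liouvilleTwo 𝓔 𝓑 A) =
          poincareCartanTwo 𝓔 𝓐 L A := by
  have : IsManifold (𝓡 n) 1 Q := IsManifold.of_le (n := ∞) (by simp)
  have : T2Space (PhaseSpace k (F →L[ℝ] ℝ) (DualBundle E)) :=
    have := FiberBundle.t2Space_totalSpace (F := Fin k → F →L[ℝ] ℝ)
      (E := WhitneySum k (DualBundle E))
    inferInstance
  refine ⟨existsUnique_isProlongation 𝓔 isChartProjectionAt_phaseProj,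
    existsUnique_isProlongation 𝓔 isChartProjectionAt_phaseProj, fun 𝓐 𝓑 h𝓐 h𝓑 => ?_⟩
  have hmor : IsLieAlgebroidMorphism 𝓐 𝓑 (legendre L hL) (prolongationLegendre 𝓔 L hL) :=
    -- The Legendre transformation preserves base points definitionally, so the projection of the
    -- Lagrangian side is the composite of the Hamiltonian projection with it.
    isLieAlgebroidMorphism_prolongation (contMDiff_legendre L hL)
      (isChartProjectionAt_phaseProj (E := E)) isChartProjectionAt_phaseProj
      (fun _ _ => rfl) (fun _ _ => rfl) h𝓐 h𝓑
  have hone : ∀ A : Fin k, pullbackForm (legendre L hL) (prolongationLegendre 𝓔 L hL)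
      (liouvilleOne 𝓔 A) = poincareCartanOne 𝓔 𝓐 L A := fun A => by
    funext p
    refine AlternatingMap.ext fun v => ?_
    -- At (a, v) the pullback of the Liouville section is ℓ^A(a), by definition the derivative of L
    -- along the shift curve of a. The Poincaré–Cartan section is dL on the tangent vector of that
    -- curve.
    have h1 := mfderiv_verticalVector hL A p (v 0).1.1
    refine h1.symm.trans ?_
    change _ = mfderiv (phaseModel n k F) 𝓘(ℝ, ℝ) L p
      (𝓐.anchor p (verticalEndomorphism 𝓔 A p (v 0)))
    rw [h𝓐.anchor_apply]
    rfl
  refine ⟨hmor, fun A => ⟨hone A, ?_⟩⟩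
  -- Naturality of the differential is available for smooth forms only; here it is applied to the
  -- Liouville 1-section.
  have hsmooth : IsSmoothForm (phaseModel n k (F →L[ℝ] ℝ)) (hamiltonianSections 𝓔 k)
      (liouvilleOne 𝓔 A) := fun X =>
    contMDiff_dual_apply (f := fun p => p) contMDiff_id A (X 0).2.1
  have h2 := hmor.d_pullback 1 (liouvilleOne 𝓔 A) hsmooth
  rw [hone] at h2
  unfold liouvilleTwo poincareCartanTwo
  rw [h2]
  rfl
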